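/- Let $d\ge 2$ be an integer and let $F$ be a probability distribution on the symmetric group $\mathrm{Sym}(d)$, whose elements are regarded as permutations of $\{1,\dots,d\}$. Let $T_d$ be the infinite rooted $d$-ary tree, in which every node $s$ has $d$ children $s1,\dots,sd$. Give the nodes $s$ independent labels $\alpha_s\in\mathrm{Sym}(d)$ with law $F$. Independently of the labels and independently for different nodes, let $U^s_1,\dots,U^s_{d-1}$ be independent uniform points of $[0,1]$, let $0=U^s_{(0)}\le U^s_{(1)}\le\dots\le U^s_{(d-1)}\le U^s_{(d)}=1$ be their order statistics completed by the endpoints, and put $\tau_{si}=U^s_{(i)}-U^s_{(i-1)}$ for $1\le i\le d$. Associate to each node a square as follows. The square of the root is $[0,1]^2$. If the square of $s$ is $[x,x+\ell]\times[y,y+\ell]$, then the square of $si$ is the square with side length $\ell\,\tau_{si}$ and lower left corner $$\Bigl(x+\ell\sum_{j<i}\tau_{sj},\; y+\ell\sum_{j:\,\alpha_s(j)<\alpha_s(i)}\tau_{sj}\Bigr).$$ Let $\mu_n$ be the probability measure that is uniform on each of the squares of the $d^n$ nodes of level $n$, giving to each of them a mass equal to its side length. Almost surely, $\mu_n$ converges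 weakly to a permuton (a probability measure on $[0,1]^2$ with uniform marginals); this random limit is denoted by $\mu=\mu_{F,\mathrm{Unif}}$. For a permuton $\nu$ let $H_n(\nu)=-\sum_{\sigma\in\mathrm{Sym}(n)}t(\sigma,\nu)\log t(\sigma,\nu)$ (with $0\log 0=0$), where $t(\sigma,\nu)$ is the probability that $n$ independent points with law $\nu$, read from left to right, have their heights in the same relative order as $\sigma(1),\dots,\sigma(n)$. Then there is a deterministic constant $c\in[0,+\infty)$, depending only on $d$ and $F$, such that $H_n(\mu)/n\to c$ almost surely as $n\to\infty$. Moreover, $c=0$ if and only if $F$ is a Dirac measure on the identity permutation $(1,2,\dots,d)$ or on the reversal permutation $(d,d-1,\dots,1)$. -/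

import Mathlib

open MeasureTheory ProbabilityTheory Filter Topology

namespace RandomPermuton

noncomputable section

/-! ### Permutons and their sampling entropy -/

/-- A permuton: a measure on the plane both of whose marginals are the uniform distribution on
`[0, 1]` (so it is a probability measure carried by the unit square). -/
def IsPermuton (μ : Measure (ℝ × ℝ)) : Prop :=
  μ.map Prod.fst = volume.restrict (Set.Icc (0 : ℝ) 1) ∧
    μ.map Prod.snd = volume.restrict (Set.Icc (0 : ℝ) 1)

/-- The points `p 0, …, p (n - 1)` determine the pattern `σ`: if `e` enumerates them from left to
right, then their heights, read in this order, are ordered as `σ 0, …, σ (n - 1)`. -/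
def HasPattern {n : ℕ} (σ : Equiv.Perm (Fin n)) (p : Fin n → ℝ × ℝ) : Prop :=
  ∃ e : Equiv.Perm (Fin n), (StrictMono fun i => (p (e i)).1) ∧
    ∀ i j, (p (e i)).2 < (p (e j)).2 ↔ σ i < σ j

/-- The density `t(σ, μ)`: the probability that `n` independent points with law `μ` determine the
pattern `σ`. -/
def patternDensity (μ : Measure (ℝ × ℝ)) {n : ℕ} (σ : Equiv.Perm (Fin n)) : ℝ :=
  (Measure.pi fun _ : Fin n => μ).real {p | HasPattern σ p}

/-- The sampling entropy `H_n(μ)`: the Shannon entropy (natural logarithm) of the random pattern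
determined by `n` independent points with law `μ`. -/
def samplingEntropy (μ : Measure (ℝ × ℝ)) (n : ℕ) : ℝ :=
  ∑ σ : Equiv.Perm (Fin n), Real.negMulLog (patternDensity μ σ)

/-! ### Permutons from labelled and weighted `d`-ary trees -/

/-- Nodes of the infinite rooted `d`-ary tree. A node is the list of the child indices on the path
from the root, the *last* step being the head of the list: `[]` is the root, and `i :: s` is the
`i`-th child of `s`. -/
abbrev Node (d : ℕ) : Type := List (Fin d)

variable {d : ℕ}

/-- Side length of the square of a node: the product of the weights of the edges on the path from
the root. Here `w s i` is the weight of the edge from `s` to its child `i :: s`. -/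
def side (w : Node d → Fin d → ℝ) : Node d → ℝ
  | [] => 1
  | i :: s => side w s * w s i

/-- Abscissa of the lower left corner of the square of a node: inside the square of `s`, the
children of `s` follow each other from left to right in their natural order. -/
def left (w : Node d → Fin d → ℝ) : Node d → ℝ
  | [] => 0
  | i :: s => left w s + side w s * ∑ j with j < i, w s j

/-- Ordinate of the lower left corner of the square of a node: inside the square of `s`, the
children of `s` are ordered from bottom to top as prescribed by the permutation `S s`. -/
def bottom (S : Node d → Equiv.Perm (Fin d)) (w : Node d → Fin d → ℝ) : Node d → ℝ
  | [] => 0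
  | i :: s => bottom S w s + side w s * ∑ j with S s j < S s i, w s j

/-- The square of a node. -/
def square (S : Node d → Equiv.Perm (Fin d)) (w : Node d → Fin d → ℝ) (s : Node d) : Set (ℝ × ℝ) :=
  Set.Icc (left w s) (left w s + side w s) ×ˢ Set.Icc (bottom S w s) (bottom S w s + side w s)

/-- The `n`-th approximation: the square of each node `s` of level `n` carries mass `side w s`,
distributed uniformly on this square. -/
def approx (S : Node d → Equiv.Perm (Fin d)) (w : Node d → Fin d → ℝ) (n : ℕ) :
    FiniteMeasure (ℝ × ℝ) :=
  ⟨∑ v : Fin n → Fin d,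
    ENNReal.ofReal (side w (List.ofFn v)) • ProbabilityTheory.cond volume (square S w (List.ofFn v)), by
      have (v : Fin n → Fin d) : IsFiniteMeasure (ENNReal.ofReal (side w (List.ofFn v)) •
          ProbabilityTheory.cond volume (square S w (List.ofFn v))) :=
        Measure.smul_finite _ ENNReal.ofReal_ne_top
      infer_instance⟩

/-- `μ` is the permuton given by the vertex labels `S` and the edge weights `w`: a permuton which is
the weak limit of the approximations (weak limits being unique, there is at most one). -/
def IsTreePermuton (S : Node d → Equiv.Perm (Fin d)) (w : Node d → Fin d → ℝ)
    (μ : FiniteMeasure (ℝ × ℝ)) : Prop :=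
  IsPermuton (μ : Measure (ℝ × ℝ)) ∧ Tendsto (approx S w) atTop (𝓝 μ)

/-! ### The random labels and weights -/

/-- The points `0 = U_(0) ≤ U_(1) ≤ … ≤ U_(m) ≤ U_(m+1) = 1`, where `U_(1) ≤ … ≤ U_(m)` are the
order statistics of `U 0, …, U (m - 1)`. -/
def orderStat {m : ℕ} (U : Fin m → unitInterval) : ℕ → ℝ
  | 0 => 0
  | k + 1 => if h : k < m then (U (Tuple.sort U ⟨k, h⟩) : ℝ) else 1

/-- The `d` spacings of `d - 1` points in `[0, 1]`. -/
def spacing (U : Fin (d - 1) → unitInterval) (i : Fin d) : ℝ :=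
  orderStat U (i + 1) - orderStat U i

instance : MeasurableSpace (Equiv.Perm (Fin d)) := ⊤

/-- The randomness attached to the nodes of the tree: each node carries a permutation and `d - 1`
points of `[0, 1]`. -/
abbrev Sample (d : ℕ) : Type := Node d → Equiv.Perm (Fin d) × (Fin (d - 1) → unitInterval)

/-- All the permutations and all the points are independent; the permutations have law `F`, the
points are uniformly distributed on `[0, 1]`. -/
def sampleLaw (F : Measure (Equiv.Perm (Fin d))) [IsProbabilityMeasure F] : Measure (Sample d) :=
  Measure.infinitePi fun _ => F.prod (Measure.pi fun _ => (volume : Measure unitInterval))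

/-- The vertex labels. -/
def labels (ω : Sample d) (s : Node d) : Equiv.Perm (Fin d) := (ω s).1

/-- The edge weights: the edges from `s` to its children carry the spacings of the points at `s`. -/
def weights (ω : Sample d) (s : Node d) (i : Fin d) : ℝ := spacing (ω s).2 i

end

end RandomPermuton

open RandomPermuton

/-! The limit permuton is self-similar. It is the image of Lebesgue measure under `x ↦ (x, ordinate
x)`, and it consists of `d` scaled copies of the permutons of the subtrees at the children of the
root, placed in the cells of the root label (`treePermuton_eq_inflate`). It is a permuton and the
weak limit of the approximations as soon as the squares shrink uniformly. This happens almost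
surely, because the sum of the squared sides at level `k` has mean `(2 / (d + 1)) ^ k`.

Self-similarity gives a recursion for the entropy. Colour each of the `n` sampled points by its
cell. Once the colours are known, the pattern and the family of patterns inside the cells determine
each other, and the cells are independent. The law of the pattern depends on the colouring only
through the `d` colour counts, which take at most `(n + 1) ^ d` values. Hence `H_n` of the whole
exceeds the sum over the children of the binomially thinned entropies by a `rootTerm` between `0`
and `d log (n + 1)` (`sum_thin_le_samplingEntropy`, `samplingEntropy_le_sum_thin`).

Taking expectations, `h n = meanEntropy F n` satisfies `h n = ∑ k, occupancy (d - 1) n k * h k +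
O(log n)`. Since `∑ k, k * occupancy (d - 1) n k = n`, the ratio `h n / n` solves a renewal
equation, up to an error `O(1 / √n)`, for the stochastic kernel `k * occupancy (d - 1) n k / n`.
This kernel is at most of order `k / n ^ 2`, and at least of that order for `2 * k ≤ n`. A
comparison argument, `IsScaleKernel.exists_tendsto`, shows that `h n / n` converges; the limit is
`c`.

For almost sure convergence the recursion is unrolled down to a level with at most `√n` nodes
(`sampleEntropy_eq`). The root terms above it contribute `O(√n log n)`. The thinned means contribute
`c n + o(n)`. The centred remainder loses a factor `2 / (d + 1)` of its second moment at each level,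
because different subtrees are independent. Its normalised second moments are therefore summable
along a sequence of powers, and the inequality `H_n ≤ H_{n+1} + log (n + 1)` fills the gaps
(`tendsto_div_of_tendsto_pow`).

For the two degenerate laws the permuton is a diagonal of the square and all entropies vanish.
Conversely, a single positive mean entropy keeps `h n / n` away from zero
(`IsScaleKernel.exists_pos_le`), so `c = 0` forces `h 2 = 0`. Then almost all pairs of points are in
increasing position, or almost all in decreasing position. The same orientation holds in the
subtrees, so the root and its child carry the same extreme label. As these two labels are
independent, `F` is a Dirac measure. -/

namespace RandomPermuton
noncomputable section

/-! ### Discrete renewal inequalities on a logarithmic scale -/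

/-- A stochastic kernel on the positive integers, moving `n` to some `k ≤ n`, such that the law
of `k / n` has a density comparable to `x`, away from `x = 1`. -/
structure IsScaleKernel (w : ℕ → ℕ → ℝ) (C c : ℝ) : Prop where
  pos : 0 < c
  nonneg : ∀ n k, 0 ≤ w n k
  sum_eq_one : ∀ n, 1 ≤ n → ∑ k ∈ Finset.range (n + 1), w n k = 1
  le : ∀ n k, 1 ≤ n → k ≤ n → w n k ≤ C * k / n ^ 2
  ge : ∀ n k, 1 ≤ n → 2 * k ≤ n → c * k / n ^ 2 ≤ w n k

namespace IsScaleKernel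

variable {w : ℕ → ℕ → ℝ} {C c : ℝ}

lemma pos' (hw : IsScaleKernel w C c) : 0 < C := by
  have h1 := hw.le 2 1 (by norm_num) (by norm_num)
  have h2 := hw.ge 2 1 (by norm_num) (by norm_num)
  have := hw.pos
  norm_num at h1 h2
  linarith

lemma apply_zero (hw : IsScaleKernel w C c) {n : ℕ} (hn : 1 ≤ n) : w n 0 = 0 := by
  have h1 := hw.le n 0 hn (by omega)
  have h2 := hw.nonneg n 0
  simp at h1
  linarith

lemma diag_lt_one (hw : IsScaleKernel w C c) {n : ℕ} (hn : 2 ≤ n) : w n n < 1 := by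
  have h := hw.sum_eq_one n (by omega)
  have h1 : w n n + w n 1 ≤ ∑ k ∈ Finset.range (n + 1), w n k := by
    rw [← Finset.sum_pair (f := fun k => w n k) (show n ≠ 1 by omega)]
    apply Finset.sum_le_sum_of_subset_of_nonneg
    · intro k hk
      simp at hk ⊢
      omega
    · intro k _ _
      exact hw.nonneg n k
  have h2 := hw.ge n 1 (by omega) (by omega)
  have h3 : 0 < c * (1 : ℕ) / (n : ℝ) ^ 2 := by
    have := hw.pos
    have : (0 : ℝ) < n := by exact_mod_cast (by omega : 0 < n)
    positivity
  linarith

/-- A supersolution which on average exceeds `S` below `n` exceeds `S` above `n`. -/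
lemma le_of_super (hw : IsScaleKernel w C c) {x : ℕ → ℝ} {n : ℕ} {S : ℝ} (hn : 1 ≤ n)
    (hx : ∀ m, n < m → ∑ k ∈ Finset.range (m + 1), w m k * x k ≤ x m)
    (hS : ∀ m, n < m → S * ∑ k ∈ Finset.range (n + 1), w m k ≤
      ∑ k ∈ Finset.range (n + 1), w m k * x k) :
    ∀ m, n < m → S ≤ x m := by
  intro m
  induction m using Nat.strong_induction_on with
  | _ m ih =>
    intro hm
    have key : ∀ y : ℕ → ℝ, ∑ k ∈ Finset.range (m + 1), y k =
        ∑ k ∈ Finset.range (n + 1), y k + ∑ k ∈ Finset.Ico (n + 1) m, y k + y m := by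
      intro y
      rw [Finset.sum_range_succ, Finset.sum_range_add_sum_Ico _ (by omega)]
    have h1 := hw.sum_eq_one m (by omega)
    have h2 := hx m hm
    rw [key] at h1 h2
    have h3 := hS m hm
    have h4 : S * ∑ k ∈ Finset.Ico (n + 1) m, w m k ≤ ∑ k ∈ Finset.Ico (n + 1) m, w m k * x k := by
      rw [Finset.mul_sum]
      apply Finset.sum_le_sum
      intro k hk
      rw [Finset.mem_Ico] at hk
      have := ih k hk.2 (by omega)
      have := hw.nonneg m k
      nlinarith
    -- The average at `m` includes the unknown value `x m` itself; moving that term to the right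
    -- leaves the factor `1 - w m m`, which must be positive.
    have h5 := hw.diag_lt_one (n := m) (by omega)
    have h6 : S * (1 - w m m) ≤ x m * (1 - w m m) := by
      have : S * (1 - w m m) = S * ∑ k ∈ Finset.range (n + 1), w m k +
        S * ∑ k ∈ Finset.Ico (n + 1) m, w m k := by rw [← h1]; ring
      linarith
    exact le_of_mul_le_mul_right h6 (by linarith)

/-- This upper bound and the lower bound `ge` both scale like `1 / m ^ 2` in the starting point `m`.
The factor cancels, so the constant `S` in `le_of_super` can be chosen independently of `m`. -/
lemma sum_range_le (hw : IsScaleKernel w C c) {n m : ℕ} (hnm : n ≤ m) (hm : 1 ≤ m) :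
    ∑ k ∈ Finset.range (n + 1), w m k ≤ C * n ^ 2 / m ^ 2 := by
  calc ∑ k ∈ Finset.range (n + 1), w m k ≤ ∑ k ∈ Finset.range (n + 1), C / m ^ 2 * (k : ℝ) := by
        apply Finset.sum_le_sum
        intro k hk
        rw [Finset.mem_range] at hk
        refine (hw.le m k hm (by omega)).trans (le_of_eq (by ring))
    _ = C / m ^ 2 * ∑ k ∈ Finset.range (n + 1), (k : ℝ) := by rw [Finset.mul_sum]
    _ ≤ C / m ^ 2 * n ^ 2 := by
        have := hw.pos'
        gcongr
        rw [Finset.sum_range_succ']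
        simp only [Nat.cast_zero, add_zero]
        calc ∑ k ∈ Finset.range n, ((k + 1 : ℕ) : ℝ) ≤ ∑ k ∈ Finset.range n, (n : ℝ) := by
              apply Finset.sum_le_sum
              intro k hk
              rw [Finset.mem_range] at hk
              exact_mod_cast hk
          _ = n ^ 2 := by simp; ring
    _ = C * n ^ 2 / m ^ 2 := by ring

lemma sum_range_cast (n : ℕ) : ∑ k ∈ Finset.range (n + 1), (k : ℝ) = n * (n + 1) / 2 := by
  induction n with
  | zero => simp
  | succ n ih => rw [Finset.sum_range_succ, ih]; push_cast; ring

/-- Summing `c * k / n ^ 2` over `k ≤ ⌊n / 2⌋` gives at least `c * (n ^ 2 - 1) / (8 * n ^ 2)`, and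
`n ^ 2 - 1 ≥ 3 * n ^ 2 / 4` once `n ≥ 2`. -/
lemma le_sum_range_half (hw : IsScaleKernel w C c) {n : ℕ} (hn : 2 ≤ n) :
    3 * c / 32 ≤ ∑ k ∈ Finset.range (n / 2 + 1), w n k := by
  have hc := hw.pos
  have hn' : (2 : ℝ) ≤ n := by exact_mod_cast hn
  calc 3 * c / 32 ≤ c / n ^ 2 * (((n / 2 : ℕ) : ℝ) * (((n / 2 : ℕ) : ℝ) + 1) / 2) := by
        have h : (n : ℝ) ≤ 2 * ((n / 2 : ℕ) : ℝ) + 1 := by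
          exact_mod_cast (by omega : n ≤ 2 * (n / 2) + 1)
        rw [div_mul_eq_mul_div, div_le_div_iff₀ (by norm_num) (by positivity)]
        have : 3 * (n : ℝ) ^ 2 ≤ 16 * (((n / 2 : ℕ) : ℝ) * (((n / 2 : ℕ) : ℝ) + 1)) := by
          nlinarith
        nlinarith
    _ = ∑ k ∈ Finset.range (n / 2 + 1), c / n ^ 2 * (k : ℝ) := by
        rw [← Finset.mul_sum, sum_range_cast]
    _ ≤ _ := by
        apply Finset.sum_le_sum
        intro k hk
        rw [Finset.mem_range] at hk
        refine le_trans (le_of_eq (by ring)) (hw.ge n k (by omega) (by omega))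

/-- The kernel increases `1 / √n` by a fixed factor. -/
lemma exists_gain (hw : IsScaleKernel w C c) : ∃ κ : ℝ, 0 < κ ∧ ∀ n : ℕ, 2 ≤ n →
    (1 + κ) * (1 / √(n : ℝ)) ≤ ∑ k ∈ Finset.range (n + 1), w n k * (1 / √(k : ℝ)) := by
  have hs2 : 1 < √(2 : ℝ) := by
    rw [Real.lt_sqrt (by norm_num)]; norm_num
  -- Mass at least `3 * c / 32` lands at some `k ≤ n / 2`, where `1 / √k` is at least `√2 / √n`; the
  -- remaining mass does not decrease `1 / √n`.
  refine ⟨3 * c / 32 * (√2 - 1), mul_pos (by have := hw.pos; positivity) (by linarith), ?_⟩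
  intro n hn
  have hn0 : (0 : ℝ) < n := by exact_mod_cast (by omega : 0 < n)
  have hsn : 0 < √(n : ℝ) := Real.sqrt_pos.2 hn0
  have h1 := hw.sum_eq_one n (by omega)
  have h2 := hw.le_sum_range_half hn
  have hsplit : ∀ y : ℕ → ℝ, ∑ k ∈ Finset.range (n + 1), y k =
      ∑ k ∈ Finset.range (n / 2 + 1), y k + ∑ k ∈ Finset.Ico (n / 2 + 1) (n + 1), y k := by
    intro y
    rw [Finset.sum_range_add_sum_Ico _ (by omega)]
  rw [hsplit] at h1 ⊢
  have h3 : (∑ k ∈ Finset.range (n / 2 + 1), w n k) * (√2 * (1 / √(n : ℝ))) ≤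
      ∑ k ∈ Finset.range (n / 2 + 1), w n k * (1 / √(k : ℝ)) := by
    rw [Finset.sum_mul]
    apply Finset.sum_le_sum
    intro k hk
    rw [Finset.mem_range] at hk
    rcases Nat.eq_zero_or_pos k with rfl | hk0
    · simp [hw.apply_zero (n := n) (by omega)]
    apply mul_le_mul_of_nonneg_left _ (hw.nonneg n k)
    have hk0' : (0 : ℝ) < k := by exact_mod_cast hk0
    have hsk : 0 < √(k : ℝ) := Real.sqrt_pos.2 hk0'
    rw [mul_one_div, div_le_div_iff₀ hsn hsk, one_mul, ← Real.sqrt_mul (by norm_num)]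
    apply Real.sqrt_le_sqrt
    exact_mod_cast (by omega : 2 * k ≤ n)
  have h4 : (∑ k ∈ Finset.Ico (n / 2 + 1) (n + 1), w n k) * (1 / √(n : ℝ)) ≤
      ∑ k ∈ Finset.Ico (n / 2 + 1) (n + 1), w n k * (1 / √(k : ℝ)) := by
    rw [Finset.sum_mul]
    apply Finset.sum_le_sum
    intro k hk
    rw [Finset.mem_Ico] at hk
    apply mul_le_mul_of_nonneg_left _ (hw.nonneg n k)
    have hk0' : (0 : ℝ) < k := by exact_mod_cast (by omega : 0 < k)
    have hsk : 0 < √(k : ℝ) := Real.sqrt_pos.2 hk0'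
    apply one_div_le_one_div_of_le hsk
    apply Real.sqrt_le_sqrt
    exact_mod_cast (by omega : k ≤ n)
  refine le_trans ?_ (add_le_add h3 h4)
  have : (∑ k ∈ Finset.range (n / 2 + 1), w n k) * (√2 * (1 / √(n : ℝ))) +
      (∑ k ∈ Finset.Ico (n / 2 + 1) (n + 1), w n k) * (1 / √(n : ℝ)) =
      (1 + (∑ k ∈ Finset.range (n / 2 + 1), w n k) * (√2 - 1)) * (1 / √(n : ℝ)) := by
    linear_combination (1 / √(n : ℝ)) * h1
  rw [this]
  apply mul_le_mul_of_nonneg_right _ (by positivity)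
  have := mul_le_mul_of_nonneg_right h2 (show 0 ≤ √2 - 1 by linarith)
  linarith

/-- An approximate supersolution becomes a supersolution after subtracting a multiple of
`1 / √n`. -/
lemma exists_super (hw : IsScaleKernel w C c) {E : ℝ} (hE : 0 ≤ E) : ∃ B : ℝ, 0 ≤ B ∧
    ∀ g : ℕ → ℝ, (∀ n, 2 ≤ n → ∑ k ∈ Finset.range (n + 1), w n k * g k ≤ g n + E / √(n : ℝ)) →
      ∀ n, 2 ≤ n → ∑ k ∈ Finset.range (n + 1), w n k * (g k - B * (1 / √(k : ℝ))) ≤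
        g n - B * (1 / √(n : ℝ)) := by
  obtain ⟨κ, hκ, h⟩ := hw.exists_gain
  -- One application of the kernel raises `(E / κ) / √n` by at least `E / √n`, which is exactly the
  -- permitted error.
  refine ⟨E / κ, by positivity, ?_⟩
  intro g hg n hn
  have h1 := h n hn
  have h2 := hg n hn
  have h3 : ∑ k ∈ Finset.range (n + 1), w n k * (g k - E / κ * (1 / √(k : ℝ))) =
      ∑ k ∈ Finset.range (n + 1), w n k * g k -
        E / κ * ∑ k ∈ Finset.range (n + 1), w n k * (1 / √(k : ℝ)) := by
    rw [Finset.mul_sum, ← Finset.sum_sub_distrib]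
    exact Finset.sum_congr rfl fun k _ => by ring
  rw [h3]
  have h4 := mul_le_mul_of_nonneg_left h1 (show 0 ≤ E / κ by positivity)
  have h5 : E / κ * ((1 + κ) * (1 / √(n : ℝ))) = E / κ * (1 / √(n : ℝ)) + E / √(n : ℝ) := by
    field_simp
  linarith

lemma bddAbove_of_sub (hw : IsScaleKernel w C c) {E : ℝ} (hE : 0 ≤ E) {g : ℕ → ℝ}
    (hg : ∀ n, 2 ≤ n → g n ≤ ∑ k ∈ Finset.range (n + 1), w n k * g k + E / √(n : ℝ)) :
    ∃ A : ℝ, ∀ n, g n ≤ A := by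
  obtain ⟨B, hB, h⟩ := hw.exists_super hE
  have h1 := h (fun n => - g n) (fun n hn => by
    have := hg n hn
    simp only [mul_neg, Finset.sum_neg_distrib]
    linarith)
  -- At threshold `1` only the site `k = 1` counts, since `w m 0 = 0`. Its value is `S`, so the
  -- hypothesis on averages is an equality.
  have h2 := hw.le_of_super (n := 1) (S := -g 1 - B * (1 / √((1 : ℕ) : ℝ))) le_rfl
    (fun m hm => h1 m hm) (fun m hm => by
      simp only [Finset.sum_range_succ, Finset.sum_range_zero, zero_add,
        hw.apply_zero (n := m) (by omega)]
      linarith)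
  refine ⟨max (g 0) (g 1 + B), fun n => ?_⟩
  rcases Nat.lt_or_ge 1 n with hn | hn
  · apply le_max_of_le_right
    have := h2 n hn
    simp at this
    have h3 : 0 ≤ B * (√(n : ℝ))⁻¹ := by positivity
    linarith
  · interval_cases n
    · exact le_max_left _ _
    · exact le_max_of_le_right (by linarith)

/-- If a supersolution is nonnegative from `m₀` on and is infinitely often at most `η`, then its
averages are of order at most `η` at every scale. -/
lemma average_le (hw : IsScaleKernel w C c) {x : ℕ → ℝ} {m₀ : ℕ} {M η : ℝ} (hη : 0 < η)
    (hx : ∀ m, 2 ≤ m → ∑ k ∈ Finset.range (m + 1), w m k * x k ≤ x m)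
    (hpos : ∀ k, m₀ ≤ k → 0 ≤ x k) (hM : 0 ≤ M) (hlow : ∀ k, -M ≤ x k)
    (hfreq : ∃ᶠ m in atTop, x m ≤ η) {n : ℕ} (hn : 1 ≤ n) :
    c * ∑ k ∈ Finset.range (n + 1), (if m₀ ≤ k ∧ 2 * k ≤ n then (k : ℝ) * x k else 0) ≤
      C * η * n ^ 2 + C * M * m₀ ^ 2 := by
  by_contra hcon
  push Not at hcon
  set T := ∑ k ∈ Finset.range (n + 1), (if m₀ ≤ k ∧ 2 * k ≤ n then (k : ℝ) * x k else 0) with hT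
  have hC := hw.pos'
  have hc := hw.pos
  have hn0 : (0 : ℝ) < n := by exact_mod_cast hn
  have hSη : η < (c * T - C * M * m₀ ^ 2) / (C * n ^ 2) := by
    rw [lt_div_iff₀ (by positivity)]
    linarith
  -- From any `m > n`, the good sites contribute at least `c * T / m ^ 2`, the sites below `m₀` cost
  -- at most `C * M * m₀ ^ 2 / m ^ 2`, and the mass at or below `n` is at most `C * n ^ 2 / m ^ 2`.
  -- So `S` is a lower bound for `x` beyond `n`, and `S > η` contradicts `hfreq`.
  set S := (c * T - C * M * m₀ ^ 2) / (C * n ^ 2) with hS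
  have key := hw.le_of_super (S := S) hn (fun m hm => hx m (by omega)) (fun m hm => by
    have hm0 : (0 : ℝ) < m := by exact_mod_cast (by omega : 0 < m)
    have h1 := hw.sum_range_le (n := n) (m := m) hm.le (by omega)
    have h2 : S * ∑ k ∈ Finset.range (n + 1), w m k ≤ S * (C * n ^ 2 / m ^ 2) :=
      mul_le_mul_of_nonneg_left h1 (by linarith)
    have h3 : S * (C * n ^ 2 / m ^ 2) = (c * T - C * M * m₀ ^ 2) / m ^ 2 := by
      rw [hS]; field_simp
    have h4 : ∑ k ∈ Finset.range (n + 1), (c / m ^ 2 *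
        (if m₀ ≤ k ∧ 2 * k ≤ n then (k : ℝ) * x k else 0) -
          C * M / m ^ 2 * (if k < m₀ then (m₀ : ℝ) else 0)) ≤
        ∑ k ∈ Finset.range (n + 1), w m k * x k := by
      apply Finset.sum_le_sum
      intro k hk
      rw [Finset.mem_range] at hk
      have hwk := hw.nonneg m k
      by_cases hkm : k < m₀
      · rw [if_neg (by omega), if_pos hkm]
        have h5 := hw.le m k (by omega) (by omega)
        have h6 : C * k / (m : ℝ) ^ 2 ≤ C * m₀ / (m : ℝ) ^ 2 := by
          gcongr
        have h7 := hlow k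
        have h8 : w m k * (-M) ≤ w m k * x k := mul_le_mul_of_nonneg_left h7 hwk
        have h9 : w m k * M ≤ C * m₀ / (m : ℝ) ^ 2 * M :=
          mul_le_mul_of_nonneg_right (h5.trans h6) hM
        have h10 : C * m₀ / (m : ℝ) ^ 2 * M = C * M / m ^ 2 * m₀ := by ring
        linarith
      · rw [if_neg hkm]
        have h5 := hpos k (by omega)
        by_cases h2k : 2 * k ≤ n
        · rw [if_pos ⟨by omega, h2k⟩]
          have h6 := hw.ge m k (by omega) (by omega)
          have h7 := mul_le_mul_of_nonneg_right h6 h5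
          have h8 : c * k / (m : ℝ) ^ 2 * x k = c / m ^ 2 * (k * x k) := by ring
          linarith
        · rw [if_neg (by omega)]
          have := mul_nonneg hwk h5
          linarith
    have h5 : ∑ k ∈ Finset.range (n + 1), (if k < m₀ then (m₀ : ℝ) else 0) ≤ m₀ ^ 2 := by
      rw [← Finset.sum_filter, Finset.sum_const, nsmul_eq_mul, sq]
      apply mul_le_mul_of_nonneg_right _ (by positivity)
      have : (Finset.filter (fun k => k < m₀) (Finset.range (n + 1))).card ≤ m₀ := by
        calc _ ≤ (Finset.range m₀).card := by
              apply Finset.card_le_card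
              intro k hk
              simp at hk ⊢
              exact hk.2
          _ = m₀ := by simp
      exact_mod_cast this
    rw [Finset.sum_sub_distrib, ← Finset.mul_sum, ← Finset.mul_sum, ← hT] at h4
    have h6 := mul_le_mul_of_nonneg_left h5 (show 0 ≤ C * M / (m : ℝ) ^ 2 by positivity)
    have h7 : (c * T - C * M * m₀ ^ 2) / (m : ℝ) ^ 2 =
      c / m ^ 2 * T - C * M / m ^ 2 * m₀ ^ 2 := by ring
    linarith)
  obtain ⟨m, hm, hmn⟩ := (hfreq.and_eventually (eventually_gt_atTop n)).exists
  linarith [key m hmn]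

lemma tendsto_const_mul_one_div_sqrt (B : ℝ) :
    Tendsto (fun n : ℕ => B * (1 / √(n : ℝ))) atTop (𝓝 0) := by
  have h : Tendsto (fun n : ℕ => √(n : ℝ)) atTop atTop :=
    Real.tendsto_sqrt_atTop.comp tendsto_natCast_atTop_atTop
  have := h.inv_tendsto_atTop.const_mul B
  simpa using this

/-- The closing arithmetic of `exists_tendsto`: the lower bound has leading term `c * D * N ^ 2`,
the two upper bounds together only half of it, so `N` cannot be arbitrarily large. -/
lemma sq_bound_of_add_le {c D C M m N X Z : ℝ} (h1 : c * X ≤ c * D / 4 * N ^ 2 + C * M * m ^ 2)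
    (h2 : c * Z ≤ c * D / 4 * N ^ 2 + C * M * m ^ 2)
    (h4 : c * (D / 2 * (2 * N ^ 2 - m ^ 2)) ≤ c * X + c * Z) :
    c * D / 2 * N ^ 2 ≤ c * D / 2 * m ^ 2 + 2 * C * M * m ^ 2 := by
  linarith

set_option maxHeartbeats 600000 in
/-- A bounded approximate solution of the renewal equation converges. -/
theorem exists_tendsto (hw : IsScaleKernel w C c) {E A : ℝ} (hE : 0 ≤ E) {g : ℕ → ℝ}
    (hA : ∀ n, |g n| ≤ A)
    (hg : ∀ n, 2 ≤ n → |g n - ∑ k ∈ Finset.range (n + 1), w n k * g k| ≤ E / √(n : ℝ)) :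
    ∃ l : ℝ, Tendsto g atTop (𝓝 l) := by
  have hA0 : 0 ≤ A := (abs_nonneg _).trans (hA 0)
  have hba : IsBoundedUnder (· ≤ ·) atTop g :=
    isBoundedUnder_of ⟨A, fun n => (abs_le.1 (hA n)).2⟩
  have hbb : IsBoundedUnder (· ≥ ·) atTop g :=
    isBoundedUnder_of ⟨-A, fun n => (abs_le.1 (hA n)).1⟩
  set a := liminf g atTop with ha
  set b := limsup g atTop with hb
  have hab : a ≤ b := liminf_le_limsup hba hbb
  rcases hab.eq_or_lt with heq | hlt
  · exact ⟨b, tendsto_of_liminf_eq_limsup (ha.symm.trans heq) hb.symm hba hbb⟩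
  exfalso
  have hC := hw.pos'
  have hc := hw.pos
  obtain ⟨B, hB, hsup⟩ := hw.exists_super hE
  set D := b - a with hD
  have hD0 : 0 < D := by linarith
  -- The constant is such that `η = 2 * δ` and `n = 4 * N` turn the bound `C * η * n ^ 2` of
  -- `average_le` into `c * D / 4 * N ^ 2`.
  set δ := c * D / (128 * C) with hδ
  have hδ0 : 0 < δ := by positivity
  have hshift : ∀ (g : ℕ → ℝ) (t : ℝ) (n : ℕ), 2 ≤ n →
      ∑ k ∈ Finset.range (n + 1), w n k * (g k - t) =
      ∑ k ∈ Finset.range (n + 1), w n k * g k - t := by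
    intro g t n hn
    simp only [mul_sub, Finset.sum_sub_distrib, ← Finset.sum_mul, hw.sum_eq_one n (by omega)]
    ring
  -- Both `g` and `-g` are approximate supersolutions. After the correction by `B / √n` and the
  -- shifts by `a - δ` and `-b - δ`, each is eventually nonnegative and infinitely often at most `2
  -- * δ`, so both have small averages. Yet their sum is eventually at least `D / 2`, a
  -- contradiction.
  have hx := fun n hn => hsup g (fun n hn => by have := (abs_le.1 (hg n hn)).1; linarith) n hn
  have hz := fun n hn => hsup (fun n => - g n) (fun n hn => by
    have := (abs_le.1 (hg n hn)).2
    simp only [mul_neg, Finset.sum_neg_distrib]; linarith) n hn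
  obtain ⟨m₀, hm₀⟩ : ∃ m₀ : ℕ, ∀ k ≥ m₀, 0 ≤ g k - B * (1 / √(k : ℝ)) - (a - δ) ∧
      0 ≤ -g k - B * (1 / √(k : ℝ)) - (-b - δ) ∧ B * (1 / √(k : ℝ)) ≤ D / 4 := by
    rw [← eventually_atTop]
    have h1 : ∀ᶠ k in atTop, a - δ / 2 < g k :=
      eventually_lt_of_lt_liminf (by linarith) hbb
    have h2 : ∀ᶠ k in atTop, g k < b + δ / 2 :=
      eventually_lt_of_limsup_lt (by linarith) hba
    have h3 := (tendsto_const_mul_one_div_sqrt B).eventually_lt_const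
      (show 0 < min (δ / 2) (D / 4) by positivity)
    filter_upwards [h1, h2, h3] with k h1 h2 h3
    have h4 := h3.trans_le (min_le_left _ _)
    have h5 := h3.trans_le (min_le_right _ _)
    exact ⟨by linarith, by linarith, h5.le⟩
  have hBk : ∀ k : ℕ, B * (1 / √(k : ℝ)) ≤ B := by
    intro k
    rcases Nat.eq_zero_or_pos k with rfl | hk
    · simpa using hB
    have : 1 ≤ √(k : ℝ) := by
      rw [Real.one_le_sqrt]; exact_mod_cast hk
    calc B * (1 / √(k : ℝ)) ≤ B * 1 := by
          gcongr
          rw [div_le_one (by linarith)]; exact this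
      _ = B := mul_one B
  have hB0k : ∀ k : ℕ, 0 ≤ B * (1 / √(k : ℝ)) := fun k => by positivity
  set M := A + B + |a| + |b| + δ with hM
  have hM0 : 0 ≤ M := by positivity
  have hX : ∀ n : ℕ, 1 ≤ n → _ := fun n hn => hw.average_le (x := fun k => g k - B * (1 / √(k : ℝ)) - (a - δ))
    (m₀ := m₀) (M := M) (η := 2 * δ) (by linarith)
    (fun m hm => by rw [hshift _ _ m hm]; linarith [hx m hm])
    (fun k hk => (hm₀ k hk).1) hM0
    (fun k => by
      have := (abs_le.1 (hA k)).1
      have := hBk k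
      have := le_abs_self a
      have := abs_nonneg b
      linarith)
    (by
      have : ∃ᶠ m in atTop, g m < a + δ := frequently_lt_of_liminf_lt (hba.isCoboundedUnder_ge) (by linarith)
      refine this.mono fun m hm => ?_
      have := hB0k m
      linarith) hn
  have hZ : ∀ n : ℕ, 1 ≤ n → _ := fun n hn => hw.average_le (x := fun k => -g k - B * (1 / √(k : ℝ)) - (-b - δ))
    (m₀ := m₀) (M := M) (η := 2 * δ) (by linarith)
    (fun m hm => by
      rw [hshift (fun k => -g k - B * (1 / √(k : ℝ))) _ m hm]; linarith [hz m hm])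
    (fun k hk => (hm₀ k hk).2.1) hM0
    (fun k => by
      have := (abs_le.1 (hA k)).2
      have := hBk k
      have := neg_abs_le b
      have := abs_nonneg a
      linarith)
    (by
      have : ∃ᶠ m in atTop, b - δ < g m := frequently_lt_of_lt_limsup (hbb.isCoboundedUnder_le) (by linarith)
      refine this.mono fun m hm => ?_
      have := hB0k m
      linarith) hn
  obtain ⟨N, hN⟩ := exists_nat_gt (((c * D / 2) * m₀ ^ 2 + 2 * C * M * m₀ ^ 2) / (c * D / 2) + 1)
  have hN1 : (1 : ℝ) < N := by
    refine lt_of_le_of_lt ?_ hN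
    have : 0 ≤ ((c * D / 2) * m₀ ^ 2 + 2 * C * M * m₀ ^ 2) / (c * D / 2) := by positivity
    linarith
  have hN1' : 1 < N := by exact_mod_cast hN1
  have h1 := hX (4 * N) (by omega)
  have h2 := hZ (4 * N) (by omega)
  -- The indices with `2 * k ≤ 4 * N` are those with `k ≤ 2 * N`, and `∑ k ≤ 2N, k = N * (2 * N + 1)
  -- ≥ 2 * N ^ 2`. The term `m₀ ^ 2` pays for the omitted indices below `m₀`.
  have h3 : (D / 2) * (2 * (N : ℝ) ^ 2 - m₀ ^ 2) ≤ ∑ k ∈ Finset.range (4 * N + 1),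
      (if m₀ ≤ k ∧ 2 * k ≤ 4 * N then (k : ℝ) * (g k - B * (1 / √(k : ℝ)) - (a - δ)) else 0) +
      ∑ k ∈ Finset.range (4 * N + 1),
      (if m₀ ≤ k ∧ 2 * k ≤ 4 * N then (k : ℝ) * (-g k - B * (1 / √(k : ℝ)) - (-b - δ)) else 0) := by
    rw [← Finset.sum_add_distrib]
    have h4 : ∑ k ∈ Finset.range (2 * N + 1), (D / 2 * (k : ℝ) -
        D / 2 * (if k < m₀ then (m₀ : ℝ) else 0)) ≤
        ∑ k ∈ Finset.range (4 * N + 1),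
      ((if m₀ ≤ k ∧ 2 * k ≤ 4 * N then (k : ℝ) * (g k - B * (1 / √(k : ℝ)) - (a - δ)) else 0) +
      (if m₀ ≤ k ∧ 2 * k ≤ 4 * N then (k : ℝ) * (-g k - B * (1 / √(k : ℝ)) - (-b - δ)) else 0)) := by
      rw [← Finset.sum_range_add_sum_Ico _ (show 2 * N + 1 ≤ 4 * N + 1 by omega)]
      refine le_trans ?_ (le_add_of_nonneg_right ?_)
      · apply Finset.sum_le_sum
        intro k hk
        rw [Finset.mem_range] at hk
        by_cases hkm : k < m₀
        · rw [if_pos hkm, if_neg (by omega), if_neg (by omega)]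
          have : (k : ℝ) ≤ m₀ := by exact_mod_cast hkm.le
          nlinarith
        · rw [if_neg hkm, if_pos ⟨by omega, by omega⟩, if_pos ⟨by omega, by omega⟩]
          have := (hm₀ k (by omega)).2.2
          have hk0 : (0 : ℝ) ≤ k := by positivity
          have : D / 2 ≤ (g k - B * (1 / √(k : ℝ)) - (a - δ)) +
            (-g k - B * (1 / √(k : ℝ)) - (-b - δ)) := by linarith
          nlinarith
      · apply Finset.sum_nonneg
        intro k _
        apply add_nonneg
        · split_ifs with h
          · exact mul_nonneg (by positivity) (hm₀ k h.1).1
          · exact le_rfl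
        · split_ifs with h
          · exact mul_nonneg (by positivity) (hm₀ k h.1).2.1
          · exact le_rfl
    refine le_trans ?_ h4
    rw [Finset.sum_sub_distrib, ← Finset.mul_sum, ← Finset.mul_sum, sum_range_cast]
    have h5 : ∑ k ∈ Finset.range (2 * N + 1), (if k < m₀ then (m₀ : ℝ) else 0) ≤ m₀ ^ 2 := by
      rw [← Finset.sum_filter, Finset.sum_const, nsmul_eq_mul, sq]
      apply mul_le_mul_of_nonneg_right _ (by positivity)
      have : (Finset.filter (fun k => k < m₀) (Finset.range (2 * N + 1))).card ≤ m₀ := by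
        calc _ ≤ (Finset.range m₀).card := by
              apply Finset.card_le_card
              intro k hk
              simp at hk ⊢
              exact hk.2
          _ = m₀ := by simp
      exact_mod_cast this
    have h6 := mul_le_mul_of_nonneg_left h5 (show 0 ≤ D / 2 by linarith)
    push_cast
    nlinarith
  have h4 := mul_le_mul_of_nonneg_left h3 hc.le
  push_cast at h1 h2 h4
  have h5 : C * (2 * δ) * (4 * (N : ℝ)) ^ 2 = c * D / 4 * N ^ 2 := by
    rw [hδ]; field_simp; ring
  rw [h5] at h1 h2
  rw [mul_add] at h4
  exact not_lt_of_ge (sq_bound_of_add_le h1 h2 h4) (by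
    have h7 : ((c * D / 2) * m₀ ^ 2 + 2 * C * M * m₀ ^ 2) / (c * D / 2) < N := by linarith
    rw [div_lt_iff₀ (by positivity)] at h7
    refine h7.trans_le ?_
    have h9 : (N : ℝ) ≤ N ^ 2 := by nlinarith
    rw [mul_comm]
    exact mul_le_mul_of_nonneg_left h9 (by positivity))

/-- A nonnegative supersolution which is not zero stays away from zero. -/
theorem exists_pos_le (hw : IsScaleKernel w C c) {g : ℕ → ℝ} (h0 : ∀ n, 0 ≤ g n)
    (hg : ∀ n, 2 ≤ n → ∑ k ∈ Finset.range (n + 1), w n k * g k ≤ g n) {k₀ : ℕ} (hk₀ : 1 ≤ k₀)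
    (hpos : 0 < g k₀) : ∃ S : ℝ, 0 < S ∧ ∀ n, 2 * k₀ < n → S ≤ g n := by
  have hC := hw.pos'
  have hc := hw.pos
  have hk : (0 : ℝ) < k₀ := by exact_mod_cast hk₀
  -- The threshold is `2 * k₀` because `ge` bounds the jump from `m` to `k₀` from below only when `2
  -- * k₀ ≤ m`. This one jump already provides the required average.
  refine ⟨c * k₀ * g k₀ / (C * (2 * k₀ : ℕ) ^ 2), by positivity, ?_⟩
  apply hw.le_of_super (by omega) (fun m hm => hg m (by omega))
  intro m hm
  have hm0 : (0 : ℝ) < m := by exact_mod_cast (by omega : 0 < m)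
  have h1 := hw.sum_range_le hm.le (by omega)
  calc _ ≤ c * k₀ * g k₀ / (C * (2 * k₀ : ℕ) ^ 2) * (C * (2 * k₀ : ℕ) ^ 2 / m ^ 2) :=
        mul_le_mul_of_nonneg_left h1 (by positivity)
    _ = c * k₀ / m ^ 2 * g k₀ := by field_simp
    _ ≤ w m k₀ * g k₀ :=
        mul_le_mul_of_nonneg_right (hw.ge m k₀ (by omega) (by omega)) hpos.le
    _ ≤ _ := Finset.single_le_sum (f := fun k => w m k * g k)
        (fun k _ => mul_nonneg (hw.nonneg m k) (h0 k)) (Finset.mem_range.2 (by omega))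

end IsScaleKernel

end
end RandomPermuton

namespace RandomPermuton
noncomputable section

/-! ### Binomial thinning -/

/-- The weights of the binomial distribution with parameters `n` and `p`. -/
def binom (p : ℝ) (n k : ℕ) : ℝ := n.choose k * p ^ k * (1 - p) ^ (n - k)

/-- The expectation of `u` at a binomial random variable with parameters `n` and `p`. -/
def thin (p : ℝ) (u : ℕ → ℝ) (n : ℕ) : ℝ := ∑ k ∈ Finset.range (n + 1), binom p n k * u k

lemma binom_eq_eval (p : ℝ) (n k : ℕ) : binom p n k = (bernsteinPolynomial ℝ n k).eval p := by
  simp [binom, bernsteinPolynomial]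

lemma binom_nonneg {p : ℝ} (h0 : 0 ≤ p) (h1 : p ≤ 1) (n k : ℕ) : 0 ≤ binom p n k :=
  mul_nonneg (mul_nonneg (Nat.cast_nonneg _) (pow_nonneg h0 _)) (pow_nonneg (by linarith) _)

lemma sum_binom (p : ℝ) (n : ℕ) : ∑ k ∈ Finset.range (n + 1), binom p n k = 1 := by
  have := congrArg (Polynomial.eval p) (bernsteinPolynomial.sum ℝ n)
  simpa [Polynomial.eval_finsetSum, binom_eq_eval] using this

lemma thin_const (p : ℝ) (a : ℝ) (n : ℕ) : thin p (fun _ => a) n = a := by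
  rw [thin, ← Finset.sum_mul, sum_binom, one_mul]

lemma thin_cast (p : ℝ) (n : ℕ) : thin p (fun k => (k : ℝ)) n = n * p := by
  have := congrArg (Polynomial.eval p) (bernsteinPolynomial.sum_smul ℝ n)
  simp only [Polynomial.eval_finsetSum, nsmul_eq_mul, Polynomial.eval_mul,
    Polynomial.eval_natCast, Polynomial.eval_X] at this
  rw [← this, thin]
  exact Finset.sum_congr rfl fun k _ => by rw [binom_eq_eval, mul_comm]

/-- Thinning multiplies the second factorial moment by exactly `p ^ 2`. For this reason the
variances in `IsCentered` are measured against `m * (m - 1)` and not against `m ^ 2`. -/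
lemma thin_falling (p : ℝ) (n : ℕ) :
    thin p (fun k => (k : ℝ) * (k - 1)) n = n * (n - 1) * p ^ 2 := by
  have h := congrArg (Polynomial.eval p) (bernsteinPolynomial.sum_mul_smul ℝ n)
  simp only [Polynomial.eval_finsetSum, nsmul_eq_mul, Polynomial.eval_mul,
    Polynomial.eval_natCast, Polynomial.eval_X, Polynomial.eval_pow] at h
  have hc : ∀ k : ℕ, (((k * (k - 1) : ℕ)) : ℝ) = (k : ℝ) * (k - 1) := by
    intro k
    rcases k with _ | k
    · simp
    · push_cast; simp
  rw [hc] at h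
  rw [← h, thin]
  exact Finset.sum_congr rfl fun k _ => by rw [binom_eq_eval, hc, mul_comm]

lemma thin_add (p : ℝ) (u v : ℕ → ℝ) (n : ℕ) :
    thin p (fun k => u k + v k) n = thin p u n + thin p v n := by
  simp only [thin, mul_add, Finset.sum_add_distrib]

lemma thin_sub (p : ℝ) (u v : ℕ → ℝ) (n : ℕ) :
    thin p (fun k => u k - v k) n = thin p u n - thin p v n := by
  simp only [thin, mul_sub, Finset.sum_sub_distrib]

lemma thin_const_mul (p a : ℝ) (u : ℕ → ℝ) (n : ℕ) :
    thin p (fun k => a * u k) n = a * thin p u n := by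
  simp only [thin, Finset.mul_sum]
  exact Finset.sum_congr rfl fun k _ => by ring

lemma thin_mono {p : ℝ} (h0 : 0 ≤ p) (h1 : p ≤ 1) {u v : ℕ → ℝ} {n : ℕ}
    (h : ∀ k, k ≤ n → u k ≤ v k) : thin p u n ≤ thin p v n :=
  Finset.sum_le_sum fun k hk =>
    mul_le_mul_of_nonneg_left (h k (by simpa [Nat.lt_succ_iff] using hk)) (binom_nonneg h0 h1 n k)

lemma thin_nonneg {p : ℝ} (h0 : 0 ≤ p) (h1 : p ≤ 1) {u : ℕ → ℝ} {n : ℕ}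
    (h : ∀ k, k ≤ n → 0 ≤ u k) : 0 ≤ thin p u n := by
  have := thin_mono h0 h1 h
  rwa [thin_const] at this

lemma thin_sq_le {p : ℝ} (h0 : 0 ≤ p) (h1 : p ≤ 1) (u : ℕ → ℝ) (n : ℕ) :
    thin p u n ^ 2 ≤ thin p (fun k => u k ^ 2) n := by
  have h := thin_nonneg h0 h1 (u := fun k => (u k - thin p u n) ^ 2) (n := n)
    (fun k _ => sq_nonneg _)
  have : thin p (fun k => (u k - thin p u n) ^ 2) n =
      thin p (fun k => u k ^ 2) n - thin p u n ^ 2 := by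
    have e : (fun k => (u k - thin p u n) ^ 2) =
        fun k => (u k ^ 2 - (2 * thin p u n) * u k) + thin p u n ^ 2 := by
      funext k; ring
    rw [e, thin_add p (fun k => u k ^ 2 - (2 * thin p u n) * u k) (fun _ => thin p u n ^ 2),
      thin_sub p (fun k => u k ^ 2) (fun k => (2 * thin p u n) * u k), thin_const_mul, thin_const]
    ring
  linarith

@[fun_prop]
lemma continuous_binom (n k : ℕ) : Continuous fun p => binom p n k := by
  unfold binom; fun_prop

/-- Pascal's rule: condition on the outcome of one of the `n + 1` trials. -/
lemma thin_succ (p : ℝ) (u : ℕ → ℝ) (n : ℕ) :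
    thin p u (n + 1) = p * thin p (fun k => u (k + 1)) n + (1 - p) * thin p u n := by
  have h1 : thin p u (n + 1) = ∑ k ∈ Finset.range (n + 1), binom p (n + 1) (k + 1) * u (k + 1) +
      binom p (n + 1) 0 * u 0 := by
    rw [thin, Finset.sum_range_succ']
  have h2 : ∀ k ∈ Finset.range (n + 1), binom p (n + 1) (k + 1) * u (k + 1) =
      p * (binom p n k * u (k + 1)) +
        n.choose (k + 1) * p ^ (k + 1) * (1 - p) ^ (n - k) * u (k + 1) := by
    intro k _
    simp only [binom, Nat.choose_succ_succ, Nat.cast_add, Nat.add_sub_add_right]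
    ring
  rw [h1, Finset.sum_congr rfl h2, Finset.sum_add_distrib, ← Finset.mul_sum, add_assoc]
  congr 1
  rw [Finset.sum_range_succ, Nat.choose_succ_self, thin, Finset.sum_range_succ', mul_add,
    Finset.mul_sum]
  simp only [Nat.cast_zero, zero_mul, add_zero]
  congr 1
  · apply Finset.sum_congr rfl
    intro k hk
    rw [Finset.mem_range] at hk
    have : n - k = (n - (k + 1)) + 1 := by omega
    rw [this, binom]
    ring
  · simp [binom]; ring

/-- If `n` points independently choose a colour, then the number of points of a given colour
has a binomial distribution. -/
lemma sum_prod_color {d : ℕ} (τ : Fin d → ℝ) (hτ : ∑ i, τ i = 1) (i : Fin d) (n : ℕ)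
    (u : ℕ → ℝ) :
    ∑ c : Fin n → Fin d, (∏ j, τ (c j)) * u (Fintype.card {j // c j = i}) = thin (τ i) u n := by
  induction n generalizing u with
  | zero => simp [thin, binom]
  | succ n ih =>
    -- The colour of the first point is split off: colour `i` shifts the count by one, and all other
    -- colours together have probability `1 - τ i`.
    rw [thin_succ, ← ih, ← ih, ← (Fin.consEquiv fun _ => Fin d).sum_comp, Fintype.sum_prod_type,
      ← Finset.add_sum_erase _ _ (Finset.mem_univ i)]
    have hcard : ∀ (a : Fin d) (c : Fin n → Fin d),
        Fintype.card {j // (Fin.consEquiv fun _ => Fin d) (a, c) j = i} =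
          (if a = i then 1 else 0) + Fintype.card {j // c j = i} := by
      intro a c
      rw [Fintype.card_subtype, Fintype.card_subtype, Finset.card_filter, Finset.card_filter,
        Fin.sum_univ_succ]
      simp [Fin.consEquiv]
    simp only [hcard, Fin.prod_univ_succ]
    congr 1
    · rw [Finset.mul_sum]
      apply Finset.sum_congr rfl
      intro c _
      simp [Fin.consEquiv, add_comm, mul_assoc]
    · have : ∑ a ∈ Finset.univ.erase i, τ a = 1 - τ i := by
        rw [← hτ, ← Finset.add_sum_erase _ _ (Finset.mem_univ i)]; ring
      rw [← this, Finset.sum_mul]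
      apply Finset.sum_congr rfl
      intro a ha
      rw [Finset.mul_sum]
      apply Finset.sum_congr rfl
      intro c _
      simp [Fin.consEquiv, Finset.ne_of_mem_erase ha, mul_assoc]

end
end RandomPermuton

namespace RandomPermuton
noncomputable section

/-! ### Entropy of finite distributions -/

/-- The Shannon entropy of a family of weights indexed by a finite type. -/
def ent {A : Type*} [Fintype A] (P : A → ℝ) : ℝ := ∑ a, Real.negMulLog (P a)

lemma ent_nonneg {A : Type*} [Fintype A] {P : A → ℝ} (h0 : ∀ a, 0 ≤ P a) (h1 : ∀ a, P a ≤ 1) :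
    0 ≤ ent P :=
  Finset.sum_nonneg fun a _ => Real.negMulLog_nonneg (h0 a) (h1 a)

lemma negMulLog_add_le {x y : ℝ} (hx : 0 ≤ x) (hy : 0 ≤ y) :
    Real.negMulLog (x + y) ≤ Real.negMulLog x + Real.negMulLog y := by
  rcases hx.eq_or_lt with rfl | hx
  · simp
  rcases hy.eq_or_lt with rfl | hy
  · simp
  simp only [Real.negMulLog]
  have h1 : Real.log x ≤ Real.log (x + y) := Real.log_le_log hx (by linarith)
  have h2 : Real.log y ≤ Real.log (x + y) := Real.log_le_log hy (by linarith)
  nlinarith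

lemma negMulLog_sum_le {A : Type*} (s : Finset A) {x : A → ℝ} (hx : ∀ a ∈ s, 0 ≤ x a) :
    Real.negMulLog (∑ a ∈ s, x a) ≤ ∑ a ∈ s, Real.negMulLog (x a) := by
  classical
  induction s using Finset.induction_on with
  | empty => simp
  | insert a s ha ih =>
    rw [Finset.sum_insert ha, Finset.sum_insert ha]
    have h1 : ∀ b ∈ s, 0 ≤ x b := fun b hb => hx b (Finset.mem_insert_of_mem hb)
    refine (negMulLog_add_le (hx a (Finset.mem_insert_self _ _)) (Finset.sum_nonneg h1)).trans ?_
    linarith [ih h1]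

lemma ent_le {A : Type*} [Fintype A] {x : A → ℝ} (hx : ∀ a, 0 ≤ x a) :
    ent x ≤ Real.negMulLog (∑ a, x a) + (∑ a, x a) * Real.log (Fintype.card A) := by
  rcases isEmpty_or_nonempty A with hA | hA
  · simp [ent]
  have hn : (0 : ℝ) < Fintype.card A := by exact_mod_cast Fintype.card_pos
  have h := Real.concaveOn_negMulLog.le_map_sum (t := Finset.univ)
    (w := fun _ : A => (Fintype.card A : ℝ)⁻¹) (p := x) (fun _ _ => by positivity)
    (by simp [hn.ne']) (fun a _ => hx a)
  simp only [smul_eq_mul, ← Finset.mul_sum] at h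
  rw [mul_comm _ (∑ a, x a), Real.negMulLog_mul] at h
  have h2 : Real.negMulLog (Fintype.card A : ℝ)⁻¹ =
      (Fintype.card A : ℝ)⁻¹ * Real.log (Fintype.card A) := by
    rw [Real.negMulLog, Real.log_inv]; ring
  rw [h2] at h
  have h3 := mul_le_mul_of_nonneg_left h hn.le
  rw [← mul_assoc, mul_inv_cancel₀ hn.ne', one_mul] at h3
  refine h3.trans (le_of_eq ?_)
  field_simp

lemma ent_le_log_card {A : Type*} [Fintype A] {x : A → ℝ} (hx : ∀ a, 0 ≤ x a)
    (h1 : ∑ a, x a = 1) : ent x ≤ Real.log (Fintype.card A) := by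
  have := ent_le hx
  simpa [h1] using this

lemma ent_map_le {A B : Type*} [Fintype A] [Fintype B] [DecidableEq B] {P : A → ℝ}
    (hP : ∀ a, 0 ≤ P a) (f : A → B) :
    ent (fun b => ∑ a with f a = b, P a) ≤ ent P := by
  rw [ent, ent, ← Finset.sum_fiberwise (s := Finset.univ) (g := f)]
  exact Finset.sum_le_sum fun b _ => negMulLog_sum_le _ fun a _ => hP a

/-- The chain rule, with each conditional entropy bounded by the logarithm of the number of values.
-/
lemma ent_prod_le {A B : Type*} [Fintype A] [Fintype B] {P : A × B → ℝ} (hP : ∀ x, 0 ≤ P x)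
    (h1 : ∑ x, P x = 1) :
    ent P ≤ ent (fun a => ∑ b, P (a, b)) + Real.log (Fintype.card B) := by
  have h : ∀ a, ∑ b, Real.negMulLog (P (a, b)) ≤
      Real.negMulLog (∑ b, P (a, b)) + (∑ b, P (a, b)) * Real.log (Fintype.card B) :=
    fun a => ent_le fun b => hP (a, b)
  have h2 := Finset.sum_le_sum fun a (_ : a ∈ Finset.univ) => h a
  rw [Finset.sum_add_distrib, ← Finset.sum_mul, ← Fintype.sum_prod_type (f := P), h1,
    one_mul] at h2
  rw [ent, Fintype.sum_prod_type]
  exact h2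

/-- `negMulLog` obeys the Leibniz rule, and this is its iterated form. Summed over a product space,
it gives the additivity of entropy in `ent_pi`. -/
lemma negMulLog_prod {ι : Type*} [DecidableEq ι] (s : Finset ι) (x : ι → ℝ) :
    Real.negMulLog (∏ i ∈ s, x i) =
      ∑ i ∈ s, ∏ j ∈ s, if j = i then Real.negMulLog (x j) else x j := by
  induction s using Finset.induction_on with
  | empty => simp
  | insert a s ha ih =>
    rw [Finset.prod_insert ha, Real.negMulLog_mul, ih, Finset.sum_insert ha,
      Finset.prod_insert ha, if_pos rfl, Finset.mul_sum]
    congr 1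
    · rw [mul_comm]
      congr 1
      apply Finset.prod_congr rfl
      intro j hj
      rw [if_neg (by rintro rfl; exact ha hj)]
    · apply Finset.sum_congr rfl
      intro i hi
      rw [Finset.prod_insert ha, if_neg (by rintro rfl; exact ha hi)]

lemma ent_pi {ι : Type*} [Fintype ι] [DecidableEq ι] {A : ι → Type*} [∀ i, Fintype (A i)]
    {P : ∀ i, A i → ℝ} (h1 : ∀ i, ∑ a, P i a = 1) :
    ent (fun a : ∀ i, A i => ∏ i, P i (a i)) = ∑ i, ent (P i) := by
  simp only [ent, negMulLog_prod]
  rw [Finset.sum_comm]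
  apply Finset.sum_congr rfl
  intro i _
  have := Fintype.prod_sum
    (fun j (a : A j) => if j = i then Real.negMulLog (P j a) else P j a)
  rw [← this, Finset.prod_eq_single i]
  · simp
  · intro j _ hj
    simp [hj, h1]
  · simp

/-- Concavity of `negMulLog`, applied at each point of `A`. -/
lemma sum_mul_ent_le_ent_mix {C A : Type*} [Fintype C] [Fintype A] {m : C → ℝ} {P : C → A → ℝ}
    (hm : ∀ c, 0 ≤ m c) (hm1 : ∑ c, m c = 1) (hP : ∀ c a, 0 ≤ P c a) :
    ∑ c, m c * ent (P c) ≤ ent (fun a => ∑ c, m c * P c a) := by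
  simp only [ent, Finset.mul_sum]
  rw [Finset.sum_comm]
  apply Finset.sum_le_sum
  intro a _
  have h := Real.concaveOn_negMulLog.le_map_sum (t := Finset.univ) (w := m)
    (p := fun c => P c a) (fun c _ => hm c) hm1 (fun c _ => hP c a)
  simpa using h

/-- Subadditivity of `negMulLog` separates the classes of `κ`. Inside one class all components
agree, so the class contributes `negMulLog` of its mass plus its share of the average; the former
terms add up to the entropy of a law on `N`. The error is thus governed by the number of classes and
not by the number of components. -/
lemma ent_mix_le {C A N : Type*} [Fintype C] [Fintype A] [Fintype N] {m : C → ℝ}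
    {P : C → A → ℝ} (hm : ∀ c, 0 ≤ m c) (hm1 : ∑ c, m c = 1) (hP : ∀ c a, 0 ≤ P c a)
    (hP1 : ∀ c, ∑ a, P c a = 1) (κ : C → N) (hκ : ∀ c c', κ c = κ c' → P c = P c') :
    ent (fun a => ∑ c, m c * P c a) ≤
      ∑ c, m c * ent (P c) + Real.log (Fintype.card N) := by
  let : DecidableEq N := Classical.decEq N
  have h1 : ∀ a, Real.negMulLog (∑ c, m c * P c a) ≤
      ∑ ν, Real.negMulLog (∑ c with κ c = ν, m c * P c a) := by
    intro a
    rw [← Finset.sum_fiberwise (s := Finset.univ) (g := κ)]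
    exact negMulLog_sum_le _ fun ν _ => Finset.sum_nonneg fun c _ => mul_nonneg (hm c) (hP c a)
  have h2 : ∀ ν, ∑ a, Real.negMulLog (∑ c with κ c = ν, m c * P c a) =
      Real.negMulLog (∑ c with κ c = ν, m c) + ∑ c with κ c = ν, m c * ent (P c) := by
    intro ν
    by_cases h : ∃ c, κ c = ν
    · obtain ⟨c₀, hc₀⟩ := h
      have h3 : ∀ a, ∑ c with κ c = ν, m c * P c a = (∑ c with κ c = ν, m c) * P c₀ a := by
        intro a
        rw [Finset.sum_mul]
        apply Finset.sum_congr rfl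
        intro c hc
        rw [hκ c c₀ ((Finset.mem_filter.1 hc).2.trans hc₀.symm)]
      have h4 : ∑ c with κ c = ν, m c * ent (P c) = (∑ c with κ c = ν, m c) * ent (P c₀) := by
        rw [Finset.sum_mul]
        apply Finset.sum_congr rfl
        intro c hc
        rw [hκ c c₀ ((Finset.mem_filter.1 hc).2.trans hc₀.symm)]
      simp only [h3, h4, Real.negMulLog_mul, Finset.sum_add_distrib, ← Finset.sum_mul, hP1,
        one_mul, ← Finset.mul_sum]
      rfl
    · have h3 : Finset.filter (fun c => κ c = ν) Finset.univ = ∅ := by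
        ext c
        simp only [Finset.mem_filter, Finset.mem_univ, true_and, Finset.notMem_empty, iff_false]
        exact fun hc => h ⟨c, hc⟩
      simp [h3]
  have h3 : ∑ ν, Real.negMulLog (∑ c with κ c = ν, m c) ≤ Real.log (Fintype.card N) := by
    apply ent_le_log_card (x := fun ν => ∑ c with κ c = ν, m c)
    · exact fun ν => Finset.sum_nonneg fun c _ => hm c
    · rw [Finset.sum_fiberwise, hm1]
  calc ent (fun a => ∑ c, m c * P c a)
      ≤ ∑ a, ∑ ν, Real.negMulLog (∑ c with κ c = ν, m c * P c a) :=
        Finset.sum_le_sum fun a _ => h1 a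
    _ = ∑ ν, (Real.negMulLog (∑ c with κ c = ν, m c) + ∑ c with κ c = ν, m c * ent (P c)) := by
        rw [Finset.sum_comm]
        exact Finset.sum_congr rfl fun ν _ => h2 ν
    _ ≤ _ := by
        rw [Finset.sum_add_distrib, Finset.sum_fiberwise]
        linarith

/-! ### Laws of finite-valued functions and their entropies -/

/-- The law of a finite-valued function. -/
def law {Ω A : Type*} [MeasurableSpace Ω] (P : Measure Ω) (f : Ω → A) (a : A) : ℝ :=
  P.real (f ⁻¹' {a})

lemma law_nonneg {Ω A : Type*} [MeasurableSpace Ω] (P : Measure Ω) (f : Ω → A) (a : A) :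
    0 ≤ law P f a := measureReal_nonneg

lemma law_comp {Ω A B : Type*} [MeasurableSpace Ω] [Fintype A] [DecidableEq B] {P : Measure Ω}
    [IsFiniteMeasure P] {f : Ω → A} (hf : ∀ a, MeasurableSet (f ⁻¹' {a})) (φ : A → B) (b : B) :
    law P (φ ∘ f) b = ∑ a with φ a = b, law P f a := by
  have : (φ ∘ f) ⁻¹' {b} = ⋃ a ∈ Finset.univ.filter (fun a => φ a = b), f ⁻¹' {a} := by
    ext ω; simp
  rw [law, this, measureReal_biUnion_finset]
  · rfl
  · intro a _ a' _ haa'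
    exact Disjoint.preimage f (by simpa using haa')
  · exact fun a _ => hf a

lemma sum_law {Ω A : Type*} [MeasurableSpace Ω] [Fintype A] {P : Measure Ω}
    [IsProbabilityMeasure P] {f : Ω → A} (hf : ∀ a, MeasurableSet (f ⁻¹' {a})) :
    ∑ a, law P f a = 1 := by
  classical
  have := law_comp (P := P) hf (fun _ => ()) ()
  rw [Finset.filter_true_of_mem (fun _ _ => rfl)] at this
  rw [← this, law]
  have hu : ((fun _ => ()) ∘ f) ⁻¹' {()} = Set.univ := Set.eq_univ_of_forall fun _ => rfl
  rw [hu, probReal_univ]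

lemma law_congr {Ω A : Type*} [MeasurableSpace Ω] {P : Measure Ω} {f g : Ω → A}
    (h : ∀ᵐ ω ∂P, f ω = g ω) (a : A) : law P f a = law P g a := by
  apply measureReal_congr
  filter_upwards [h] with ω hω
  apply propext
  change f ω = a ↔ g ω = a
  rw [hω]

lemma law_map {Ω Ω' A : Type*} [MeasurableSpace Ω] [MeasurableSpace Ω'] {P : Measure Ω}
    {T : Ω → Ω'} (hT : Measurable T) {f : Ω' → A} (hf : ∀ a, MeasurableSet (f ⁻¹' {a})) (a : A) :
    law (P.map T) f a = law P (f ∘ T) a := by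
  rw [law, map_measureReal_apply hT (hf a)]
  rfl

/-- If almost surely `g` is determined by `f`, the entropy of `g` is at most that of `f`. -/
lemma ent_law_le {Ω A B : Type*} [MeasurableSpace Ω] [Fintype A] [Fintype B] {P : Measure Ω}
    [IsProbabilityMeasure P] {f : Ω → A} {g : Ω → B} (hf : ∀ a, MeasurableSet (f ⁻¹' {a}))
    {G : Set Ω} (hG : ∀ᵐ ω ∂P, ω ∈ G)
    (h : ∀ ω ∈ G, ∀ ω' ∈ G, f ω = f ω' → g ω = g ω') :
    ent (law P g) ≤ ent (law P f) := by
  classical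
  obtain ⟨ω₀, hω₀⟩ := hG.exists
  -- Values which `f` does not take on `G` receive the dummy `g ω₀`; they play no role in the almost
  -- sure identity `g = φ ∘ f`.
  let φ : A → B := fun a => if ha : ∃ ω ∈ G, f ω = a then g ha.choose else g ω₀
  have hφ : ∀ᵐ ω ∂P, g ω = (φ ∘ f) ω := by
    filter_upwards [hG] with ω hω
    have ha : ∃ ω' ∈ G, f ω' = f ω := ⟨ω, hω, rfl⟩
    simp only [φ, Function.comp, dif_pos ha]
    exact h ω hω _ ha.choose_spec.1 ha.choose_spec.2.symm
  have : law P g = fun b => ∑ a with φ a = b, law P f a := by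
    funext b
    rw [law_congr hφ, law_comp hf]
  rw [this]
  exact ent_map_le (fun a => law_nonneg P f a) φ

lemma ent_law_prod_le {Ω A B : Type*} [MeasurableSpace Ω] [Fintype A] [Fintype B] {P : Measure Ω}
    [IsProbabilityMeasure P] {f : Ω → A} {g : Ω → B} (hf : ∀ a, MeasurableSet (f ⁻¹' {a}))
    (hg : ∀ b, MeasurableSet (g ⁻¹' {b})) :
    ent (law P fun ω => (f ω, g ω)) ≤ ent (law P f) + Real.log (Fintype.card B) := by
  classical
  have hfg : ∀ x : A × B, MeasurableSet ((fun ω => (f ω, g ω)) ⁻¹' {x}) := by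
    rintro ⟨a, b⟩
    have : (fun ω => (f ω, g ω)) ⁻¹' {(a, b)} = f ⁻¹' {a} ∩ g ⁻¹' {b} := by
      ext ω; simp
    rw [this]
    exact (hf a).inter (hg b)
  refine (ent_prod_le (fun x => law_nonneg _ _ x) (sum_law hfg)).trans (le_of_eq ?_)
  congr 2
  funext a
  have := law_comp (P := P) hfg Prod.fst a
  change law P f a = _ at this
  rw [this]
  have e : Finset.filter (fun x : A × B => x.1 = a) Finset.univ =
      Finset.univ.map ⟨fun b : B => (a, b), fun b b' h => (Prod.mk.inj h).2⟩ := by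
    ext ⟨a', b⟩
    simp only [Finset.mem_filter, Finset.mem_univ, true_and, Finset.mem_map]
    exact ⟨fun h => ⟨b, by rw [h]; rfl⟩, fun ⟨_, h⟩ => (congrArg Prod.fst h).symm⟩
  rw [e, Finset.sum_map]
  rfl

end
end RandomPermuton

namespace RandomPermuton
noncomputable section

/-! ### Patterns of finite tuples of points -/

/-- The points have pairwise distinct abscissas and pairwise distinct ordinates. -/
def Generic {n : ℕ} (p : Fin n → ℝ × ℝ) : Prop :=
  Function.Injective (fun i => (p i).1) ∧ Function.Injective (fun i => (p i).2)

/-- The only order automorphism of `Fin n` is the identity. -/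
lemma perm_eq_of_lt_iff {n : ℕ} {σ σ' : Equiv.Perm (Fin n)}
    (h : ∀ i j, σ i < σ j ↔ σ' i < σ' j) : σ = σ' := by
  have hm : StrictMono (σ'.symm.trans σ) := by
    intro a b hab
    have := (h (σ'.symm a) (σ'.symm b)).2 (by simpa using hab)
    simpa using this
  have h2 := Subsingleton.elim (hm.orderIsoOfSurjective _ (σ'.symm.trans σ).surjective)
    (OrderIso.refl (Fin n))
  ext i : 1
  have := congrArg (fun e : Fin n ≃o Fin n => e (σ' i)) h2
  simpa using this

lemma HasPattern.unique {n : ℕ} {σ σ' : Equiv.Perm (Fin n)} {p : Fin n → ℝ × ℝ}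
    (h : HasPattern σ p) (h' : HasPattern σ' p) : σ = σ' := by
  obtain ⟨e, he, hσ⟩ := h
  obtain ⟨e', he', hσ'⟩ := h'
  have hee : e⁻¹ = e'⁻¹ := by
    apply perm_eq_of_lt_iff
    intro i j
    rw [← he.lt_iff_lt, ← he'.lt_iff_lt]
    simp
  rw [inv_inj] at hee
  subst hee
  apply perm_eq_of_lt_iff
  intro i j
  rw [← hσ, hσ']

lemma Generic.exists_hasPattern {n : ℕ} {p : Fin n → ℝ × ℝ} (h : Generic p) :
    ∃ σ, HasPattern σ p := by
  have hx : StrictMono ((fun i => (p i).1) ∘ Tuple.sort fun i => (p i).1) :=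
    (Tuple.monotone_sort _).strictMono_of_injective (h.1.comp (Equiv.injective _))
  have hy : StrictMono ((fun i => (p i).2) ∘ Tuple.sort fun i => (p i).2) :=
    (Tuple.monotone_sort _).strictMono_of_injective (h.2.comp (Equiv.injective _))
  refine ⟨(Tuple.sort fun i => (p i).2)⁻¹ * Tuple.sort fun i => (p i).1, Tuple.sort _, hx, ?_⟩
  intro i j
  rw [← hy.lt_iff_lt]
  simp

open Classical in
/-- The pattern of a tuple of points. -/
def pat {n : ℕ} (p : Fin n → ℝ × ℝ) : Equiv.Perm (Fin n) :=
  if h : ∃ σ, HasPattern σ p then h.choose else 1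

lemma HasPattern.pat_eq {n : ℕ} {σ : Equiv.Perm (Fin n)} {p : Fin n → ℝ × ℝ}
    (h : HasPattern σ p) : pat p = σ := by
  have h' : ∃ σ, HasPattern σ p := ⟨σ, h⟩
  rw [pat, dif_pos h']
  exact h'.choose_spec.unique h

lemma Generic.hasPattern_iff {n : ℕ} {σ : Equiv.Perm (Fin n)} {p : Fin n → ℝ × ℝ}
    (h : Generic p) : HasPattern σ p ↔ pat p = σ := by
  refine ⟨HasPattern.pat_eq, ?_⟩
  rintro rfl
  obtain ⟨σ, hσ⟩ := h.exists_hasPattern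
  rwa [hσ.pat_eq]

lemma measurableSet_hasPattern {n : ℕ} (σ : Equiv.Perm (Fin n)) :
    MeasurableSet {p : Fin n → ℝ × ℝ | HasPattern σ p} := by
  have h1 : ∀ a b : Fin n, MeasurableSet {p : Fin n → ℝ × ℝ | (p a).1 < (p b).1} :=
    fun a b => measurableSet_lt (by fun_prop) (by fun_prop)
  have h2 : ∀ a b : Fin n, MeasurableSet {p : Fin n → ℝ × ℝ | (p a).2 < (p b).2} :=
    fun a b => measurableSet_lt (by fun_prop) (by fun_prop)
  have : {p : Fin n → ℝ × ℝ | HasPattern σ p} = ⋃ e : Equiv.Perm (Fin n),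
      ((⋂ i, ⋂ j, ⋂ _ : i < j, {p | (p (e i)).1 < (p (e j)).1}) ∩
        ⋂ i, ⋂ j, {p | (p (e i)).2 < (p (e j)).2 ↔ σ i < σ j}) := by
    ext p
    simp only [HasPattern, StrictMono, Set.mem_ofPred_eq, Set.mem_iUnion, Set.mem_inter_iff,
      Set.mem_iInter]
  rw [this]
  refine MeasurableSet.iUnion fun e => MeasurableSet.inter ?_ ?_
  · exact MeasurableSet.iInter fun i => MeasurableSet.iInter fun j => MeasurableSet.iInter fun _ =>
      h1 _ _
  · refine MeasurableSet.iInter fun i => MeasurableSet.iInter fun j => ?_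
    by_cases h : σ i < σ j
    · simpa only [h, iff_true] using h2 _ _
    · simp only [h, iff_false]
      exact (h2 _ _).compl

lemma measurableSet_pat {n : ℕ} (σ : Equiv.Perm (Fin n)) :
    MeasurableSet ((pat : (Fin n → ℝ × ℝ) → _) ⁻¹' {σ}) := by
  -- The second set accounts for the default value `1` of `pat` on tuples without a pattern.
  have : (pat : (Fin n → ℝ × ℝ) → _) ⁻¹' {σ} = {p | HasPattern σ p} ∪
      ({p | σ = 1} ∩ ⋂ σ', {p | HasPattern σ' p}ᶜ) := by
    ext p
    simp only [Set.mem_preimage, Set.mem_singleton_iff, Set.mem_union, Set.mem_ofPred_eq,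
      Set.mem_inter_iff, Set.mem_iInter, Set.mem_compl_iff]
    by_cases h : ∃ σ', HasPattern σ' p
    · obtain ⟨σ', h⟩ := h
      rw [h.pat_eq]
      constructor
      · rintro rfl; exact Or.inl h
      · rintro (h' | h')
        · exact h.unique h'
        · exact absurd h (h'.2 σ')
    · have h1 : pat p = 1 := dif_neg h
      push Not at h
      rw [h1]
      have := h σ
      simp only [this, h]
      simp [eq_comm]
  rw [this]
  refine (measurableSet_hasPattern σ).union (MeasurableSet.inter (.const _) ?_)
  exact MeasurableSet.iInter fun σ' => (measurableSet_hasPattern σ').compl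

/-- The points of `p` and of `p'` are in the same relative order, up to renumbering. -/
def SameType {n : ℕ} (p p' : Fin n → ℝ × ℝ) : Prop :=
  ∃ e : Equiv.Perm (Fin n), ∀ i j, ((p i).1 < (p j).1 ↔ (p' (e i)).1 < (p' (e j)).1) ∧
    ((p i).2 < (p j).2 ↔ (p' (e i)).2 < (p' (e j)).2)

lemma SameType.pat_eq {n : ℕ} {p p' : Fin n → ℝ × ℝ} (h : SameType p p') : pat p = pat p' := by
  obtain ⟨f, hf⟩ := h
  have key : ∀ σ, HasPattern σ p ↔ HasPattern σ p' := by
    intro σ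
    constructor
    · rintro ⟨e, he, hσ⟩
      refine ⟨f * e, fun i j hij => ?_, fun i j => ?_⟩
      · exact (hf _ _).1.1 (he hij)
      · rw [← hσ]; exact (hf _ _).2.symm
    · rintro ⟨e, he, hσ⟩
      refine ⟨f⁻¹ * e, fun i j hij => ?_, fun i j => ?_⟩
      · exact (hf _ _).1.2 (by simpa using he hij)
      · rw [← hσ, (hf _ _).2]; simp
  by_cases h : ∃ σ, HasPattern σ p
  · obtain ⟨σ, h⟩ := h
    rw [h.pat_eq, ((key σ).1 h).pat_eq]
  · rw [pat, dif_neg h, pat, dif_neg (by simpa only [key] using h)]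

lemma Generic.sameType_of_pat_eq {n : ℕ} {p p' : Fin n → ℝ × ℝ} (hp : Generic p)
    (hp' : Generic p') (h : pat p = pat p') : SameType p p' := by
  obtain ⟨e, he, hσ⟩ := hp.hasPattern_iff.2 h
  obtain ⟨e', he', hσ'⟩ := hp'.hasPattern_iff.2 rfl
  refine ⟨e.symm.trans e', fun i j => ⟨?_, ?_⟩⟩
  · have h1 := he.lt_iff_lt (a := e.symm i) (b := e.symm j)
    have h2 := he'.lt_iff_lt (a := e.symm i) (b := e.symm j)
    simp only [Equiv.apply_symm_apply] at h1
    rw [h1, ← h2, Equiv.trans_apply, Equiv.trans_apply]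
  · have h1 := hσ (e.symm i) (e.symm j)
    have h2 := hσ' (e.symm i) (e.symm j)
    simp only [Equiv.apply_symm_apply] at h1
    rw [h1, ← h2, Equiv.trans_apply, Equiv.trans_apply]

lemma Generic.comp {n m : ℕ} {p : Fin n → ℝ × ℝ} (h : Generic p) {f : Fin m → Fin n}
    (hf : Function.Injective f) : Generic (p ∘ f) :=
  ⟨h.1.comp hf, h.2.comp hf⟩

lemma pat_comp_perm {n : ℕ} (p : Fin n → ℝ × ℝ) (f : Equiv.Perm (Fin n)) :
    pat (p ∘ f) = pat p :=
  SameType.pat_eq ⟨f, fun _ _ => ⟨Iff.rfl, Iff.rfl⟩⟩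

/-! ### Coloured tuples -/

/-- The points of different colours are separated: the colours are ordered from left to right by
their numbers, and from bottom to top by their images under `α`. -/
def Colored {n d : ℕ} (α : Equiv.Perm (Fin d)) (c : Fin n → Fin d) (p : Fin n → ℝ × ℝ) : Prop :=
  ∀ j k, (c j < c k → (p j).1 < (p k).1) ∧ (α (c j) < α (c k) → (p j).2 < (p k).2)

/-- The number of points of a given colour. -/
abbrev colorCount {n d : ℕ} (c : Fin n → Fin d) (i : Fin d) : ℕ := Fintype.card {j // c j = i}

/-- An enumeration of the points, colour by colour. -/
def colorEquiv {n d : ℕ} (c : Fin n → Fin d) : (Σ i, Fin (colorCount c i)) ≃ Fin n :=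
  (Equiv.sigmaCongrRight fun i => (Fintype.equivFin {j // c j = i}).symm).trans
    (Equiv.sigmaFiberEquiv c)

/-- The points of a given colour. -/
def colorPart {n d : ℕ} {X : Type*} (c : Fin n → Fin d) (p : Fin n → X) (i : Fin d)
    (j : Fin (colorCount c i)) : X := p (colorEquiv c ⟨i, j⟩)

lemma color_colorEquiv {n d : ℕ} (c : Fin n → Fin d) (x : Σ i, Fin (colorCount c i)) :
    c (colorEquiv c x) = x.1 :=
  ((Fintype.equivFin {j // c j = x.1}).symm x.2).2

lemma Generic.colorPart {n d : ℕ} {c : Fin n → Fin d} {p : Fin n → ℝ × ℝ} (h : Generic p)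
    (i : Fin d) : Generic (colorPart c p i) :=
  h.comp (f := fun j => colorEquiv c ⟨i, j⟩) fun j j' hj => by
    have := (colorEquiv c).injective hj
    simpa using this

lemma Colored.fst_lt_iff {n d : ℕ} {α : Equiv.Perm (Fin d)} {c : Fin n → Fin d}
    {p : Fin n → ℝ × ℝ} (h : Colored α c p) {j k : Fin n} (hjk : c j ≠ c k) :
    (p j).1 < (p k).1 ↔ c j < c k := by
  refine ⟨fun hlt => ?_, (h j k).1⟩
  rcases lt_or_gt_of_ne hjk with h1 | h1
  · exact h1
  · exact absurd ((h k j).1 h1) (not_lt.2 hlt.le)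

lemma Colored.snd_lt_iff {n d : ℕ} {α : Equiv.Perm (Fin d)} {c : Fin n → Fin d}
    {p : Fin n → ℝ × ℝ} (h : Colored α c p) {j k : Fin n} (hjk : c j ≠ c k) :
    (p j).2 < (p k).2 ↔ α (c j) < α (c k) := by
  refine ⟨fun hlt => ?_, (h j k).2⟩
  rcases lt_or_gt_of_ne (α.injective.ne hjk) with h1 | h1
  · exact h1
  · exact absurd ((h k j).2 h1) (not_lt.2 hlt.le)

/-- The relative order of two points of different colours is dictated by `c` and `α`, so matchings
inside the colour classes combine into one matching. -/
lemma Colored.sameType_of_colorPart {n d : ℕ} {α : Equiv.Perm (Fin d)} {c : Fin n → Fin d}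
    {p p' : Fin n → ℝ × ℝ} (hp : Colored α c p) (hp' : Colored α c p')
    (h : ∀ i, SameType (colorPart c p i) (colorPart c p' i)) : SameType p p' := by
  choose e he using h
  refine ⟨((colorEquiv c).symm.trans (Equiv.sigmaCongrRight e)).trans (colorEquiv c), ?_⟩
  intro j k
  obtain ⟨⟨i, j⟩, rfl⟩ := (colorEquiv c).surjective j
  obtain ⟨⟨i', k⟩, rfl⟩ := (colorEquiv c).surjective k
  simp only [Equiv.trans_apply, Equiv.symm_apply_apply, Equiv.sigmaCongrRight_apply]
  by_cases hii : i = i'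
  · subst hii
    exact he i j k
  · rw [hp.fst_lt_iff (by simpa [color_colorEquiv] using hii),
      hp'.fst_lt_iff (by simpa [color_colorEquiv] using hii),
      hp.snd_lt_iff (by simpa [color_colorEquiv] using hii),
      hp'.snd_lt_iff (by simpa [color_colorEquiv] using hii)]
    simp [color_colorEquiv]

/-- The number of points on the left of a given point. -/
def leftRank {n : ℕ} (p : Fin n → ℝ × ℝ) (j : Fin n) : ℕ :=
  (Finset.univ.filter fun k => (p k).1 < (p j).1).card

lemma leftRank_eq_of_lt_iff {n : ℕ} {p p' : Fin n → ℝ × ℝ} {e : Equiv.Perm (Fin n)}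
    (he : ∀ i j, (p i).1 < (p j).1 ↔ (p' (e i)).1 < (p' (e j)).1) (j : Fin n) :
    leftRank p' (e j) = leftRank p j := by
  refine Eq.trans ?_ (Finset.card_map e.toEmbedding)
  rw [leftRank]
  congr 1
  ext k
  obtain ⟨k, rfl⟩ := e.surjective k
  simp [he]

/-- The points of colour at most `i` are the leftmost ones. Hence a colour can be read off from the
left rank and the colour counts. -/
lemma Colored.le_iff_leftRank {n d : ℕ} {α : Equiv.Perm (Fin d)} {c : Fin n → Fin d}
    {p : Fin n → ℝ × ℝ} (h : Colored α c p) (j : Fin n) (i : Fin d) :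
    c j ≤ i ↔ leftRank p j < (Finset.univ.filter fun k => c k ≤ i).card := by
  constructor
  · intro hj
    apply Finset.card_lt_card
    rw [Finset.ssubset_iff_of_subset]
    · exact ⟨j, by simp [hj], by simp⟩
    · intro k hk
      simp only [Finset.mem_filter, Finset.mem_univ, true_and] at hk ⊢
      refine le_trans (not_lt.1 fun hlt => ?_) hj
      exact absurd ((h j k).1 hlt) (not_lt.2 hk.le)
  · intro hlt
    by_contra hj
    refine absurd hlt (not_lt.2 (Finset.card_le_card ?_))
    intro k hk
    simp only [Finset.mem_filter, Finset.mem_univ, true_and] at hk ⊢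
    exact (h k j).1 (lt_of_le_of_lt hk (not_le.1 hj))

/-- A matching which preserves the order preserves left ranks, hence colours, and so restricts to
every colour class. -/
lemma Colored.colorPart_sameType {n d : ℕ} {α : Equiv.Perm (Fin d)} {c : Fin n → Fin d}
    {p p' : Fin n → ℝ × ℝ} (hp : Colored α c p) (hp' : Colored α c p')
    (h : SameType p p') (i : Fin d) : SameType (colorPart c p i) (colorPart c p' i) := by
  obtain ⟨e, he⟩ := h
  have hc : ∀ j, c (e j) = c j := by
    intro j
    have h1 : ∀ i, c (e j) ≤ i ↔ c j ≤ i := by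
      intro i
      rw [hp'.le_iff_leftRank, hp.le_iff_leftRank,
        leftRank_eq_of_lt_iff (fun i j => (he i j).1)]
    exact le_antisymm ((h1 _).2 le_rfl) ((h1 _).1 le_rfl)
  let f := e.subtypePerm (p := fun j => c j = i) (fun j => by rw [hc])
  let q := Fintype.equivFin {j // c j = i}
  refine ⟨(q.symm.trans f).trans q, fun j k => ?_⟩
  have key : ∀ j, colorPart c p' i (((q.symm.trans f).trans q) j) =
      p' (e (colorEquiv c ⟨i, j⟩)) := by
    intro j
    change p' (q.symm (q (f (q.symm j)))).1 = _
    rw [Equiv.symm_apply_apply]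
    rfl
  rw [key, key]
  exact he _ _

/-! ### Deleting a point -/

lemma leftRank_lt {n : ℕ} (p : Fin n → ℝ × ℝ) (j : Fin n) : leftRank p j < n := by
  have : leftRank p j < (Finset.univ : Finset (Fin n)).card := by
    apply Finset.card_lt_card
    rw [Finset.ssubset_iff_of_subset (Finset.subset_univ _)]
    exact ⟨j, Finset.mem_univ _, by simp⟩
  simpa using this

lemma Generic.leftRank_injective {n : ℕ} {p : Fin n → ℝ × ℝ} (h : Generic p) :
    Function.Injective (leftRank p) := by
  have key : ∀ j k, (p j).1 < (p k).1 → leftRank p j < leftRank p k := by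
    intro j k hjk
    apply Finset.card_lt_card
    rw [Finset.ssubset_iff_of_subset]
    · exact ⟨j, by simp [hjk], by simp⟩
    · intro l hl
      simp only [Finset.mem_filter, Finset.mem_univ, true_and] at hl ⊢
      exact hl.trans hjk
  intro j k hjk
  by_contra hne
  rcases lt_or_gt_of_ne (h.1.ne hne) with h1 | h1
  · exact (key _ _ h1).ne hjk
  · exact (key _ _ h1).ne hjk.symm

/-- Left ranks of generic points are distinct, so equality of the left ranks of the two points `0`
forces the matching to fix `0`. -/
lemma SameType.comp_succ {n : ℕ} {p p' : Fin (n + 1) → ℝ × ℝ} (hp' : Generic p')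
    (h : SameType p p') (h0 : leftRank p 0 = leftRank p' 0) :
    SameType (p ∘ Fin.succ) (p' ∘ Fin.succ) := by
  obtain ⟨e, he⟩ := h
  have he0 : e 0 = 0 := by
    apply hp'.leftRank_injective
    rw [leftRank_eq_of_lt_iff (fun i j => (he i j).1), h0]
  let f := e.subtypePerm (p := fun j => j ≠ 0) (fun j => by
    rw [ne_eq, ne_eq, ← he0, e.injective.eq_iff, he0])
  let q := finSuccAboveEquiv (0 : Fin (n + 1))
  refine ⟨(q.trans f).trans q.symm, fun j k => ?_⟩
  have hq : ∀ j, Fin.succ j = (q j).1 := by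
    intro j; simp [q, finSuccAboveEquiv_apply]
  have key : ∀ j, (p' ∘ Fin.succ) (((q.trans f).trans q.symm) j) = p' (e (Fin.succ j)) := by
    intro j
    rw [Function.comp, hq, hq]
    simp [f]
  rw [key, key]
  exact he _ _

end
end RandomPermuton

namespace RandomPermuton
noncomputable section

/-! ### Sampling from measures with diffuse marginals -/

/-- Both marginals have no atoms. -/
def DiffuseMarginals (μ : Measure (ℝ × ℝ)) : Prop :=
  (∀ x, μ {p | p.1 = x} = 0) ∧ ∀ y, μ {p | p.2 = y} = 0

lemma pi_map_pair {n : ℕ} {X : Type*} [MeasurableSpace X] (ν : Fin n → Measure X)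
    [∀ j, IsProbabilityMeasure (ν j)] {i j : Fin n} (hij : i ≠ j) :
    (Measure.pi ν).map (fun p => (p i, p j)) = (ν i).prod (ν j) := by
  have h := (iIndepFun_pi (μ := ν) (X := fun _ x => x) (fun _ => aemeasurable_id)).indepFun hij
  rw [indepFun_iff_map_prod_eq_prod_map_map (measurable_pi_apply i).aemeasurable
    (measurable_pi_apply j).aemeasurable] at h
  rw [h]
  congr 1
  · exact (measurePreserving_eval ν i).map_eq
  · exact (measurePreserving_eval ν j).map_eq

lemma ae_generic {n : ℕ} (ν : Fin n → Measure (ℝ × ℝ)) [∀ j, IsProbabilityMeasure (ν j)]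
    (h : ∀ j, DiffuseMarginals (ν j)) : ∀ᵐ p ∂(Measure.pi ν), Generic p := by
  have key : ∀ i j, i ≠ j → ∀ᵐ p ∂(Measure.pi ν), (p i).1 ≠ (p j).1 ∧ (p i).2 ≠ (p j).2 := by
    intro i j hij
    have h1 : ∀ᵐ q ∂((ν i).prod (ν j)), q.1.1 ≠ q.2.1 ∧ q.1.2 ≠ q.2.2 := by
      have m1 : MeasurableSet {q : (ℝ × ℝ) × (ℝ × ℝ) | q.1.1 = q.2.1} :=
        measurableSet_eq_fun (by fun_prop) (by fun_prop)
      have m2 : MeasurableSet {q : (ℝ × ℝ) × (ℝ × ℝ) | q.1.2 = q.2.2} :=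
        measurableSet_eq_fun (by fun_prop) (by fun_prop)
      have n1 : (ν i).prod (ν j) {q : (ℝ × ℝ) × (ℝ × ℝ) | q.1.1 = q.2.1} = 0 := by
        rw [Measure.measure_prod_null m1]
        refine Filter.Eventually.of_forall fun a => ?_
        have : Prod.mk a ⁻¹' {q : (ℝ × ℝ) × (ℝ × ℝ) | q.1.1 = q.2.1} = {p | p.1 = a.1} := by
          ext p; exact eq_comm
        change ν j (Prod.mk a ⁻¹' _) = 0
        rw [this]
        exact (h j).1 _
      have n2 : (ν i).prod (ν j) {q : (ℝ × ℝ) × (ℝ × ℝ) | q.1.2 = q.2.2} = 0 := by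
        rw [Measure.measure_prod_null m2]
        refine Filter.Eventually.of_forall fun a => ?_
        have : Prod.mk a ⁻¹' {q : (ℝ × ℝ) × (ℝ × ℝ) | q.1.2 = q.2.2} = {p | p.2 = a.2} := by
          ext p; exact eq_comm
        change ν j (Prod.mk a ⁻¹' _) = 0
        rw [this]
        exact (h j).2 _
      exact (measure_eq_zero_iff_ae_notMem.1 n1).and (measure_eq_zero_iff_ae_notMem.1 n2)
    rw [← pi_map_pair ν hij] at h1
    exact ae_of_ae_map (by fun_prop) h1
  have key' : ∀ᵐ p ∂(Measure.pi ν), ∀ i j, i ≠ j → (p i).1 ≠ (p j).1 ∧ (p i).2 ≠ (p j).2 := by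
    rw [ae_all_iff]; intro i
    rw [ae_all_iff]; intro j
    by_cases hij : i = j
    · simp [hij]
    · filter_upwards [key i j hij] with p hp _ using hp
  filter_upwards [key'] with p hp
  refine ⟨fun i j hij => ?_, fun i j hij => ?_⟩
  · by_contra hne; exact (hp i j hne).1 hij
  · by_contra hne; exact (hp i j hne).2 hij

lemma IsPermuton.measure_univ {μ : Measure (ℝ × ℝ)} (h : IsPermuton μ) : μ Set.univ = 1 := by
  have := congrArg (fun ν => ν Set.univ) h.1
  simpa [Measure.map_apply measurable_fst MeasurableSet.univ] using this

lemma IsPermuton.isProbabilityMeasure {μ : Measure (ℝ × ℝ)} (h : IsPermuton μ) :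
    IsProbabilityMeasure μ := ⟨h.measure_univ⟩

lemma IsPermuton.diffuse {μ : Measure (ℝ × ℝ)} (h : IsPermuton μ) : DiffuseMarginals μ := by
  constructor
  · intro x
    have := congrArg (fun ν => ν {x}) h.1
    simp only [Measure.map_apply measurable_fst (measurableSet_singleton x), measure_singleton]
      at this
    exact this
  · intro x
    have := congrArg (fun ν => ν {x}) h.2
    simp only [Measure.map_apply measurable_snd (measurableSet_singleton x), measure_singleton]
      at this
    exact this

lemma IsPermuton.ae_mem {μ : Measure (ℝ × ℝ)} (h : IsPermuton μ) :
    ∀ᵐ p ∂μ, p.1 ∈ Set.Icc (0 : ℝ) 1 ∧ p.2 ∈ Set.Icc (0 : ℝ) 1 := by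
  have h0 : ∀ᵐ x ∂(volume.restrict (Set.Icc (0 : ℝ) 1)), x ∈ Set.Icc (0 : ℝ) 1 :=
    ae_restrict_mem measurableSet_Icc
  have h1 := h0
  rw [← h.1] at h0
  rw [← h.2] at h1
  exact (ae_of_ae_map (by fun_prop) h0).and (ae_of_ae_map (by fun_prop) h1)

/-- The entropy of the pattern of `n` independent points. -/
lemma samplingEntropy_eq_ent {μ : Measure (ℝ × ℝ)} [IsProbabilityMeasure μ]
    (h : DiffuseMarginals μ) (n : ℕ) :
    samplingEntropy μ n = ent (law (Measure.pi fun _ : Fin n => μ) pat) := by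
  apply Finset.sum_congr rfl
  intro σ _
  congr 1
  apply measureReal_congr
  filter_upwards [ae_generic (fun _ : Fin n => μ) fun _ => h] with p hp
  exact propext hp.hasPattern_iff

lemma samplingEntropy_nonneg (μ : Measure (ℝ × ℝ)) [IsProbabilityMeasure μ] (n : ℕ) :
    0 ≤ samplingEntropy μ n :=
  ent_nonneg (P := patternDensity μ) (fun _ => measureReal_nonneg) fun _ => measureReal_le_one

/-- The exponent is `n` and not `n + 1`, so that the resulting bound `(n - 1) * log n` on the
entropy vanishes at `n = 1`; the variance bound by `m * (m - 1)` in `isCentered_deviation` relies on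
this. -/
lemma factorial_le_pow (n : ℕ) : (n + 1).factorial ≤ (n + 1) ^ n := by
  induction n with
  | zero => simp
  | succ n ih =>
    rw [Nat.factorial_succ, pow_succ, mul_comm]
    apply Nat.mul_le_mul_right
    exact ih.trans (Nat.pow_le_pow_left (by omega) n)

lemma samplingEntropy_le {μ : Measure (ℝ × ℝ)} (h : IsPermuton μ) {n : ℕ} (hn : 1 ≤ n) :
    samplingEntropy μ n ≤ (n - 1) * Real.log n := by
  have := h.isProbabilityMeasure
  rw [samplingEntropy_eq_ent h.diffuse]
  refine (ent_le_log_card (law_nonneg _ _) (sum_law measurableSet_pat)).trans ?_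
  rw [Fintype.card_perm, Fintype.card_fin]
  have h1 : (n.factorial : ℝ) ≤ (n : ℝ) ^ (n - 1) := by
    obtain ⟨n, rfl⟩ := Nat.exists_eq_add_of_le' hn
    exact_mod_cast factorial_le_pow n
  refine (Real.log_le_log (by exact_mod_cast n.factorial_pos) h1).trans (le_of_eq ?_)
  rw [Real.log_pow, Nat.cast_sub hn, Nat.cast_one]

/-! ### Removing a point -/

lemma measurableSet_leftRank {n : ℕ} (j : Fin n) (k : ℕ) :
    MeasurableSet {p : Fin n → ℝ × ℝ | leftRank p j = k} := by
  have : Measurable fun p : Fin n → ℝ × ℝ => leftRank p j := by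
    simp only [leftRank, Finset.card_filter]
    refine Finset.measurable_sum _ fun i _ => ?_
    exact Measurable.ite (measurableSet_lt (by fun_prop) (by fun_prop)) measurable_const
      measurable_const
  exact this (measurableSet_singleton k)

lemma pi_map_comp_succ {n : ℕ} {X : Type*} [MeasurableSpace X] (μ : Measure X)
    [IsProbabilityMeasure μ] :
    (Measure.pi fun _ : Fin (n + 1) => μ).map (fun p => p ∘ Fin.succ) =
      Measure.pi fun _ : Fin n => μ := by
  have h := measurePreserving_piFinSuccAbove (fun _ : Fin (n + 1) => μ) 0
  have h2 := (measurePreserving_snd (μ := μ) (ν := Measure.pi fun _ : Fin n => μ)).comp h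
  rw [← h2.map_eq]
  rfl

/-- Removing a point decreases the entropy of the pattern, up to a logarithmic error. -/
lemma samplingEntropy_le_succ {μ : Measure (ℝ × ℝ)} (h : IsPermuton μ) (n : ℕ) :
    samplingEntropy μ n ≤ samplingEntropy μ (n + 1) + Real.log (n + 1) := by
  have := h.isProbabilityMeasure
  rw [samplingEntropy_eq_ent h.diffuse, samplingEntropy_eq_ent h.diffuse]
  set P := Measure.pi fun _ : Fin (n + 1) => μ with hP
  -- The full pattern together with the left rank of the deleted point determines the remaining
  -- pattern, and the left rank has only `n + 1` values.
  let r : (Fin (n + 1) → ℝ × ℝ) → Fin (n + 1) := fun p => ⟨leftRank p 0, leftRank_lt p 0⟩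
  have hr : ∀ k, MeasurableSet (r ⁻¹' {k}) := by
    intro k
    have : r ⁻¹' {k} = {p | leftRank p 0 = k} := by
      ext p; exact Fin.ext_iff
    rw [this]
    exact measurableSet_leftRank 0 k
  have h1 : law (Measure.pi fun _ : Fin n => μ) pat =
      law P fun p : Fin (n + 1) → ℝ × ℝ => pat (p ∘ Fin.succ) := by
    funext σ
    rw [← pi_map_comp_succ, law_map (by fun_prop) measurableSet_pat]
    rfl
  rw [h1]
  have hm : ∀ x : Equiv.Perm (Fin (n + 1)) × Fin (n + 1),
      MeasurableSet ((fun p => (pat p, r p)) ⁻¹' {x}) := by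
    rintro ⟨a, b⟩
    have : (fun p => (pat p, r p)) ⁻¹' {(a, b)} = pat ⁻¹' {a} ∩ r ⁻¹' {b} := by
      ext ω; simp
    rw [this]
    exact (measurableSet_pat a).inter (hr b)
  have h2 := ent_law_le (P := P) (f := fun p => (pat p, r p)) (g := fun p => pat (p ∘ Fin.succ))
    (G := {p | Generic p}) hm (ae_generic (fun _ : Fin (n + 1) => μ) fun _ => h.diffuse)
    (fun p hp p' hp' hpp => by
      have h3 := congrArg Prod.fst hpp
      have h4 := congrArg (fun x => (x.2 : ℕ)) hpp
      exact ((hp.sameType_of_pat_eq hp' h3).comp_succ hp' h4).pat_eq)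
  have h3 := ent_law_prod_le (P := P) (f := pat) (g := r) measurableSet_pat hr
  rw [Fintype.card_fin] at h3
  push_cast at h3
  exact h2.trans h3

end
end RandomPermuton

namespace RandomPermuton
noncomputable section

/-! ### Inflations of a permutation by permutons -/

variable {d : ℕ}

/-- The left end of the `i`-th interval, when intervals of lengths `τ` are arranged in the order
prescribed by `α`. -/
def offset (α : Equiv.Perm (Fin d)) (τ : Fin d → ℝ) (i : Fin d) : ℝ := ∑ j with α j < α i, τ j

lemma offset_nonneg {α : Equiv.Perm (Fin d)} {τ : Fin d → ℝ} (hτ : ∀ i, 0 ≤ τ i) (i : Fin d) :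
    0 ≤ offset α τ i := Finset.sum_nonneg fun j _ => hτ j

lemma offset_add_le {α : Equiv.Perm (Fin d)} {τ : Fin d → ℝ} (hτ : ∀ i, 0 ≤ τ i) {i k : Fin d}
    (hik : α i < α k) : offset α τ i + τ i ≤ offset α τ k := by
  rw [offset, offset, add_comm,
    ← Finset.sum_insert (s := Finset.univ.filter fun j => α j < α i) (by simp)]
  apply Finset.sum_le_sum_of_subset_of_nonneg
  · intro j hj
    simp only [Finset.mem_insert, Finset.mem_filter, Finset.mem_univ, true_and] at hj ⊢
    rcases hj with rfl | hj
    · exact hik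
    · exact hj.trans hik
  · exact fun j _ _ => hτ j

/-- The similarity which maps the unit square onto the `i`-th cell. -/
def cellMap (α : Equiv.Perm (Fin d)) (τ : Fin d → ℝ) (i : Fin d) (p : ℝ × ℝ) : ℝ × ℝ :=
  (offset 1 τ i + τ i * p.1, offset α τ i + τ i * p.2)

/-- The measure which consists of scaled copies of the `μ i`, placed in the cells of `α`. -/
def inflate (α : Equiv.Perm (Fin d)) (τ : Fin d → ℝ) (μ : Fin d → Measure (ℝ × ℝ)) :
    Measure (ℝ × ℝ) :=
  ∑ i, ENNReal.ofReal (τ i) • (μ i).map (cellMap α τ i)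

@[fun_prop]
lemma continuous_cellMap (α : Equiv.Perm (Fin d)) (τ : Fin d → ℝ) (i : Fin d) :
    Continuous (cellMap α τ i) := by
  unfold cellMap; fun_prop

@[fun_prop]
lemma measurable_cellMap (α : Equiv.Perm (Fin d)) (τ : Fin d → ℝ) (i : Fin d) :
    Measurable (cellMap α τ i) := (continuous_cellMap α τ i).measurable

/-- Sampling from a mixture amounts to choosing the colours first and then the points independently.
-/
lemma pi_sum_smul {n : ℕ} {X : Type*} [MeasurableSpace X] (ν : Fin d → Measure X)
    [∀ i, IsFiniteMeasure (ν i)] (w : Fin d → ENNReal) (hw : ∀ i, w i ≠ ⊤) :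
    Measure.pi (fun _ : Fin n => ∑ i, w i • ν i) =
      ∑ c : Fin n → Fin d, (∏ j, w (c j)) • Measure.pi fun j => ν (c j) := by
  have (i : Fin d) : IsFiniteMeasure (w i • ν i) := Measure.smul_finite _ (hw i)
  apply Measure.pi_eq
  intro s _
  simp only [Measure.finsetSum_apply, Measure.smul_apply, smul_eq_mul, Measure.pi_pi,
    ← Finset.prod_mul_distrib]
  exact (Fintype.prod_sum (fun j i => w i * ν i (s j))).symm

lemma cellMap_fst_le {α : Equiv.Perm (Fin d)} {τ : Fin d → ℝ} (hτ : ∀ i, 0 ≤ τ i) {i k : Fin d}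
    (hik : i < k) {p q : ℝ × ℝ} (hp : p.1 ≤ 1) (hq : 0 ≤ q.1) :
    (cellMap α τ i p).1 ≤ (cellMap α τ k q).1 := by
  have h1 := offset_add_le (α := 1) hτ hik
  have h2 := mul_le_mul_of_nonneg_left hp (hτ i)
  have h3 := mul_nonneg (hτ k) hq
  simp only [cellMap]
  linarith

lemma cellMap_snd_le {α : Equiv.Perm (Fin d)} {τ : Fin d → ℝ} (hτ : ∀ i, 0 ≤ τ i) {i k : Fin d}
    (hik : α i < α k) {p q : ℝ × ℝ} (hp : p.2 ≤ 1) (hq : 0 ≤ q.2) :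
    (cellMap α τ i p).2 ≤ (cellMap α τ k q).2 := by
  have h1 := offset_add_le (α := α) hτ hik
  have h2 := mul_le_mul_of_nonneg_left hp (hτ i)
  have h3 := mul_nonneg (hτ k) hq
  simp only [cellMap]
  linarith

lemma DiffuseMarginals.map_cellMap {μ : Measure (ℝ × ℝ)} (h : DiffuseMarginals μ)
    {α : Equiv.Perm (Fin d)} {τ : Fin d → ℝ} {i : Fin d} (hτ : 0 < τ i) :
    DiffuseMarginals (μ.map (cellMap α τ i)) := by
  constructor
  · intro x
    rw [Measure.map_apply (by fun_prop) (measurableSet_eq_fun (by fun_prop) (by fun_prop))]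
    refine measure_mono_null ?_ (h.1 ((x - offset 1 τ i) / τ i))
    rintro p hp
    change _ + _ = x at hp
    change p.1 = _
    rw [eq_div_iff hτ.ne', ← hp]; ring
  · intro x
    rw [Measure.map_apply (by fun_prop) (measurableSet_eq_fun (by fun_prop) (by fun_prop))]
    refine measure_mono_null ?_ (h.2 ((x - offset α τ i) / τ i))
    rintro p hp
    change _ + _ = x at hp
    change p.2 = _
    rw [eq_div_iff hτ.ne', ← hp]; ring

/-- Neighbouring cells may touch, so their geometry gives only weak inequalities. Genericity makes
them strict, and genericity requires that the cells in use have positive size. -/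
lemma ae_colored {n : ℕ} {α : Equiv.Perm (Fin d)} {τ : Fin d → ℝ} (hτ : ∀ i, 0 ≤ τ i)
    {μ : Fin d → Measure (ℝ × ℝ)} (hμ : ∀ i, IsPermuton (μ i)) {c : Fin n → Fin d}
    (hc : ∀ j, 0 < τ (c j)) :
    ∀ᵐ p ∂(Measure.pi fun j => (μ (c j)).map (cellMap α τ (c j))), Generic p ∧ Colored α c p := by
  have (i : Fin d) := (hμ i).isProbabilityMeasure
  have (i : Fin d) : IsProbabilityMeasure ((μ i).map (cellMap α τ i)) :=
    Measure.isProbabilityMeasure_map (by fun_prop)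
  have h1 := ae_generic (fun j => (μ (c j)).map (cellMap α τ (c j)))
    fun j => (hμ (c j)).diffuse.map_cellMap (hc j)
  have h2 : ∀ᵐ p ∂(Measure.pi fun j => (μ (c j)).map (cellMap α τ (c j))),
      ∀ j, ∃ q : ℝ × ℝ, (q.1 ∈ Set.Icc (0 : ℝ) 1 ∧ q.2 ∈ Set.Icc (0 : ℝ) 1) ∧
        cellMap α τ (c j) q = p j := by
    rw [ae_all_iff]
    intro j
    have h3 : ∀ᵐ x ∂((μ (c j)).map (cellMap α τ (c j))),
        x ∈ cellMap α τ (c j) '' {q | q.1 ∈ Set.Icc (0 : ℝ) 1 ∧ q.2 ∈ Set.Icc (0 : ℝ) 1} := by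
      rw [ae_map_iff (by fun_prop)]
      · filter_upwards [(hμ (c j)).ae_mem] with q hq
        exact ⟨q, hq, rfl⟩
      · apply IsCompact.measurableSet
        apply IsCompact.image _ (continuous_cellMap α τ (c j))
        have : {q : ℝ × ℝ | q.1 ∈ Set.Icc (0 : ℝ) 1 ∧ q.2 ∈ Set.Icc (0 : ℝ) 1} =
          Set.Icc 0 1 ×ˢ Set.Icc 0 1 := by ext q; rfl
        rw [this]
        exact isCompact_Icc.prod isCompact_Icc
    rw [← (measurePreserving_eval (fun j => (μ (c j)).map (cellMap α τ (c j))) j).map_eq] at h3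
    exact ae_of_ae_map (measurable_pi_apply j).aemeasurable h3
  filter_upwards [h1, h2] with p hp hq
  refine ⟨hp, fun j k => ⟨fun hjk => ?_, fun hjk => ?_⟩⟩
  · obtain ⟨q, hq1, hq2⟩ := hq j
    obtain ⟨r, hr1, hr2⟩ := hq k
    refine lt_of_le_of_ne ?_ (hp.1.ne (by rintro rfl; exact lt_irrefl _ hjk))
    rw [← hq2, ← hr2]
    exact cellMap_fst_le hτ hjk hq1.1.2 hr1.1.1
  · obtain ⟨q, hq1, hq2⟩ := hq j
    obtain ⟨r, hr1, hr2⟩ := hq k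
    refine lt_of_le_of_ne ?_ (hp.2.ne (by rintro rfl; exact lt_irrefl _ hjk))
    rw [← hq2, ← hr2]
    exact cellMap_snd_le hτ hjk hq1.2.2 hr1.2.1

lemma pi_map_colorPart {n : ℕ} {X : Type*} [MeasurableSpace X] (ν : Fin d → Measure X)
    [∀ i, IsProbabilityMeasure (ν i)] (c : Fin n → Fin d) :
    (Measure.pi fun j => ν (c j)).map (colorPart c) =
      Measure.pi fun i => Measure.pi fun _ : Fin (colorCount c i) => ν i := by
  have h1 := measurePreserving_piCongrLeft (fun j => ν (c j)) (colorEquiv c)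
  have h2 := Measure.infinitePi_map_piCurry (fun i (_ : Fin (colorCount c i)) => ν i)
  simp only [Measure.infinitePi_eq_pi] at h2
  have h3 : (fun x => ν (c (colorEquiv c x))) =
      fun x : Σ i, Fin (colorCount c i) => ν x.1 := by
    funext x; rw [color_colorEquiv c x]
  rw [← h2, ← h3, ← (h1.symm).map_eq, Measure.map_map (MeasurableEquiv.measurable _)
    (MeasurableEquiv.measurable _)]
  rfl

lemma pat_cellMap {n : ℕ} {α : Equiv.Perm (Fin d)} {τ : Fin d → ℝ} {i : Fin d} (hτ : 0 < τ i)
    (p : Fin n → ℝ × ℝ) : pat (fun j => cellMap α τ i (p j)) = pat p := by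
  symm
  apply SameType.pat_eq
  refine ⟨Equiv.refl _, fun j k => ⟨?_, ?_⟩⟩ <;>
  simp [cellMap, hτ]

/-- The alternative `n = 0` serves the cells of size zero, which receive no points. -/
lemma law_pat_cellMap {n : ℕ} {α : Equiv.Perm (Fin d)} {τ : Fin d → ℝ} {i : Fin d}
    (hτ : 0 < τ i ∨ n = 0) (μ : Measure (ℝ × ℝ)) [IsProbabilityMeasure μ] :
    law (Measure.pi fun _ : Fin n => μ.map (cellMap α τ i)) pat =
      law (Measure.pi fun _ : Fin n => μ) pat := by
  funext σ
  have : IsProbabilityMeasure (μ.map (cellMap α τ i)) :=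
    Measure.isProbabilityMeasure_map (by fun_prop)
  rw [← Measure.pi_map_pi (fun _ => (measurable_cellMap α τ i).aemeasurable),
    law_map (by fun_prop) measurableSet_pat]
  congr 1
  funext p
  rcases hτ with hτ | rfl
  · exact pat_cellMap hτ p
  · exact Subsingleton.elim _ _

/-- Given the colours of the points, the entropy of the pattern is the sum of the entropies of the
patterns inside the cells. -/
lemma ent_law_pat_colored {n : ℕ} {α : Equiv.Perm (Fin d)} {τ : Fin d → ℝ} (hτ : ∀ i, 0 ≤ τ i)
    {μ : Fin d → Measure (ℝ × ℝ)} (hμ : ∀ i, IsPermuton (μ i)) {c : Fin n → Fin d}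
    (hc : ∀ j, 0 < τ (c j)) :
    ent (law (Measure.pi fun j => (μ (c j)).map (cellMap α τ (c j))) pat) =
      ∑ i, samplingEntropy (μ i) (colorCount c i) := by
  have (i : Fin d) := (hμ i).isProbabilityMeasure
  have (i : Fin d) : IsProbabilityMeasure ((μ i).map (cellMap α τ i)) :=
    Measure.isProbabilityMeasure_map (by fun_prop)
  set P := Measure.pi fun j => (μ (c j)).map (cellMap α τ (c j)) with hP
  let f : (Fin n → ℝ × ℝ) → ∀ i, Equiv.Perm (Fin (colorCount c i)) :=
    fun p i => pat (colorPart c p i)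
  have hmeas : Measurable (colorPart c : (Fin n → ℝ × ℝ) → _) := by
    unfold colorPart
    fun_prop
  have hpre : ∀ a, f ⁻¹' {a} = colorPart c ⁻¹' (Set.univ.pi fun i => pat ⁻¹' {a i}) := by
    intro a; ext p
    simp [f, funext_iff]
  have hset : ∀ a : ∀ i, Equiv.Perm (Fin (colorCount c i)),
      MeasurableSet (Set.univ.pi fun i => (pat : (Fin (colorCount c i) → ℝ × ℝ) → _) ⁻¹' {a i}) :=
    fun a => MeasurableSet.univ_pi fun i => measurableSet_pat _
  have hf : ∀ a, MeasurableSet (f ⁻¹' {a}) := by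
    intro a
    rw [hpre]
    exact hmeas (hset a)
  have hlaw : law P f = fun a => ∏ i, law (Measure.pi fun _ : Fin (colorCount c i) => μ i) pat
      (a i) := by
    funext a
    rw [law, hpre, ← map_measureReal_apply hmeas (hset a), hP,
      pi_map_colorPart (fun i => (μ i).map (cellMap α τ i)) c, measureReal_def,
      Measure.pi_pi, ENNReal.toReal_prod]
    apply Finset.prod_congr rfl
    intro i _
    rw [← law_pat_cellMap (α := α) (τ := τ) (i := i)]
    · rfl
    · by_cases hi : 0 < τ i
      · exact Or.inl hi
      · right
        rw [Fintype.card_eq_zero_iff]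
        exact ⟨fun j => hi (j.2 ▸ hc j.1)⟩
  have hG := ae_colored (α := α) hτ hμ hc
  -- On generic coloured tuples the pattern and the family of patterns of the colour classes
  -- determine each other, so both have the same entropy.
  have h1 : ent (law P pat) = ent (law P f) := by
    apply le_antisymm
    · exact ent_law_le (G := {p | Generic p ∧ Colored α c p}) hf hG
        fun p hp p' hp' h => (hp.2.sameType_of_colorPart hp'.2 fun i =>
          hp.1.colorPart i |>.sameType_of_pat_eq (hp'.1.colorPart i) (congrFun h i)).pat_eq
    · exact ent_law_le (G := {p | Generic p ∧ Colored α c p}) measurableSet_pat hG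
        fun p hp p' hp' h => funext fun i =>
          (hp.2.colorPart_sameType hp'.2 (hp.1.sameType_of_pat_eq hp'.1 h) i).pat_eq
  rw [h1, hlaw, ent_pi fun i => sum_law measurableSet_pat]
  exact Finset.sum_congr rfl fun i _ => (samplingEntropy_eq_ent (hμ i).diffuse _).symm

/-- A pattern does not depend on the numbering of the points, and two colourings with the same
counts differ by a renumbering. -/
lemma law_pat_eq_of_colorCount {n : ℕ} (ν : Fin d → Measure (ℝ × ℝ))
    [∀ i, IsProbabilityMeasure (ν i)] {c c' : Fin n → Fin d}
    (h : ∀ i, colorCount c i = colorCount c' i) :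
    law (Measure.pi fun j => ν (c j)) pat = law (Measure.pi fun j => ν (c' j)) pat := by
  let f : Fin n ≃ Fin n := ((colorEquiv c).symm.trans
    (Equiv.sigmaCongrRight fun i => finCongr (h i))).trans (colorEquiv c')
  have hf : ∀ j, c' (f j) = c j := by
    intro j
    obtain ⟨x, rfl⟩ := (colorEquiv c).surjective j
    simp [f, color_colorEquiv]
  have h1 := (measurePreserving_piCongrLeft (fun j => ν (c' j)) f).map_eq
  simp only [hf] at h1
  funext σ
  rw [← h1, law_map (MeasurableEquiv.measurable _) measurableSet_pat]
  congr 1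
  funext p
  rw [Function.comp, ← pat_comp_perm (MeasurableEquiv.piCongrLeft (fun _ => ℝ × ℝ) f p) f]
  congr 1
  funext j
  exact (Equiv.piCongrLeft_apply_apply (fun _ => ℝ × ℝ) f p j).symm

lemma law_pat_inflate {α : Equiv.Perm (Fin d)} {τ : Fin d → ℝ} (hτ : ∀ i, 0 ≤ τ i)
    {μ : Fin d → Measure (ℝ × ℝ)} (hμ : ∀ i, IsPermuton (μ i)) (n : ℕ) :
    law (Measure.pi fun _ : Fin n => inflate α τ μ) pat = fun σ => ∑ c : Fin n → Fin d,
      (∏ j, τ (c j)) * law (Measure.pi fun j => (μ (c j)).map (cellMap α τ (c j))) pat σ := by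
  have (i : Fin d) := (hμ i).isProbabilityMeasure
  have (i : Fin d) : IsProbabilityMeasure ((μ i).map (cellMap α τ i)) :=
    Measure.isProbabilityMeasure_map (by fun_prop)
  funext σ
  rw [law, inflate, pi_sum_smul _ _ (fun i => ENNReal.ofReal_ne_top), measureReal_def,
    Measure.finsetSum_apply, ENNReal.toReal_sum]
  · apply Finset.sum_congr rfl
    intro c _
    rw [Measure.smul_apply, smul_eq_mul, ENNReal.toReal_mul, ENNReal.toReal_prod]
    congr 1
    exact Finset.prod_congr rfl fun j _ => ENNReal.toReal_ofReal (hτ _)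
  · intro c _
    rw [Measure.smul_apply, smul_eq_mul]
    exact ENNReal.mul_ne_top (ENNReal.prod_ne_top fun j _ => ENNReal.ofReal_ne_top)
      (measure_ne_top _ _)

lemma sum_prod_eq_one {τ : Fin d → ℝ} (hτ1 : ∑ i, τ i = 1) (n : ℕ) :
    ∑ c : Fin n → Fin d, ∏ j, τ (c j) = 1 := by
  rw [← Fintype.prod_sum (fun (_ : Fin n) i => τ i)]
  simp [hτ1]

/-- The number of points in the `i`-th cell is binomial with parameters `n` and `τ i`. Colourings
which use a cell of size zero have weight zero, so `ent_law_pat_colored` is needed only for the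
others. -/
lemma sum_prod_mul_ent_colored {α : Equiv.Perm (Fin d)} {τ : Fin d → ℝ} (hτ : ∀ i, 0 ≤ τ i)
    (hτ1 : ∑ i, τ i = 1) {μ : Fin d → Measure (ℝ × ℝ)} (hμ : ∀ i, IsPermuton (μ i)) (n : ℕ) :
    ∑ c : Fin n → Fin d, (∏ j, τ (c j)) *
        ent (law (Measure.pi fun j => (μ (c j)).map (cellMap α τ (c j))) pat) =
      ∑ i, thin (τ i) (samplingEntropy (μ i)) n := by
  simp only [← sum_prod_color τ hτ1]
  rw [Finset.sum_comm]
  apply Finset.sum_congr rfl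
  intro c _
  rw [← Finset.mul_sum]
  by_cases hc : ∀ j, 0 < τ (c j)
  · rw [ent_law_pat_colored hτ hμ hc]
  · push Not at hc
    obtain ⟨j, hj⟩ := hc
    rw [Finset.prod_eq_zero (Finset.mem_univ j) (le_antisymm hj (hτ _)), zero_mul, zero_mul]

/-- The entropy of an inflation is at least the average of the entropies inside the cells. -/
lemma sum_thin_le_samplingEntropy {α : Equiv.Perm (Fin d)} {τ : Fin d → ℝ} (hτ : ∀ i, 0 ≤ τ i)
    (hτ1 : ∑ i, τ i = 1) {μ : Fin d → Measure (ℝ × ℝ)} (hμ : ∀ i, IsPermuton (μ i))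
    (h : IsPermuton (inflate α τ μ)) (n : ℕ) :
    ∑ i, thin (τ i) (samplingEntropy (μ i)) n ≤ samplingEntropy (inflate α τ μ) n := by
  have := h.isProbabilityMeasure
  rw [samplingEntropy_eq_ent h.diffuse, law_pat_inflate hτ hμ,
    ← sum_prod_mul_ent_colored (α := α) hτ hτ1 hμ]
  exact sum_mul_ent_le_ent_mix (fun c => Finset.prod_nonneg fun j _ => hτ _)
    (sum_prod_eq_one hτ1 n) fun c σ => law_nonneg _ _ _

/-- The entropy of an inflation exceeds the average of the entropies inside the cells by at most
a logarithmic error. -/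
lemma samplingEntropy_le_sum_thin {α : Equiv.Perm (Fin d)} {τ : Fin d → ℝ} (hτ : ∀ i, 0 ≤ τ i)
    (hτ1 : ∑ i, τ i = 1) {μ : Fin d → Measure (ℝ × ℝ)} (hμ : ∀ i, IsPermuton (μ i))
    (h : IsPermuton (inflate α τ μ)) (n : ℕ) :
    samplingEntropy (inflate α τ μ) n ≤
      ∑ i, thin (τ i) (samplingEntropy (μ i)) n + d * Real.log (n + 1) := by
  have := h.isProbabilityMeasure
  have (i : Fin d) := (hμ i).isProbabilityMeasure
  have (i : Fin d) : IsProbabilityMeasure ((μ i).map (cellMap α τ i)) :=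
    Measure.isProbabilityMeasure_map (by fun_prop)
  rw [samplingEntropy_eq_ent h.diffuse, law_pat_inflate hτ hμ,
    ← sum_prod_mul_ent_colored (α := α) hτ hτ1 hμ]
  have hlt : ∀ (c : Fin n → Fin d) i, colorCount c i < n + 1 := by
    intro c i
    have := Fintype.card_subtype_le fun j => c j = i
    rw [Fintype.card_fin] at this
    exact Nat.lt_succ_of_le this
  -- The classes are the vectors of colour counts. They lie in a set of size `(n + 1) ^ d`, whose
  -- logarithm is the error term.
  have key := ent_mix_le (m := fun c : Fin n → Fin d => ∏ j, τ (c j))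
    (P := fun c => law (Measure.pi fun j => (μ (c j)).map (cellMap α τ (c j))) pat)
    (fun c => Finset.prod_nonneg fun j _ => hτ _) (sum_prod_eq_one hτ1 n)
    (fun c σ => law_nonneg _ _ _) (fun c => sum_law measurableSet_pat)
    (fun c (i : Fin d) => (⟨colorCount c i, hlt c i⟩ : Fin (n + 1)))
    (fun c c' hcc => law_pat_eq_of_colorCount (fun i => (μ i).map (cellMap α τ i)) fun i => by
      simpa using congrFun hcc i)
  refine key.trans (le_of_eq ?_)
  simp

end
end RandomPermuton

namespace RandomPermuton
noncomputable section

variable {d : ℕ}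

/-! ### Subdivisions of an interval -/

lemma offset_add_le_one {α : Equiv.Perm (Fin d)} {τ : Fin d → ℝ} (hτ : ∀ i, 0 ≤ τ i)
    (hτ1 : ∑ i, τ i = 1) (i : Fin d) : offset α τ i + τ i ≤ 1 := by
  rw [← hτ1, offset, add_comm,
    ← Finset.sum_insert (s := Finset.univ.filter fun j => α j < α i) (by simp)]
  exact Finset.sum_le_sum_of_subset_of_nonneg (Finset.subset_univ _) fun j _ _ => hτ j

lemma exists_mem_offset {α : Equiv.Perm (Fin d)} {τ : Fin d → ℝ} (hτ1 : ∑ i, τ i = 1) {y : ℝ}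
    (hy0 : 0 ≤ y) (hy1 : y < 1) :
    ∃ i, offset α τ i ≤ y ∧ y < offset α τ i + τ i := by
  classical
  -- `P k` is the total length of the first `k` intervals in the order `α`. The first `k` for which
  -- it exceeds `y` singles out the interval of rank `k - 1`.
  let P : ℕ → ℝ := fun k => ∑ j with (α j : ℕ) < k, τ j
  have hP : ∃ k, y < P k := by
    refine ⟨d, ?_⟩
    have : P d = 1 := by
      rw [← hτ1]
      exact Finset.sum_congr (Finset.filter_true_of_mem fun j _ => (α j).2) fun _ _ => rfl
    rwa [this]
  have hspec := Nat.find_spec hP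
  set k := Nat.find hP with hk
  have hk0 : k ≠ 0 := by
    intro h0
    rw [h0] at hspec
    simp [P] at hspec
    linarith
  obtain ⟨m, hm⟩ := Nat.exists_eq_succ_of_ne_zero hk0
  have hPm : P m ≤ y := not_lt.1 (Nat.find_min hP (by omega))
  have hmd : m < d := by
    by_contra hmd
    have : P k = P m := by
      apply Finset.sum_congr _ fun _ _ => rfl
      ext j
      have := (α j).2
      simp only [Finset.mem_filter, Finset.mem_univ, true_and]
      omega
    linarith
  refine ⟨α.symm ⟨m, hmd⟩, ?_, ?_⟩
  · refine le_trans (le_of_eq ?_) hPm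
    rw [offset]
    simp [P, Fin.lt_def]
  · refine lt_of_lt_of_le hspec (le_of_eq ?_)
    rw [offset, add_comm, ← Finset.sum_insert (s := Finset.univ.filter fun j =>
      α j < α (α.symm ⟨m, hmd⟩)) (by simp)]
    apply Finset.sum_congr _ fun _ _ => rfl
    ext j
    rw [hm]
    simp only [Finset.mem_filter, Finset.mem_univ, true_and, Finset.mem_insert,
      Equiv.apply_symm_apply, Fin.lt_def, Equiv.eq_symm_apply, Fin.ext_iff]
    omega

/-- An interval is the disjoint union of the intervals of a subdivision. -/
lemma restrict_Ico_eq_sum {α : Equiv.Perm (Fin d)} {τ : Fin d → ℝ} (hτ : ∀ i, 0 ≤ τ i)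
    (hτ1 : ∑ i, τ i = 1) (b : ℝ) {l : ℝ} (hl : 0 ≤ l) :
    volume.restrict (Set.Ico b (b + l)) = ∑ i, volume.restrict
      (Set.Ico (b + l * offset α τ i) (b + l * offset α τ i + l * τ i)) := by
  have hU : Set.Ico b (b + l) = ⋃ i, Set.Ico (b + l * offset α τ i)
      (b + l * offset α τ i + l * τ i) := by
    ext x
    simp only [Set.mem_iUnion, Set.mem_Ico]
    constructor
    · rintro ⟨h1, h2⟩
      have hl0 : 0 < l := by linarith
      obtain ⟨i, hi1, hi2⟩ := exists_mem_offset (α := α) hτ1 (y := (x - b) / l)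
        (div_nonneg (by linarith) hl) (by rw [div_lt_one hl0]; linarith)
      rw [le_div_iff₀ hl0] at hi1
      rw [div_lt_iff₀ hl0] at hi2
      exact ⟨i, by linarith, by linarith⟩
    · rintro ⟨i, h1, h2⟩
      have h3 := mul_nonneg hl (offset_nonneg (α := α) hτ i)
      have h4 := mul_le_mul_of_nonneg_left (offset_add_le_one (α := α) hτ hτ1 i) hl
      constructor <;> linarith
  rw [hU, Measure.restrict_iUnion _ fun i => measurableSet_Ico, Measure.sum_fintype]
  have key : ∀ i k, α i < α k → Disjoint
      (Set.Ico (b + l * offset α τ i) (b + l * offset α τ i + l * τ i))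
      (Set.Ico (b + l * offset α τ k) (b + l * offset α τ k + l * τ k)) := by
    intro i k hik
    rw [Set.disjoint_left]
    intro x hx hx'
    have := mul_le_mul_of_nonneg_left (offset_add_le hτ hik) hl
    have := hx.2
    have := hx'.1
    linarith
  intro i k hik
  rcases lt_or_gt_of_ne (α.injective.ne hik) with h | h
  · exact key i k h
  · exact (key k i h).symm

lemma smul_map_restrict_Ico (a : ℝ) {t : ℝ} (ht : 0 ≤ t) :
    ENNReal.ofReal t • (volume.restrict (Set.Ico (0 : ℝ) 1)).map (fun x => a + t * x) =
      volume.restrict (Set.Ico a (a + t)) := by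
  rcases ht.eq_or_lt with rfl | ht
  · simp
  have h1 : ENNReal.ofReal t • (volume : Measure ℝ).map (fun x => a + t * x) = volume := by
    have h2 := Real.smul_map_volume_mul_left ht.ne'
    rw [abs_of_pos ht] at h2
    calc ENNReal.ofReal t • (volume : Measure ℝ).map (fun x => a + t * x)
        = (ENNReal.ofReal t • (volume : Measure ℝ).map (fun x => t * x)).map (fun x => a + x) := by
          rw [Measure.map_smul, Measure.map_map (by fun_prop) (by fun_prop)]
          rfl
      _ = volume := by rw [h2]; exact map_add_left_eq_self volume a
  conv_rhs => rw [← h1]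
  rw [Measure.restrict_smul, Measure.restrict_map (by fun_prop) measurableSet_Ico]
  congr 3
  ext x
  simp only [Set.mem_Ico, Set.mem_preimage]
  constructor
  · rintro ⟨h1, h2⟩
    constructor <;> nlinarith
  · rintro ⟨h1, h2⟩
    constructor <;> nlinarith

/-! ### The geometry of the tree -/

/-- The weights of the edges from a node to its children are nonnegative and have sum `1`. -/
def IsWeight (w : Node d → Fin d → ℝ) : Prop := (∀ s i, 0 ≤ w s i) ∧ ∀ s, ∑ i, w s i = 1

/-- The restriction of a function on the nodes to the subtree of the `i`-th child of the root. -/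
def subtree {X : Type*} (i : Fin d) (f : Node d → X) : Node d → X := fun s => f (s ++ [i])

lemma IsWeight.subtree {w : Node d → Fin d → ℝ} (hw : IsWeight w) (i : Fin d) :
    IsWeight (subtree i w) :=
  ⟨fun s => hw.1 (s ++ [i]), fun s => hw.2 (s ++ [i])⟩

lemma bottom_cons (S : Node d → Equiv.Perm (Fin d)) (w : Node d → Fin d → ℝ) (i : Fin d)
    (s : Node d) : bottom S w (i :: s) = bottom S w s + side w s * offset (S s) (w s) i := rfl

/-- The horizontal geometry is the vertical geometry for identity labels, so facts about `bottom`
serve both axes. -/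
lemma left_eq_bottom (w : Node d → Fin d → ℝ) (s : Node d) :
    left w s = bottom (fun _ => 1) w s := by
  induction s with
  | nil => rfl
  | cons i s ih => rw [bottom_cons, ← ih]; rfl

lemma side_append (w : Node d → Fin d → ℝ) (i : Fin d) (s : Node d) :
    side w (s ++ [i]) = w [] i * side (subtree i w) s := by
  induction s with
  | nil => simp [side]
  | cons j s ih =>
    rw [List.cons_append, side, ih, side, mul_assoc]
    rfl

/-- The first step from the root is the last entry of the list, so appending `i` embeds the subtree
of the `i`-th child. This is the self-similarity of the geometry. -/
lemma bottom_append (S : Node d → Equiv.Perm (Fin d)) (w : Node d → Fin d → ℝ) (i : Fin d)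
    (s : Node d) : bottom S w (s ++ [i]) =
      offset (S []) (w []) i + w [] i * bottom (subtree i S) (subtree i w) s := by
  induction s with
  | nil => simp [bottom, side, offset]
  | cons j s ih =>
    rw [List.cons_append, bottom_cons, ih, side_append, bottom_cons]
    change _ + _ * offset (subtree i S s) (subtree i w s) j = _
    ring

section Weight

variable {w : Node d → Fin d → ℝ} (hw : IsWeight w)
include hw

lemma side_nonneg (s : Node d) : 0 ≤ side w s := by
  induction s with
  | nil => simp [side]
  | cons i s ih => exact mul_nonneg ih (hw.1 s i)

lemma bottom_nonneg (S : Node d → Equiv.Perm (Fin d)) (s : Node d) : 0 ≤ bottom S w s := by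
  induction s with
  | nil => simp [bottom]
  | cons i s ih =>
    rw [bottom_cons]
    exact add_nonneg ih (mul_nonneg (side_nonneg hw s) (offset_nonneg (hw.1 s) i))

lemma bottom_le_append (S : Node d → Equiv.Perm (Fin d)) (t s : Node d) :
    bottom S w s ≤ bottom S w (t ++ s) := by
  induction t with
  | nil => simp
  | cons i t ih =>
    rw [List.cons_append, bottom_cons]
    exact ih.trans (le_add_of_nonneg_right
      (mul_nonneg (side_nonneg hw _) (offset_nonneg (hw.1 _) i)))

lemma bottom_add_side_append_le (S : Node d → Equiv.Perm (Fin d)) (t s : Node d) :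
    bottom S w (t ++ s) + side w (t ++ s) ≤ bottom S w s + side w s := by
  induction t with
  | nil => simp
  | cons i t ih =>
    refine le_trans ?_ ih
    rw [List.cons_append, bottom_cons, side]
    have := mul_le_mul_of_nonneg_left (offset_add_le_one (α := S (t ++ s)) (hw.1 (t ++ s))
      (hw.2 (t ++ s)) i) (side_nonneg hw (t ++ s))
    linarith

lemma bottom_add_side_le_one (S : Node d → Equiv.Perm (Fin d)) (s : Node d) :
    bottom S w s + side w s ≤ 1 := by
  have := bottom_add_side_append_le hw S s []
  simpa [bottom, side] using this

/-- At each level, the intervals of the nodes form a subdivision of `[0, 1]`. -/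
lemma restrict_Ico_eq_sum_level (S : Node d → Equiv.Perm (Fin d)) (n : ℕ) :
    volume.restrict (Set.Ico (0 : ℝ) 1) = ∑ v : Fin n → Fin d, volume.restrict
      (Set.Ico (bottom S w (List.ofFn v)) (bottom S w (List.ofFn v) + side w (List.ofFn v))) := by
  induction n with
  | zero => simp [bottom, side]
  | succ n ih =>
    rw [ih, ← (Fin.consEquiv fun _ => Fin d).sum_comp, Fintype.sum_prod_type, Finset.sum_comm]
    apply Finset.sum_congr rfl
    intro v _
    rw [restrict_Ico_eq_sum (α := S (List.ofFn v)) (hw.1 _) (hw.2 (List.ofFn v)) _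
      (side_nonneg hw _)]
    apply Finset.sum_congr rfl
    intro i _
    have : List.ofFn ((Fin.consEquiv fun _ => Fin d) (i, v)) = i :: List.ofFn v :=
      List.ofFn_cons i v
    rw [this, bottom_cons, side]

lemma sum_side_level (n : ℕ) : ∑ v : Fin n → Fin d, side w (List.ofFn v) = 1 := by
  have h := congrArg (fun ν => (ν Set.univ).toReal)
    (restrict_Ico_eq_sum_level hw (fun _ => 1) n)
  simp only [Measure.restrict_apply MeasurableSet.univ, Set.univ_inter, Real.volume_Ico,
    Measure.finsetSum_apply, sub_zero, ENNReal.ofReal_one, ENNReal.toReal_one,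
    add_sub_cancel_left] at h
  rw [ENNReal.toReal_sum (fun _ _ => ENNReal.ofReal_ne_top)] at h
  rw [h]
  exact Finset.sum_congr rfl fun v _ => (ENNReal.toReal_ofReal (side_nonneg hw _)).symm

end Weight

/-- The horizontal interval of a node. -/
def interval (w : Node d → Fin d → ℝ) (s : Node d) : Set ℝ :=
  Set.Ico (left w s) (left w s + side w s)

lemma measurableSet_interval (w : Node d → Fin d → ℝ) (s : Node d) :
    MeasurableSet (interval w s) := measurableSet_Ico

lemma mem_interval_append {w : Node d → Fin d → ℝ} {i : Fin d} (hi : 0 < w [] i) (s : Node d)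
    (x : ℝ) : offset 1 (w []) i + w [] i * x ∈ interval w (s ++ [i]) ↔
      x ∈ interval (subtree i w) s := by
  simp only [interval, left_eq_bottom, bottom_append, side_append, Set.mem_Ico]
  change offset 1 (w []) i + w [] i * bottom (fun _ => 1) (subtree i w) s ≤ _ ∧
    _ < offset 1 (w []) i + w [] i * bottom (fun _ => 1) (subtree i w) s + _ ↔ _
  rw [add_le_add_iff_left, mul_le_mul_iff_right₀ hi, add_assoc, add_lt_add_iff_left, ← mul_add,
    mul_lt_mul_iff_right₀ hi]

lemma interval_append_subset {w : Node d → Fin d → ℝ} (hw : IsWeight w) (t s : Node d) :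
    interval w (t ++ s) ⊆ interval w s := by
  have h1 := bottom_le_append hw (fun _ => 1) t s
  have h2 := bottom_add_side_append_le hw (fun _ => 1) t s
  simp only [← left_eq_bottom] at h1 h2
  exact Set.Ico_subset_Ico h1 h2

/-- Half-open intervals make siblings genuinely disjoint, so the node of a given level above `x` is
unique and not merely almost surely so. -/
lemma eq_of_mem_interval {w : Node d → Fin d → ℝ} (hw : IsWeight w) {x : ℝ} :
    ∀ {s t : Node d}, s.length = t.length → x ∈ interval w s → x ∈ interval w t → s = t := by
  intro s
  induction s with
  | nil => intro t h _ _; exact (List.length_eq_zero_iff.1 h.symm).symm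
  | cons i s ih =>
    intro t h hs ht
    rcases t with _ | ⟨k, t⟩
    · simp at h
    have hst : s = t := ih (by simpa using h) (interval_append_subset hw [i] s hs)
      (interval_append_subset hw [k] t ht)
    subst hst
    congr 1
    have key : ∀ i k : Fin d, x ∈ interval w (i :: s) → x ∈ interval w (k :: s) → ¬ i < k := by
      intro i k hi hk hik
      simp only [interval, left_eq_bottom, bottom_cons, side, Set.mem_Ico] at hi hk
      have := mul_le_mul_of_nonneg_left (offset_add_le (α := 1) (hw.1 s) hik) (side_nonneg hw s)
      linarith [hi.2, hk.1]
    exact le_antisymm (not_lt.1 (key k i ht hs)) (not_lt.1 (key i k hs ht))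

lemma append_of_mem_interval {w : Node d → Fin d → ℝ} (hw : IsWeight w) {x : ℝ} {s t : Node d}
    (hst : s.length ≤ t.length) (hs : x ∈ interval w s) (ht : x ∈ interval w t) :
    ∃ r, t = r ++ s := by
  have h1 := List.take_append_drop (t.length - s.length) t
  refine ⟨t.take (t.length - s.length), ?_⟩
  have h2 : t.drop (t.length - s.length) = s := by
    apply eq_of_mem_interval hw _ _ hs
    · rw [List.length_drop]; omega
    · rw [← h1] at ht
      exact interval_append_subset hw _ _ ht
  rw [← h2, List.length_drop]
  conv_lhs => rw [← h1]
  congr 2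
  omega

/-! ### The permuton of a tree -/

/-- The height of the permuton above the point `x`. -/
def ordinate (S : Node d → Equiv.Perm (Fin d)) (w : Node d → Fin d → ℝ) (x : ℝ) : ℝ :=
  ⨆ s : Node d, (interval w s).indicator (fun _ => bottom S w s) x

/-- The measure carried by the graph of `ordinate`. -/
def treePermuton (S : Node d → Equiv.Perm (Fin d)) (w : Node d → Fin d → ℝ) :
    Measure (ℝ × ℝ) :=
  (volume.restrict (Set.Ico (0 : ℝ) 1)).map fun x => (x, ordinate S w x)

lemma measurable_ordinate (S : Node d → Equiv.Perm (Fin d)) (w : Node d → Fin d → ℝ) :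
    Measurable (ordinate S w) :=
  Measurable.iSup fun s => measurable_const.indicator (measurableSet_interval w s)

instance (S : Node d → Equiv.Perm (Fin d)) (w : Node d → Fin d → ℝ) :
    IsProbabilityMeasure (treePermuton S w) := by
  have : IsProbabilityMeasure (volume.restrict (Set.Ico (0 : ℝ) 1)) := ⟨by simp⟩
  exact Measure.isProbabilityMeasure_map
    (measurable_id.prodMk (measurable_ordinate S w)).aemeasurable

section Weight

variable {w : Node d → Fin d → ℝ} (hw : IsWeight w)
include hw

lemma bddAbove_ordinate (S : Node d → Equiv.Perm (Fin d)) (x : ℝ) :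
    BddAbove (Set.range fun s => (interval w s).indicator (fun _ => bottom S w s) x) := by
  refine ⟨1, ?_⟩
  rintro _ ⟨s, rfl⟩
  have h1 := bottom_add_side_le_one hw S s
  have h2 := side_nonneg hw s
  simp only [Set.indicator]
  split_ifs
  · linarith
  · exact zero_le_one

lemma bottom_le_ordinate (S : Node d → Equiv.Perm (Fin d)) {x : ℝ} {s : Node d}
    (hs : x ∈ interval w s) : bottom S w s ≤ ordinate S w x := by
  refine le_trans (le_of_eq ?_) (le_ciSup (bddAbove_ordinate hw S x) s)
  simp [hs]

/-- All nodes whose intervals contain `x` lie on one branch. Those below `s` have their squares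
inside the square of `s`, those above `s` have smaller ordinates, and every other node contributes
`0` to the supremum. -/
lemma ordinate_le (S : Node d → Equiv.Perm (Fin d)) {x : ℝ} {s : Node d}
    (hs : x ∈ interval w s) : ordinate S w x ≤ bottom S w s + side w s := by
  apply ciSup_le
  intro t
  have h0 := side_nonneg hw s
  simp only [Set.indicator]
  split_ifs with ht
  · rcases le_total s.length t.length with h | h
    · obtain ⟨r, rfl⟩ := append_of_mem_interval hw h hs ht
      have h1 := bottom_add_side_append_le hw S r s
      have h2 := side_nonneg hw (r ++ s)
      linarith
    · obtain ⟨r, rfl⟩ := append_of_mem_interval hw h ht hs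
      have h1 := bottom_le_append hw S r t
      linarith
  · exact add_nonneg (bottom_nonneg hw S s) h0

/-- Above a point of the `i`-th cell only the root and the nodes in the `i`-th subtree contribute to
the supremum; the root contributes `0`, and `bottom_append` rescales the rest. -/
lemma ordinate_subtree (S : Node d → Equiv.Perm (Fin d)) {i : Fin d} (hi : 0 < w [] i) {x : ℝ}
    (hx : x ∈ Set.Ico (0 : ℝ) 1) :
    ordinate S w (offset 1 (w []) i + w [] i * x) =
      offset (S []) (w []) i + w [] i * ordinate (subtree i S) (subtree i w) x := by
  have hroot : x ∈ interval (subtree i w) [] := by simpa [interval, left, side] using hx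
  have hi1 : offset 1 (w []) i + w [] i * x ∈ interval w [i] := (mem_interval_append hi [] x).2 hroot
  have hb : bottom S w [i] = offset (S []) (w []) i := by
    have := bottom_append S w i []
    simpa [bottom] using this
  apply le_antisymm
  · apply ciSup_le
    intro t
    have h0 : 0 ≤ ordinate (subtree i S) (subtree i w) x :=
      bottom_le_ordinate (hw.subtree i) (subtree i S) hroot
    have h1 : 0 ≤ offset (S []) (w []) i + w [] i * ordinate (subtree i S) (subtree i w) x :=
      add_nonneg (offset_nonneg (hw.1 []) i) (mul_nonneg hi.le h0)
    simp only [Set.indicator]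
    split_ifs with ht
    · rcases t with _ | ⟨j, t⟩
      · simpa [bottom] using h1
      · obtain ⟨r, hr⟩ := append_of_mem_interval hw (by simp) hi1 ht
        rw [hr] at ht ⊢
        rw [bottom_append]
        have h2 := bottom_le_ordinate (hw.subtree i) (subtree i S)
          ((mem_interval_append hi r x).1 ht)
        have h3 := mul_le_mul_of_nonneg_left h2 hi.le
        linarith
    · exact h1
  · rw [← le_sub_iff_add_le', mul_comm, ← le_div_iff₀ hi]
    apply ciSup_le
    intro s
    rw [le_div_iff₀ hi]
    simp only [Set.indicator]
    split_ifs with hs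
    · have h1 := bottom_le_ordinate hw S ((mem_interval_append hi s x).2 hs)
      rw [bottom_append] at h1
      linarith
    · have h1 := bottom_le_ordinate hw S hi1
      rw [hb] at h1
      linarith

/-- The permuton of a tree is composed of the permutons of the subtrees of the children of the
root. -/
lemma treePermuton_eq_inflate (S : Node d → Equiv.Perm (Fin d)) :
    treePermuton S w =
      inflate (S []) (w []) fun i => treePermuton (subtree i S) (subtree i w) := by
  have h1 := restrict_Ico_eq_sum (α := 1) (hw.1 []) (hw.2 []) 0 zero_le_one
  simp only [zero_add, one_mul] at h1
  have hZ : ∀ (S : Node d → Equiv.Perm (Fin d)) (w : Node d → Fin d → ℝ),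
      Measurable fun x => (x, ordinate S w x) := fun S w =>
    measurable_id.prodMk (measurable_ordinate S w)
  rw [treePermuton, h1, Measure.map_finset_sum (hZ S w).aemeasurable, inflate]
  apply Finset.sum_congr rfl
  intro i _
  rw [← smul_map_restrict_Ico _ (hw.1 [] i), Measure.map_smul]
  -- A child of weight zero has no share in either measure, and the rescaling in `ordinate_subtree`
  -- needs a positive weight.
  rcases (hw.1 [] i).eq_or_lt with h0 | h0
  · rw [← h0]; simp
  congr 1
  rw [treePermuton, Measure.map_map (hZ S w) (by fun_prop), Measure.map_map (by fun_prop) (hZ _ _)]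
  apply Measure.map_congr
  filter_upwards [ae_restrict_mem measurableSet_Ico] with x hx
  exact Prod.ext rfl (ordinate_subtree hw S h0 hx)

end Weight

end
end RandomPermuton

namespace RandomPermuton
noncomputable section

variable {d : ℕ}

/-! ### Weak convergence to the permuton of a tree -/

/-- A Riemann sum estimate for a measure cut into pieces. The pieces are later the squares of a
level, their horizontal intervals or their vertical intervals, all compared with the same
`cornerSum`. -/
lemma abs_integral_sub_sum_le {V X : Type*} [Fintype V] [MeasurableSpace X]
    {K : V → Measure X} {m a : V → ℝ} (hm : ∀ v, 0 ≤ m v)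
    (hK : ∀ v, K v Set.univ = ENNReal.ofReal (m v)) {f : X → ℝ} {ε : ℝ}
    (hf : ∀ v, AEStronglyMeasurable f (K v))
    (h : ∀ v, ∀ᵐ x ∂(K v), |f x - a v| ≤ ε) :
    |∫ x, f x ∂(∑ v, K v) - ∑ v, m v * a v| ≤ ε * ∑ v, m v := by
  have (v : V) : IsFiniteMeasure (K v) := ⟨by rw [hK]; exact ENNReal.ofReal_lt_top⟩
  have hreal : ∀ v, (K v).real Set.univ = m v := fun v => by
    rw [measureReal_def, hK, ENNReal.toReal_ofReal (hm v)]
  have hint : ∀ v, Integrable f (K v) := fun v => by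
    refine Integrable.of_bound (hf v) (ε + |a v|) ?_
    filter_upwards [h v] with x hx
    rw [Real.norm_eq_abs]
    have := abs_add_le (f x - a v) (a v)
    rw [sub_add_cancel] at this
    linarith
  rw [integral_finsetSum_measure fun v _ => hint v, ← Finset.sum_sub_distrib, Finset.mul_sum]
  refine (Finset.abs_sum_le_sum_abs _ _).trans (Finset.sum_le_sum fun v _ => ?_)
  have h2 := norm_integral_le_of_norm_le_const (μ := K v) (f := fun x => f x - a v) (C := ε) (h v)
  rw [integral_sub (hint v) (integrable_const _), integral_const, hreal, smul_eq_mul,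
    Real.norm_eq_abs] at h2
  exact h2

/-- The permuton of a tree as a finite measure. -/
def treeFiniteMeasure (S : Node d → Equiv.Perm (Fin d)) (w : Node d → Fin d → ℝ) :
    FiniteMeasure (ℝ × ℝ) := ⟨treePermuton S w, inferInstance⟩

/-- The side lengths of the squares of level `n` tend uniformly to `0`. -/
def IsFine (w : Node d → Fin d → ℝ) : Prop :=
  ∀ ε > 0, ∀ᶠ n in atTop, ∀ s : Node d, s.length = n → side w s < ε

/-- A Riemann sum along the squares of level `n`. -/
def cornerSum (S : Node d → Equiv.Perm (Fin d)) (w : Node d → Fin d → ℝ) (n : ℕ)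
    (f : ℝ × ℝ → ℝ) : ℝ :=
  ∑ v : Fin n → Fin d,
    side w (List.ofFn v) * f (left w (List.ofFn v), bottom S w (List.ofFn v))

section Weight

variable {w : Node d → Fin d → ℝ} (hw : IsWeight w)
include hw

lemma left_nonneg (s : Node d) : 0 ≤ left w s := by
  rw [left_eq_bottom]; exact bottom_nonneg hw _ s

lemma left_add_side_le_one (s : Node d) : left w s + side w s ≤ 1 := by
  rw [left_eq_bottom]; exact bottom_add_side_le_one hw _ s

lemma square_subset (S : Node d → Equiv.Perm (Fin d)) (s : Node d) :
    square S w s ⊆ Set.Icc 0 1 ×ˢ Set.Icc 0 1 := by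
  apply Set.prod_mono
  · exact Set.Icc_subset_Icc (left_nonneg hw s) (left_add_side_le_one hw s)
  · exact Set.Icc_subset_Icc (bottom_nonneg hw S s) (bottom_add_side_le_one hw S s)

lemma corner_mem_square (S : Node d → Equiv.Perm (Fin d)) (s : Node d) :
    (left w s, bottom S w s) ∈ square S w s := by
  have := side_nonneg hw s
  exact ⟨⟨le_rfl, by simpa using this⟩, ⟨le_rfl, by simpa using this⟩⟩

lemma exists_level_close (hfine : IsFine w) (S : Node d → Equiv.Perm (Fin d)) {f : ℝ × ℝ → ℝ}
    (hf : Continuous f) {ε : ℝ} (hε : 0 < ε) :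
    ∀ᶠ n in atTop, ∀ s : Node d, s.length = n → ∀ p ∈ square S w s,
      |f p - f (left w s, bottom S w s)| ≤ ε := by
  have hc : IsCompact (Set.Icc (0 : ℝ) 1 ×ˢ Set.Icc (0 : ℝ) 1) := isCompact_Icc.prod isCompact_Icc
  have hu := hc.uniformContinuousOn_of_continuous hf.continuousOn
  rw [Metric.uniformContinuousOn_iff] at hu
  obtain ⟨δ, hδ, hu⟩ := hu ε hε
  filter_upwards [hfine δ hδ] with n hn s hs p hp
  have h1 := hu p (square_subset hw S s hp) _ (square_subset hw S s (corner_mem_square hw S s)) (by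
    have hlt := hn s hs
    rw [Prod.dist_eq, max_lt_iff, Real.dist_eq, Real.dist_eq]
    obtain ⟨⟨h1, h2⟩, ⟨h3, h4⟩⟩ := hp
    constructor <;> rw [abs_lt] <;> constructor <;> simp only <;> linarith)
  rw [Real.dist_eq] at h1
  exact h1.le

lemma integral_approx_close (hfine : IsFine w) (S : Node d → Equiv.Perm (Fin d)) {f : ℝ × ℝ → ℝ}
    (hf : Continuous f) {ε : ℝ} (hε : 0 < ε) :
    ∀ᶠ n in atTop, |∫ p, f p ∂(approx S w n : Measure (ℝ × ℝ)) - cornerSum S w n f| ≤ ε := by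
  filter_upwards [exists_level_close hw hfine S hf hε] with n hn
  have key := abs_integral_sub_sum_le (V := Fin n → Fin d)
    (K := fun v => ENNReal.ofReal (side w (List.ofFn v)) •
      ProbabilityTheory.cond volume (square S w (List.ofFn v)))
    (m := fun v => side w (List.ofFn v))
    (a := fun v => f (left w (List.ofFn v), bottom S w (List.ofFn v)))
    (f := f) (ε := ε) (fun v => side_nonneg hw _) (fun v => by
      rcases (side_nonneg hw (List.ofFn v)).eq_or_lt with h0 | h0
      · rw [← h0]; simp
      · have hvol : volume (square S w (List.ofFn v)) =
            ENNReal.ofReal (side w (List.ofFn v)) * ENNReal.ofReal (side w (List.ofFn v)) := by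
          rw [square, Measure.volume_eq_prod, Measure.prod_prod, Real.volume_Icc, Real.volume_Icc]
          simp
        have : IsProbabilityMeasure (ProbabilityTheory.cond volume (square S w (List.ofFn v))) := by
          apply ProbabilityTheory.cond_isProbabilityMeasure_of_finite
          · rw [hvol]
            simp [h0]
          · rw [hvol]
            exact ENNReal.mul_ne_top ENNReal.ofReal_ne_top ENNReal.ofReal_ne_top
        simp) (fun v => hf.aestronglyMeasurable) (fun v => by
      have hac : ENNReal.ofReal (side w (List.ofFn v)) •
          ProbabilityTheory.cond volume (square S w (List.ofFn v)) ≪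
          volume.restrict (square S w (List.ofFn v)) :=
        Measure.smul_absolutelyContinuous.trans Measure.smul_absolutelyContinuous
      refine hac.ae_le ?_
      filter_upwards [ae_restrict_mem (by exact measurableSet_Icc.prod measurableSet_Icc)]
        with p hp
      exact hn _ (List.length_ofFn) p hp)
  rw [sum_side_level hw, mul_one] at key
  exact key

lemma mem_square_ordinate (S : Node d → Equiv.Perm (Fin d)) {s : Node d} {x : ℝ}
    (hx : x ∈ interval w s) : (x, ordinate S w x) ∈ square S w s :=
  ⟨⟨hx.1, hx.2.le⟩, bottom_le_ordinate hw S hx, ordinate_le hw S hx⟩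

lemma integral_treePermuton_close (hfine : IsFine w) (S : Node d → Equiv.Perm (Fin d))
    {f : ℝ × ℝ → ℝ} (hf : Continuous f) {ε : ℝ} (hε : 0 < ε) :
    ∀ᶠ n in atTop, |∫ p, f p ∂(treePermuton S w) - cornerSum S w n f| ≤ ε := by
  filter_upwards [exists_level_close hw hfine S hf hε] with n hn
  have hm : Measurable fun x => (x, ordinate S w x) :=
    measurable_id.prodMk (measurable_ordinate S w)
  rw [treePermuton, integral_map hm.aemeasurable hf.aestronglyMeasurable,
    restrict_Ico_eq_sum_level hw (fun _ => 1) n]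
  have key := abs_integral_sub_sum_le (V := Fin n → Fin d)
    (K := fun v => volume.restrict (Set.Ico (bottom (fun _ => 1) w (List.ofFn v))
      (bottom (fun _ => 1) w (List.ofFn v) + side w (List.ofFn v))))
    (m := fun v => side w (List.ofFn v))
    (a := fun v => f (left w (List.ofFn v), bottom S w (List.ofFn v)))
    (f := fun x => f (x, ordinate S w x)) (ε := ε) (fun v => side_nonneg hw _)
    (fun v => by simp) (fun v => (hf.measurable.comp hm).aestronglyMeasurable) (fun v => by
      filter_upwards [ae_restrict_mem measurableSet_Ico] with x hx
      rw [← left_eq_bottom] at hx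
      exact hn _ (List.length_ofFn) _ (mem_square_ordinate hw S hx))
  rw [sum_side_level hw, mul_one] at key
  exact key

/-- The vertical intervals of a level also subdivide `[0, 1)`. Hence Lebesgue measure and the second
marginal of the tree permuton share their Riemann sums, which makes this marginal uniform. -/
lemma integral_restrict_close (hfine : IsFine w) (S : Node d → Equiv.Perm (Fin d)) {g : ℝ → ℝ}
    (hg : Continuous g) {ε : ℝ} (hε : 0 < ε) :
    ∀ᶠ n in atTop, |∫ y, g y ∂(volume.restrict (Set.Ico (0 : ℝ) 1)) -
      cornerSum S w n fun p => g p.2| ≤ ε := by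
  filter_upwards [exists_level_close hw hfine S (f := fun p => g p.2) (by fun_prop) hε] with n hn
  rw [restrict_Ico_eq_sum_level hw S n]
  have key := abs_integral_sub_sum_le (V := Fin n → Fin d)
    (K := fun v => volume.restrict (Set.Ico (bottom S w (List.ofFn v))
      (bottom S w (List.ofFn v) + side w (List.ofFn v))))
    (m := fun v => side w (List.ofFn v)) (a := fun v => g (bottom S w (List.ofFn v)))
    (f := g) (ε := ε) (fun v => side_nonneg hw _)
    (fun v => by simp) (fun v => hg.aestronglyMeasurable) (fun v => by
      filter_upwards [ae_restrict_mem measurableSet_Ico] with y hy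
      have h0 := side_nonneg hw (List.ofFn v)
      exact hn _ (List.length_ofFn) (left w (List.ofFn v), y)
        ⟨⟨le_rfl, by simpa using h0⟩, ⟨hy.1, hy.2.le⟩⟩)
  rw [sum_side_level hw, mul_one] at key
  exact key

lemma isPermuton_treePermuton (hfine : IsFine w) (S : Node d → Equiv.Perm (Fin d)) :
    IsPermuton (treePermuton S w) := by
  have hI : volume.restrict (Set.Ico (0 : ℝ) 1) = volume.restrict (Set.Icc (0 : ℝ) 1) :=
    Measure.restrict_congr_set Ico_ae_eq_Icc
  have hm : Measurable fun x => (x, ordinate S w x) :=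
    measurable_id.prodMk (measurable_ordinate S w)
  constructor
  · rw [treePermuton, Measure.map_map measurable_fst hm, ← hI]
    exact Measure.map_id
  · rw [← hI]
    have : IsProbabilityMeasure ((treePermuton S w).map Prod.snd) :=
      Measure.isProbabilityMeasure_map measurable_snd.aemeasurable
    apply ext_of_forall_integral_eq_of_IsFiniteMeasure
    intro g
    rw [integral_map measurable_snd.aemeasurable g.continuous.aestronglyMeasurable]
    apply eq_of_forall_dist_le
    intro ε hε
    obtain ⟨n, h1, h2⟩ := ((integral_treePermuton_close hw hfine S (f := fun p => g p.2)
      (by fun_prop) (half_pos hε)).and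
      (integral_restrict_close hw hfine S g.continuous (half_pos hε))).exists
    rw [Real.dist_eq]
    rw [abs_le] at h1 h2 ⊢
    constructor <;> linarith [h1.1, h1.2, h2.1, h2.2]

lemma tendsto_approx (hfine : IsFine w) (S : Node d → Equiv.Perm (Fin d)) :
    Tendsto (approx S w) atTop (𝓝 (treeFiniteMeasure S w)) := by
  rw [FiniteMeasure.tendsto_iff_forall_integral_tendsto]
  intro f
  rw [Metric.tendsto_nhds]
  intro ε hε
  filter_upwards [integral_treePermuton_close hw hfine S f.continuous (show 0 < ε / 3 by positivity),
    integral_approx_close hw hfine S f.continuous (show 0 < ε / 3 by positivity)] with n h1 h2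
  rw [Real.dist_eq]
  change |_ - ∫ p, f p ∂(treePermuton S w)| < ε
  rw [abs_le] at h1 h2
  rw [abs_lt]
  constructor <;> linarith [h1.1, h1.2, h2.1, h2.2]

lemma isTreePermuton (hfine : IsFine w) (S : Node d → Equiv.Perm (Fin d)) :
    IsTreePermuton S w (treeFiniteMeasure S w) :=
  ⟨isPermuton_treePermuton hw hfine S, tendsto_approx hw hfine S⟩

end Weight

end
end RandomPermuton

namespace RandomPermuton
noncomputable section

variable {d : ℕ}

/-! ### Spacings -/

lemma orderStat_succ_of_lt {m : ℕ} (U : Fin m → unitInterval) {k : ℕ} (hk : k < m) :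
    orderStat U (k + 1) = U (Tuple.sort U ⟨k, hk⟩) := by
  simp [orderStat, hk]

lemma orderStat_succ_of_le {m : ℕ} (U : Fin m → unitInterval) {k : ℕ} (hk : m ≤ k) :
    orderStat U (k + 1) = 1 := by
  simp [orderStat, not_lt.2 hk]

lemma orderStat_le_one {m : ℕ} (U : Fin m → unitInterval) (k : ℕ) : orderStat U k ≤ 1 := by
  rcases k with _ | k
  · simp [orderStat]
  · rcases lt_or_ge k m with h | h
    · rw [orderStat_succ_of_lt U h]; exact (U _).2.2
    · rw [orderStat_succ_of_le U h]

lemma orderStat_le_succ {m : ℕ} (U : Fin m → unitInterval) (k : ℕ) :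
    orderStat U k ≤ orderStat U (k + 1) := by
  rcases lt_or_ge k m with h | h
  · rw [orderStat_succ_of_lt U h]
    rcases k with _ | k
    · exact (U _).2.1
    · rw [orderStat_succ_of_lt U (by omega)]
      have := Tuple.monotone_sort U (a := ⟨k, by omega⟩) (b := ⟨k + 1, h⟩) (by simp)
      exact_mod_cast this
  · rw [orderStat_succ_of_le U h]
    exact orderStat_le_one U k

lemma spacing_nonneg (U : Fin (d - 1) → unitInterval) (i : Fin d) : 0 ≤ spacing U i :=
  sub_nonneg.2 (orderStat_le_succ U i)

lemma sum_spacing (hd : 1 ≤ d) (U : Fin (d - 1) → unitInterval) : ∑ i, spacing U i = 1 := by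
  simp only [spacing]
  rw [Fin.sum_univ_eq_sum_range (fun i => orderStat U (i + 1) - orderStat U i),
    Finset.sum_range_sub]
  obtain ⟨m, rfl⟩ := Nat.exists_eq_add_of_le' hd
  rw [orderStat_succ_of_le U (by simp)]
  simp [orderStat]

lemma isWeight_weights (hd : 1 ≤ d) (ω : Sample d) : IsWeight (weights ω) :=
  ⟨fun _ i => spacing_nonneg _ i, fun _ => sum_spacing hd _⟩

lemma measurable_orderStat {m : ℕ} (k : ℕ) :
    Measurable fun U : Fin m → unitInterval => orderStat U k := by
  rcases k with _ | k
  · exact measurable_const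
  rcases lt_or_ge k m with h | h
  · simp only [orderStat_succ_of_lt _ h]
    apply measurable_subtype_coe.comp
    apply measurable_of_Iic
    intro x
    have : (fun U : Fin m → unitInterval => U (Tuple.sort U ⟨k, h⟩)) ⁻¹' Set.Iic x =
        {U | k < ∑ l, if U l ≤ x then 1 else 0} := by
      ext U
      have h1 := Tuple.lt_card_le_iff_apply_le_of_monotone (j := ⟨k, h⟩) (a := x)
        (Tuple.monotone_sort U)
      have h2 : (Finset.univ.filter fun i => (U ∘ Tuple.sort U) i ≤ x).card =
          ∑ l, if U l ≤ x then 1 else 0 := by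
        rw [Finset.card_filter, ← Equiv.sum_comp (Tuple.sort U) fun l => if U l ≤ x then 1 else 0]
        rfl
      rw [h2] at h1
      exact h1.symm
    rw [this]
    refine measurableSet_lt measurable_const (Finset.measurable_sum _ fun l _ => ?_)
    exact Measurable.ite (measurableSet_le (measurable_pi_apply l) measurable_const)
      measurable_const measurable_const
  · simp only [orderStat_succ_of_le _ h]
    exact measurable_const

@[fun_prop]
lemma measurable_spacing (i : Fin d) :
    Measurable fun U : Fin (d - 1) → unitInterval => spacing U i :=
  (measurable_orderStat _).sub (measurable_orderStat _)

/-- The event that there is no point in an interval of length `t` on the right of the `j`-th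
point. -/
def gapEvent {m : ℕ} (t : ℝ) (j : Fin m) : Set (Fin m → unitInterval) :=
  {U | (U j : ℝ) + t < 1 ∧ ∀ l, l ≠ j → ¬ ((U j : ℝ) ≤ U l ∧ (U l : ℝ) ≤ U j + t)}

/-- For distinct points, the spacing after the `k`-th order statistic is the gap to the right of the
point with index `Tuple.sort U k`. For the largest point the gap ends at `1`, which explains the
condition `U j + t < 1` in `gapEvent`. -/
lemma lt_gap_iff {m : ℕ} {U : Fin m → unitInterval} (hU : Function.Injective U) {t : ℝ}
    (k : Fin m) : t < orderStat U (k + 2) - orderStat U (k + 1) ↔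
      U ∈ gapEvent t (Tuple.sort U k) := by
  have hmono : StrictMono (U ∘ Tuple.sort U) :=
    (Tuple.monotone_sort U).strictMono_of_injective (hU.comp (Equiv.injective _))
  rw [orderStat_succ_of_lt U k.2, lt_sub_iff_add_lt']
  change _ ↔ _ ∧ _
  rcases lt_or_ge ((k : ℕ) + 1) m with h | h
  · rw [orderStat_succ_of_lt U h]
    constructor
    · intro ht
      refine ⟨ht.trans_le (U _).2.2, ?_⟩
      intro l hl
      obtain ⟨k', rfl⟩ := (Tuple.sort U).surjective l
      have hne : k' ≠ k := fun h => hl (by rw [h])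
      rintro ⟨h1, h2⟩
      rcases lt_or_gt_of_ne hne with h3 | h3
      · have := hmono h3
        exact absurd h1 (not_le.2 this)
      · have h4 : (⟨(k : ℕ) + 1, h⟩ : Fin m) ≤ k' := by
          rw [Fin.le_def]; exact h3
        have h5 : (U (Tuple.sort U ⟨(k : ℕ) + 1, h⟩) : ℝ) ≤ U (Tuple.sort U k') :=
          Tuple.monotone_sort U h4
        linarith
    · rintro ⟨_, h2⟩
      have hlt : k < (⟨(k : ℕ) + 1, h⟩ : Fin m) := by rw [Fin.lt_def]; simp
      have h3 := h2 (Tuple.sort U ⟨(k : ℕ) + 1, h⟩)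
        ((Tuple.sort U).injective.ne hlt.ne')
      have h4 : (U (Tuple.sort U k) : ℝ) ≤ U (Tuple.sort U ⟨(k : ℕ) + 1, h⟩) :=
        Tuple.monotone_sort U hlt.le
      by_contra h5
      exact h3 ⟨h4, not_lt.1 h5⟩
  · rw [orderStat_succ_of_le U h]
    refine ⟨fun ht => ⟨ht, ?_⟩, fun ht => ht.1⟩
    intro l hl
    obtain ⟨k', rfl⟩ := (Tuple.sort U).surjective l
    have hne : k' ≠ k := fun h => hl (by rw [h])
    have hlt : k' < k := by
      refine lt_of_le_of_ne ?_ hne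
      rw [Fin.le_def]
      have := k'.2
      omega
    rintro ⟨h1, _⟩
    exact absurd h1 (not_le.2 (hmono hlt))

lemma lt_orderStat_one_iff {m : ℕ} (U : Fin m → unitInterval) {t : ℝ} (ht : t < 1) :
    t < orderStat U 1 ↔ ∀ l, t < U l := by
  rcases m with _ | m
  · rw [orderStat_succ_of_le U le_rfl]
    simp [ht]
  · rw [orderStat_succ_of_lt U (Nat.succ_pos m)]
    constructor
    · intro h l
      obtain ⟨k, rfl⟩ := (Tuple.sort U).surjective l
      have : (U (Tuple.sort U ⟨0, Nat.succ_pos m⟩) : ℝ) ≤ U (Tuple.sort U k) :=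
        Tuple.monotone_sort U (Fin.zero_le k)
      linarith
    · intro h; exact h _

lemma measurableSet_gapEvent {m : ℕ} (t : ℝ) (j : Fin m) : MeasurableSet (gapEvent t j) := by
  have h1 : ∀ l : Fin m, Measurable fun U : Fin m → unitInterval => (U l : ℝ) := fun l =>
    measurable_subtype_coe.comp (measurable_pi_apply l)
  have : gapEvent t j = {U : Fin m → unitInterval | (U j : ℝ) + t < 1} ∩
      ⋂ l, ⋂ (_ : l ≠ j), ({U | (U j : ℝ) ≤ U l} ∩ {U | (U l : ℝ) ≤ U j + t})ᶜ := by
    ext U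
    simp [gapEvent]
  rw [this]
  refine (measurableSet_lt ((h1 j).add_const t) measurable_const).inter ?_
  refine MeasurableSet.iInter fun l => MeasurableSet.iInter fun _ => MeasurableSet.compl ?_
  exact (measurableSet_le (h1 j) (h1 l)).inter (measurableSet_le (h1 l) ((h1 j).add_const t))

lemma volume_unitInterval_preimage {s : Set ℝ} (hs : MeasurableSet s) :
    (volume : Measure unitInterval) (Subtype.val ⁻¹' s) = volume (s ∩ Set.Icc 0 1) := by
  have h := measurePreserving_subtype_coe (μa := (volume : Measure ℝ))
    (s := Set.Icc (0 : ℝ) 1) measurableSet_Icc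
  rw [← Measure.restrict_apply hs, ← h.map_eq, Measure.map_apply measurable_subtype_coe hs]
  rfl

lemma volume_gap_compl {u t : ℝ} (hu : 0 ≤ u) (ht : 0 ≤ t) (hut : u + t < 1) :
    (volume : Measure unitInterval) {x | ¬ (u ≤ (x : ℝ) ∧ (x : ℝ) ≤ u + t)} =
      ENNReal.ofReal (1 - t) := by
  have h1 : (volume : Measure unitInterval) {x | u ≤ (x : ℝ) ∧ (x : ℝ) ≤ u + t} =
      ENNReal.ofReal t := by
    have := volume_unitInterval_preimage (s := Set.Icc u (u + t)) measurableSet_Icc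
    rw [Set.inter_eq_left.2 (Set.Icc_subset_Icc hu hut.le), Real.volume_Icc,
      add_sub_cancel_left] at this
    exact this
  have hm : MeasurableSet {x : unitInterval | u ≤ (x : ℝ) ∧ (x : ℝ) ≤ u + t} :=
    (measurableSet_Icc (a := u) (b := u + t)).preimage measurable_subtype_coe
  have h2 := prob_compl_eq_one_sub (μ := (volume : Measure unitInterval)) hm
  rw [h1] at h2
  rw [ENNReal.ofReal_sub _ ht, ENNReal.ofReal_one, ← h2]
  rfl

lemma volume_lt {t : ℝ} (ht : 0 ≤ t) :
    (volume : Measure unitInterval) {x | t < (x : ℝ)} = ENNReal.ofReal (1 - t) := by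
  have := volume_unitInterval_preimage (s := Set.Ioi t) measurableSet_Ioi
  have h2 : Set.Ioi t ∩ Set.Icc 0 1 = Set.Ioc t 1 := by
    ext x
    simp only [Set.mem_inter_iff, Set.mem_Ioi, Set.mem_Icc, Set.mem_Ioc]
    constructor
    · rintro ⟨h, _, h'⟩; exact ⟨h, h'⟩
    · rintro ⟨h, h'⟩; exact ⟨h, by linarith, h'⟩
  rw [h2, Real.volume_Ioc] at this
  exact this

lemma volume_add_lt {t : ℝ} (ht : 0 ≤ t) :
    (volume : Measure unitInterval) {x | (x : ℝ) + t < 1} = ENNReal.ofReal (1 - t) := by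
  have := volume_unitInterval_preimage (s := Set.Iio (1 - t)) measurableSet_Iio
  have h2 : Set.Iio (1 - t) ∩ Set.Icc 0 1 = Set.Ico 0 (1 - t) := by
    ext x
    simp only [Set.mem_inter_iff, Set.mem_Iio, Set.mem_Icc, Set.mem_Ico]
    constructor
    · rintro ⟨h, h', _⟩; exact ⟨h', h⟩
    · rintro ⟨h, h'⟩; exact ⟨h', h, by linarith⟩
  rw [h2, Real.volume_Ico, sub_zero] at this
  rw [← this]
  congr 1
  ext x
  simp only [Set.mem_ofPred_eq, Set.mem_preimage, Set.mem_Iio]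
  constructor <;> intro h <;> linarith

/-- Fix the `j`-th point. It lies to the left of `1 - t` with probability `1 - t`, and then each of
the other `m - 1` points avoids an interval of length `t` with probability `1 - t`. -/
lemma volume_gapEvent {m : ℕ} {t : ℝ} (ht : 0 ≤ t) (j : Fin m) :
    (Measure.pi fun _ : Fin m => (volume : Measure unitInterval)) (gapEvent t j) =
      ENNReal.ofReal (1 - t) ^ m := by
  obtain ⟨m, rfl⟩ : ∃ m', m = m' + 1 := ⟨m - 1, by have := j.2; omega⟩
  have h := (measurePreserving_piFinSuccAbove
    (fun _ : Fin (m + 1) => (volume : Measure unitInterval)) j).symm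
  rw [← h.map_eq, Measure.map_apply (MeasurableEquiv.measurable _) (measurableSet_gapEvent t j),
    Measure.prod_apply (MeasurableEquiv.measurable _ (measurableSet_gapEvent t j))]
  have key : ∀ u : unitInterval, (Measure.pi fun _ : Fin m => (volume : Measure unitInterval))
      (Prod.mk u ⁻¹' ((MeasurableEquiv.piFinSuccAbove (fun _ => unitInterval) j).symm ⁻¹'
        gapEvent t j)) =
      {x : unitInterval | (x : ℝ) + t < 1}.indicator (fun _ => ENNReal.ofReal (1 - t) ^ m) u := by
    intro u
    by_cases hu : (u : ℝ) + t < 1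
    · rw [Set.indicator_of_mem (by exact hu)]
      have : Prod.mk u ⁻¹' ((MeasurableEquiv.piFinSuccAbove (fun _ => unitInterval) j).symm ⁻¹'
          gapEvent t j) = Set.univ.pi fun _ => {x : unitInterval | ¬ ((u : ℝ) ≤ (x : ℝ) ∧ (x : ℝ) ≤ u + t)} := by
        ext V
        simp only [gapEvent, Set.mem_preimage, Set.mem_ofPred_eq, Set.mem_pi, Set.mem_univ,
          forall_const, MeasurableEquiv.piFinSuccAbove_symm_apply, Fin.insertNthEquiv_apply,
          Fin.insertNth_apply_same, hu, true_and]
        constructor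
        · intro h i
          have := h (j.succAbove i) (Fin.succAbove_ne j i)
          simpa using this
        · intro h l hl
          obtain ⟨i, rfl⟩ := Fin.exists_succAbove_eq hl
          simpa using h i
      rw [this, Measure.pi_pi]
      simp only [volume_gap_compl u.2.1 ht hu]
      simp
    · rw [Set.indicator_of_notMem (by exact hu)]
      have : Prod.mk u ⁻¹' ((MeasurableEquiv.piFinSuccAbove (fun _ => unitInterval) j).symm ⁻¹'
          gapEvent t j) = ∅ := by
        ext V
        simp only [gapEvent, Set.mem_preimage, Set.mem_ofPred_eq,
          MeasurableEquiv.piFinSuccAbove_symm_apply, Fin.insertNthEquiv_apply,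
          Fin.insertNth_apply_same, hu, false_and, Set.mem_empty_iff_false]
      rw [this, measure_empty]
  simp only [key]
  rw [lintegral_indicator_const]
  · rw [volume_add_lt ht, pow_succ]
  · exact (measurableSet_Iio (a := 1 - t)).preimage measurable_subtype_coe |>.congr (by
      ext x
      simp only [Set.mem_ofPred_eq, Set.mem_preimage, Set.mem_Iio]
      constructor <;> intro h <;> linarith)

lemma ae_injective_uniform (m : ℕ) :
    ∀ᵐ U ∂(Measure.pi fun _ : Fin m => (volume : Measure unitInterval)),
      Function.Injective U := by
  have key : ∀ i j : Fin m, i ≠ j →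
      ∀ᵐ U ∂(Measure.pi fun _ : Fin m => (volume : Measure unitInterval)), U i ≠ U j := by
    intro i j hij
    have h1 : ∀ᵐ q ∂((volume : Measure unitInterval).prod volume), q.1 ≠ q.2 := by
      have m1 : MeasurableSet {q : unitInterval × unitInterval | q.1 = q.2} :=
        measurableSet_eq_fun (by fun_prop) (by fun_prop)
      suffices h0 : ((volume : Measure unitInterval).prod volume)
          {q : unitInterval × unitInterval | q.1 = q.2} = 0 from
        measure_eq_zero_iff_ae_notMem.1 h0
      rw [Measure.measure_prod_null m1]
      refine Filter.Eventually.of_forall fun a => ?_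
      change volume (Prod.mk a ⁻¹' _) = 0
      have : Prod.mk a ⁻¹' {q : unitInterval × unitInterval | q.1 = q.2} = {a} := by
        ext p; exact eq_comm
      rw [this]
      exact measure_singleton a
    rw [← pi_map_pair (fun _ : Fin m => (volume : Measure unitInterval)) hij] at h1
    exact ae_of_ae_map (f := fun p : Fin m → unitInterval => (p i, p j)) (by fun_prop) h1
  have key' : ∀ᵐ U ∂(Measure.pi fun _ : Fin m => (volume : Measure unitInterval)),
      ∀ i j, i ≠ j → U i ≠ U j := by
    rw [ae_all_iff]; intro i
    rw [ae_all_iff]; intro j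
    by_cases hij : i = j
    · simp [hij]
    · filter_upwards [key i j hij] with p hp _ using hp
  filter_upwards [key'] with U hU i j hij
  by_contra hne
  exact hU i j hne hij

/-- The mean number of spacings longer than `t`. -/
lemma sum_measure_lt_spacing (m : ℕ) {t : ℝ} (ht0 : 0 ≤ t) (ht1 : t < 1) :
    ∑ i : Fin (m + 1), (Measure.pi fun _ : Fin m => (volume : Measure unitInterval))
      {U | t < spacing (d := m + 1) U i} = (m + 1) * ENNReal.ofReal (1 - t) ^ m := by
  set P := Measure.pi fun _ : Fin m => (volume : Measure unitInterval) with hP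
  have hms : ∀ i, MeasurableSet {U : Fin m → unitInterval | t < spacing (d := m + 1) U i} :=
    fun i => measurableSet_lt measurable_const (measurable_spacing (d := m + 1) i)
  rw [Fin.sum_univ_succ]
  have h0 : P {U | t < spacing (d := m + 1) U 0} = ENNReal.ofReal (1 - t) ^ m := by
    have : {U : Fin m → unitInterval | t < spacing (d := m + 1) U 0} =
        Set.univ.pi fun _ => {x : unitInterval | t < (x : ℝ)} := by
      ext U
      have := lt_orderStat_one_iff U ht1
      simp only [Set.mem_ofPred_eq, Set.mem_pi, Set.mem_univ, forall_const, ← this]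
      change t < orderStat U 1 - orderStat U 0 ↔ _
      rw [show orderStat U 0 = 0 from rfl, sub_zero]
    rw [this, hP, Measure.pi_pi]
    simp [volume_lt ht0]
  have h1 : ∑ k : Fin m, P {U | t < spacing (d := m + 1) U k.succ} = ∑ k : Fin m, P (gapEvent t k) := by
    have e1 : ∀ (A : Fin m → Set (Fin m → unitInterval)), (∀ k, MeasurableSet (A k)) →
        ∑ k, P (A k) = ∫⁻ U, ∑ k, (A k).indicator 1 U ∂P := by
      intro A hA
      rw [lintegral_finsetSum _ fun k _ => measurable_one.indicator (hA k)]
      exact Finset.sum_congr rfl fun k _ => (lintegral_indicator_one (hA k)).symm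
    rw [e1 _ fun k => hms k.succ, e1 _ fun k => measurableSet_gapEvent t k]
    apply lintegral_congr_ae
    filter_upwards [ae_injective_uniform m] with U hU
    -- Reindexing by the sorting permutation replaces the sum over order statistics by a sum over
    -- the points, whose terms have known probabilities.
    rw [← Equiv.sum_comp (Tuple.sort U) fun k => (gapEvent t k).indicator 1 U]
    apply Finset.sum_congr rfl
    intro k _
    have := lt_gap_iff hU (t := t) k
    apply Set.indicator_const_eq_indicator_const (c := (1 : ENNReal))
    rw [← this]
    rfl
  rw [h0, h1]
  simp only [hP, volume_gapEvent ht0]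
  simp
  ring

end
end RandomPermuton

namespace RandomPermuton
noncomputable section

/-! ### The law of the spacings -/

/-- The density of a spacing of `m` uniform points. -/
def spacingDensity (m : ℕ) (t : ℝ) : ℝ := m * (1 - t) ^ (m - 1)

@[fun_prop]
lemma continuous_spacingDensity (m : ℕ) : Continuous (spacingDensity m) := by
  unfold spacingDensity; fun_prop

lemma hasDerivAt_one_sub (s : ℝ) : HasDerivAt (fun s : ℝ => 1 - s) (-1) s := by
  simpa using (hasDerivAt_id s).const_sub 1

lemma integral_spacingDensity (m : ℕ) (t : ℝ) (hm : 1 ≤ m) :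
    ∫ s in t..1, spacingDensity m s = (1 - t) ^ m := by
  have h : ∀ s ∈ Set.uIcc t 1, HasDerivAt (fun s : ℝ => -(1 - s) ^ m) (spacingDensity m s) s := by
    intro s _
    exact ((hasDerivAt_one_sub s).fun_pow m).fun_neg.congr_deriv (by simp [spacingDensity])
  rw [intervalIntegral.integral_eq_sub_of_hasDerivAt h
    ((continuous_spacingDensity m).intervalIntegrable _ _)]
  simp [show m ≠ 0 by omega]

lemma spacingDensity_nonneg (m : ℕ) {t : ℝ} (ht : t ≤ 1) : 0 ≤ spacingDensity m t :=
  mul_nonneg (Nat.cast_nonneg _) (pow_nonneg (by linarith) _)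

/-- The law of a spacing of `m` uniform points. -/
def spacingLaw (m : ℕ) : Measure ℝ :=
  (volume.restrict (Set.Ioc (0 : ℝ) 1)).withDensity fun t => ENNReal.ofReal (spacingDensity m t)

lemma spacingLaw_Ioi {m : ℕ} (hm : 1 ≤ m) {t : ℝ} (ht0 : 0 ≤ t) (ht1 : t ≤ 1) :
    spacingLaw m (Set.Ioi t) = ENNReal.ofReal (1 - t) ^ m := by
  rw [spacingLaw, withDensity_apply _ measurableSet_Ioi, Measure.restrict_restrict measurableSet_Ioi]
  have h2 : Set.Ioi t ∩ Set.Ioc 0 1 = Set.Ioc t 1 := by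
    ext x
    simp only [Set.mem_inter_iff, Set.mem_Ioi, Set.mem_Ioc]
    constructor
    · rintro ⟨h, _, h'⟩; exact ⟨h, h'⟩
    · rintro ⟨h, h'⟩; exact ⟨h, by linarith, h'⟩
  rw [h2, ← ofReal_integral_eq_lintegral_ofReal]
  · rw [← intervalIntegral.integral_of_le ht1, integral_spacingDensity m t hm,
      ENNReal.ofReal_pow (by linarith)]
  · exact ((continuous_spacingDensity m).integrableOn_Icc).mono_set Set.Ioc_subset_Icc_self
  · filter_upwards [ae_restrict_mem measurableSet_Ioc] with s hs
    exact spacingDensity_nonneg m hs.2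

variable {d : ℕ}

lemma spacing_le_one (U : Fin (d - 1) → unitInterval) (i : Fin d) : spacing U i ≤ 1 := by
  rw [← sum_spacing (by have := i.2; omega) U]
  exact Finset.single_le_sum (f := spacing U) (fun i _ => spacing_nonneg U i) (Finset.mem_univ i)

lemma sum_measure_lt_spacing' (hd : 2 ≤ d) {t : ℝ} (ht0 : 0 ≤ t) (ht1 : t < 1) :
    ∑ i : Fin d, (Measure.pi fun _ : Fin (d - 1) => (volume : Measure unitInterval))
      {U | t < spacing U i} = d * ENNReal.ofReal (1 - t) ^ (d - 1) := by
  obtain ⟨m, rfl⟩ : ∃ m, d = m + 1 := ⟨d - 1, by omega⟩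
  have := sum_measure_lt_spacing m ht0 ht1
  push_cast
  exact this

/-- The recursion involves the children only through sums, so the sum of the laws suffices and the
law of an individual spacing is never needed. Finite measures are identified by their tails. -/
lemma sum_map_spacing (hd : 2 ≤ d) :
    ∑ i : Fin d, (Measure.pi fun _ : Fin (d - 1) => (volume : Measure unitInterval)).map
      (fun U => spacing U i) = (d : ENNReal) • spacingLaw (d - 1) := by
  set P := Measure.pi fun _ : Fin (d - 1) => (volume : Measure unitInterval) with hP
  have hms : ∀ i, Measurable fun U : Fin (d - 1) → unitInterval => spacing U i :=
    fun i => measurable_spacing i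
  have hprob : ∀ i, IsProbabilityMeasure (P.map fun U => spacing U i) := fun i =>
    Measure.isProbabilityMeasure_map (hms i).aemeasurable
  have hIoi : ∀ t, (∑ i : Fin d, P.map fun U => spacing U i) (Set.Ioi t) =
      ((d : ENNReal) • spacingLaw (d - 1)) (Set.Ioi t) := by
    intro t
    simp only [Measure.finsetSum_apply, Measure.smul_apply, smul_eq_mul,
      Measure.map_apply (hms _) measurableSet_Ioi]
    rcases lt_or_ge t 0 with ht | ht
    · have h1 : ∀ i, (fun U : Fin (d - 1) → unitInterval => spacing U i) ⁻¹' Set.Ioi t =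
          Set.univ := fun i => Set.eq_univ_of_forall fun U =>
        ht.trans_le (spacing_nonneg U i)
      have h2 : spacingLaw (d - 1) (Set.Ioi t) = spacingLaw (d - 1) (Set.Ioi 0) := by
        have hac : spacingLaw (d - 1) ≪ volume.restrict (Set.Ioc (0 : ℝ) 1) :=
          withDensity_absolutelyContinuous _ _
        apply measure_congr
        refine hac.ae_le ?_
        filter_upwards [ae_restrict_mem measurableSet_Ioc] with s hs
        apply propext
        exact ⟨fun _ => hs.1, fun _ => ht.trans hs.1⟩
      rw [h2, spacingLaw_Ioi (m := d - 1) (by omega) le_rfl zero_le_one]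
      simp [h1]
    rcases lt_or_ge t 1 with ht1 | ht1
    · rw [spacingLaw_Ioi (m := d - 1) (by omega) ht ht1.le, ← sum_measure_lt_spacing' hd ht ht1]
      rfl
    · have h1 : ∀ i, (fun U : Fin (d - 1) → unitInterval => spacing U i) ⁻¹' Set.Ioi t =
          ∅ := fun i => Set.eq_empty_of_forall_notMem fun U hU =>
        absurd (spacing_le_one U i) (not_le.2 (lt_of_le_of_lt ht1 hU))
      have h2 : spacingLaw (d - 1) (Set.Ioi t) = 0 := by
        refine measure_mono_null (Set.Ioi_subset_Ioi ht1) ?_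
        rw [spacingLaw_Ioi (m := d - 1) (by omega) zero_le_one le_rfl]
        simp [show d - 1 ≠ 0 by omega]
      simp [h1, h2]
  have huniv : spacingLaw (d - 1) Set.univ = 1 := by
    have h0 : spacingLaw (d - 1) (Set.Iic 0) = 0 := by
      rw [spacingLaw, withDensity_apply _ measurableSet_Iic,
        Measure.restrict_restrict measurableSet_Iic]
      have : Set.Iic (0 : ℝ) ∩ Set.Ioc 0 1 = ∅ := by
        ext x; simp only [Set.mem_inter_iff, Set.mem_Iic, Set.mem_Ioc, Set.mem_empty_iff_false,
          iff_false]
        rintro ⟨h1, h2, _⟩; linarith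
      simp [this]
    rw [← Set.Iic_union_Ioi (a := (0 : ℝ)), measure_union (Set.Iic_disjoint_Ioi le_rfl) measurableSet_Ioi, h0,
      spacingLaw_Ioi (m := d - 1) (by omega) le_rfl zero_le_one]
    simp
  have : IsFiniteMeasure (spacingLaw (d - 1)) := ⟨by simp [huniv]⟩
  have : IsFiniteMeasure ((d : ENNReal) • spacingLaw (d - 1)) :=
    Measure.smul_finite _ (by finiteness)
  refine Measure.ext_of_Iic _ _ fun t => ?_
  rw [← Set.compl_Ioi, measure_compl measurableSet_Ioi (measure_ne_top _ _),
    measure_compl measurableSet_Ioi (measure_ne_top _ _), hIoi]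
  congr 1
  simp [Measure.finsetSum_apply, huniv]

lemma integral_spacing (hd : 2 ≤ d) {f : ℝ → ℝ} (hf : Continuous f) :
    ∑ i : Fin d, ∫ U, f (spacing U i)
      ∂(Measure.pi fun _ : Fin (d - 1) => (volume : Measure unitInterval)) =
      d * ∫ t in (0 : ℝ)..1, spacingDensity (d - 1) t * f t := by
  have hms : ∀ i, Measurable fun U : Fin (d - 1) → unitInterval => spacing U i :=
    fun i => measurable_spacing i
  have hbd : ∃ C, ∀ t ∈ Set.Icc (0 : ℝ) 1, |f t| ≤ C := by
    obtain ⟨C, hC⟩ := (isCompact_Icc (a := (0 : ℝ)) (b := 1)).exists_bound_of_continuousOn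
      hf.continuousOn
    exact ⟨C, hC⟩
  obtain ⟨C, hC⟩ := hbd
  have h1 : ∀ i : Fin d, ∫ U, f (spacing U i)
      ∂(Measure.pi fun _ : Fin (d - 1) => (volume : Measure unitInterval)) =
      ∫ t, f t ∂((Measure.pi fun _ : Fin (d - 1) => (volume : Measure unitInterval)).map
        fun U => spacing U i) := fun i =>
    (integral_map (hms i).aemeasurable hf.aestronglyMeasurable).symm
  simp only [h1]
  rw [← integral_finsetSum_measure, sum_map_spacing hd, integral_smul_measure, spacingLaw,
    integral_withDensity_eq_integral_toReal_smul (by fun_prop) (by simp),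
    intervalIntegral.integral_of_le zero_le_one, smul_eq_mul]
  · congr 1
    apply integral_congr_ae
    filter_upwards [ae_restrict_mem measurableSet_Ioc] with t ht
    rw [ENNReal.toReal_ofReal (spacingDensity_nonneg (d - 1) ht.2), smul_eq_mul]
  · intro i _
    have := Measure.isProbabilityMeasure_map
      (μ := Measure.pi fun _ : Fin (d - 1) => (volume : Measure unitInterval)) (hms i).aemeasurable
    refine Integrable.of_bound hf.aestronglyMeasurable C ?_
    rw [ae_map_iff (hms i).aemeasurable]
    · exact Filter.Eventually.of_forall fun U =>
        hC _ ⟨spacing_nonneg U i, spacing_le_one U i⟩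
    · exact measurableSet_le hf.norm.measurable measurable_const

/-! ### Beta integrals and the occupancy numbers of the spacings -/

lemma integral_pow_mul_one_sub_pow (a b : ℕ) : ∫ t in (0 : ℝ)..1, t ^ a * (1 - t) ^ b =
    a.factorial * b.factorial / (a + b + 1).factorial := by
  induction a generalizing b with
  | zero =>
    have h : ∀ s ∈ Set.uIcc (0 : ℝ) 1,
        HasDerivAt (fun s : ℝ => -(1 - s) ^ (b + 1) / (b + 1)) (s ^ 0 * (1 - s) ^ b) s := by
      intro s _
      refine ((((hasDerivAt_one_sub s).fun_pow (b + 1)).fun_neg).div_const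
        ((b : ℝ) + 1)).congr_deriv ?_
      simp
      field_simp
    rw [intervalIntegral.integral_eq_sub_of_hasDerivAt h
      ((by fun_prop : Continuous fun s : ℝ => s ^ 0 * (1 - s) ^ b).intervalIntegrable _ _)]
    have hb : (b.factorial : ℝ) ≠ 0 := by exact_mod_cast b.factorial_ne_zero
    rw [zero_add, Nat.factorial_succ]
    push_cast
    simp
    field_simp
  | succ a ih =>
    have h : ∀ s ∈ Set.uIcc (0 : ℝ) 1, HasDerivAt (fun s : ℝ => s ^ (a + 1) * (1 - s) ^ (b + 1))
        ((a + 1) * (s ^ a * (1 - s) ^ (b + 1)) - (b + 1) * (s ^ (a + 1) * (1 - s) ^ b)) s := by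
      intro s _
      refine ((hasDerivAt_pow (a + 1) s).fun_mul
        ((hasDerivAt_one_sub s).fun_pow (b + 1))).congr_deriv ?_
      simp
      ring
    have h2 := intervalIntegral.integral_eq_sub_of_hasDerivAt h
      ((by fun_prop : Continuous fun s : ℝ => (a + 1) * (s ^ a * (1 - s) ^ (b + 1)) -
        (b + 1) * (s ^ (a + 1) * (1 - s) ^ b)).intervalIntegrable _ _)
    rw [intervalIntegral.integral_sub
      ((by fun_prop : Continuous fun s : ℝ => ((a : ℝ) + 1) *
        (s ^ a * (1 - s) ^ (b + 1))).intervalIntegrable _ _)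
      ((by fun_prop : Continuous fun s : ℝ => ((b : ℝ) + 1) *
        (s ^ (a + 1) * (1 - s) ^ b)).intervalIntegrable _ _),
      intervalIntegral.integral_const_mul, intervalIntegral.integral_const_mul, ih] at h2
    simp at h2
    have e : a + (b + 1) + 1 = a + 1 + b + 1 := by ring
    rw [e] at h2
    have hF : ((a + 1 + b + 1).factorial : ℝ) ≠ 0 := by exact_mod_cast Nat.factorial_ne_zero _
    rw [Nat.factorial_succ a, Nat.factorial_succ b] at *
    push_cast at *
    have hb : (b : ℝ) + 1 ≠ 0 := by positivity
    apply mul_left_cancel₀ hb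
    rw [← sub_eq_zero.1 h2]
    field_simp

/-- The mean number of spacings of `m` uniform points which contain exactly `k` of `n` further
independent uniform points. -/
def occupancy (m n k : ℕ) : ℝ := (m + 1) * ∫ t in (0 : ℝ)..1, spacingDensity m t * binom t n k

lemma occupancy_eq {m n k : ℕ} (hm : 1 ≤ m) (hk : k ≤ n) : occupancy m n k =
    (m + 1) * m * (n.factorial / (n - k).factorial) *
      ((n - k + (m - 1)).factorial / (n + m).factorial) := by
  have h1 : ∀ t, spacingDensity m t * binom t n k =
      m * n.choose k * (t ^ k * (1 - t) ^ (n - k + (m - 1))) := by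
    intro t
    rw [spacingDensity, binom, pow_add]
    ring
  rw [occupancy]
  simp only [h1]
  rw [intervalIntegral.integral_const_mul, integral_pow_mul_one_sub_pow,
    Nat.cast_choose ℝ hk]
  have e : k + (n - k + (m - 1)) + 1 = n + m := by omega
  rw [e]
  have hk0 : (k.factorial : ℝ) ≠ 0 := by exact_mod_cast Nat.factorial_ne_zero _
  field_simp

/-- Log-convexity of the factorial. -/
lemma factorial_add_le_mul (a j r : ℕ) :
    (a + j).factorial * (a + r).factorial ≤ (a + j + r).factorial * a.factorial := by
  induction r with
  | zero => simp
  | succ r ih =>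
    rw [← add_assoc, Nat.factorial_succ, ← add_assoc, Nat.factorial_succ]
    calc (a + j).factorial * ((a + r + 1) * (a + r).factorial)
        = (a + r + 1) * ((a + j).factorial * (a + r).factorial) := by ring
      _ ≤ (a + j + r + 1) * ((a + j + r).factorial * a.factorial) :=
        Nat.mul_le_mul (by omega) ih
      _ = _ := by ring

lemma occupancy_le {m n k : ℕ} (hm : 1 ≤ m) (hn : 1 ≤ n) (hk : k ≤ n) :
    occupancy m n k ≤ (m + 1) * m / n := by
  rw [occupancy_eq hm hk]
  have hn0 : (0 : ℝ) < n := by exact_mod_cast hn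
  have h1 : n.factorial * (n - k + (m - 1)).factorial * n ≤
      (n + m).factorial * (n - k).factorial := by
    have h2 := factorial_add_le_mul (n - k) k (m - 1)
    have e1 : n - k + k = n := by omega
    rw [e1] at h2
    have e2 : n + m = n + (m - 1) + 1 := by omega
    rw [e2, Nat.factorial_succ]
    calc n.factorial * (n - k + (m - 1)).factorial * n
        ≤ (n + (m - 1)).factorial * (n - k).factorial * (n + (m - 1) + 1) :=
          Nat.mul_le_mul h2 (by omega)
      _ = _ := by ring
  have h2 : (n.factorial : ℝ) * (n - k + (m - 1)).factorial * n ≤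
      (n + m).factorial * (n - k).factorial := by exact_mod_cast h1
  have hF : (0 : ℝ) < (n + m).factorial := by exact_mod_cast Nat.factorial_pos _
  have hG : (0 : ℝ) < (n - k).factorial := by exact_mod_cast Nat.factorial_pos _
  rw [mul_assoc, div_mul_div_comm, div_eq_mul_one_div _ (n : ℝ)]
  refine mul_le_mul_of_nonneg_left ?_ (by positivity)
  rw [div_le_div_iff₀ (by positivity) hn0]
  linarith

/-- Each of the `r` factors `(n + s) / (n - k + s)` is at most `2` when `2 * k ≤ n`. -/
lemma factorial_add_mul_le (n k r : ℕ) (hk : 2 * k ≤ n) :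
    (n + r).factorial * (n - k).factorial ≤ 2 ^ r * (n.factorial * (n - k + r).factorial) := by
  induction r with
  | zero => simp
  | succ r ih =>
    rw [← add_assoc, Nat.factorial_succ, ← add_assoc, Nat.factorial_succ]
    calc (n + r + 1) * (n + r).factorial * (n - k).factorial
        = (n + r + 1) * ((n + r).factorial * (n - k).factorial) := by ring
      _ ≤ (2 * (n - k + r + 1)) * (2 ^ r * (n.factorial * (n - k + r).factorial)) :=
        Nat.mul_le_mul (by omega) ih
      _ = _ := by ring

lemma le_occupancy {m n k : ℕ} (hm : 1 ≤ m) (hn : 1 ≤ n) (hk : 2 * k ≤ n) :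
    1 / 2 ^ m / n ≤ occupancy m n k := by
  rw [occupancy_eq hm (by omega)]
  have hn0 : (0 : ℝ) < n := by exact_mod_cast hn
  have h1 : (n + m).factorial * (n - k).factorial ≤
      2 ^ m * m * n * (n.factorial * (n - k + (m - 1)).factorial) * (m + 1) := by
    have h2 := factorial_add_mul_le n k (m - 1) hk
    obtain ⟨r, rfl⟩ := Nat.exists_eq_add_of_le' hm
    simp only [Nat.add_sub_cancel] at h2 ⊢
    rw [← add_assoc, Nat.factorial_succ]
    calc (n + r + 1) * (n + r).factorial * (n - k).factorial
        = (n + r + 1) * ((n + r).factorial * (n - k).factorial) := by ring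
      _ ≤ ((r + 1 + 1) * (2 * (r + 1) * n)) * (2 ^ r * (n.factorial * (n - k + r).factorial)) :=
        Nat.mul_le_mul (by nlinarith [Nat.zero_le (r * n), Nat.zero_le (r * r * n), Nat.mul_le_mul_left r hn]) h2
      _ = _ := by ring
  have h2 : ((n + m).factorial : ℝ) * (n - k).factorial ≤
      2 ^ m * m * n * (n.factorial * (n - k + (m - 1)).factorial) * (m + 1) := by
    exact_mod_cast h1
  have hF : (0 : ℝ) < (n + m).factorial := by exact_mod_cast Nat.factorial_pos _
  have hG : (0 : ℝ) < (n - k).factorial := by exact_mod_cast Nat.factorial_pos _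
  rw [mul_assoc, div_mul_div_comm, ← mul_div_assoc, div_div, div_le_div_iff₀ (by positivity)
    (by positivity)]
  linarith

lemma occupancy_nonneg (m n k : ℕ) : 0 ≤ occupancy m n k := by
  refine mul_nonneg (by positivity) (intervalIntegral.integral_nonneg zero_le_one fun t ht => ?_)
  exact mul_nonneg (spacingDensity_nonneg m ht.2) (binom_nonneg ht.1 ht.2 n k)

@[fun_prop]
lemma continuous_thin (u : ℕ → ℝ) (n : ℕ) : Continuous fun t => thin t u n := by
  unfold thin; fun_prop

/-- The law of the points which determine the spacings. -/
abbrev spacingPoints (d : ℕ) : Measure (Fin (d - 1) → unitInterval) :=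
  Measure.pi fun _ => volume

lemma integrable_comp_spacing (i : Fin d) {f : ℝ → ℝ} (hf : Continuous f) :
    Integrable (fun U => f (spacing U i)) (spacingPoints d) := by
  obtain ⟨C, hC⟩ := (isCompact_Icc (a := (0 : ℝ)) (b := 1)).exists_bound_of_continuousOn
    hf.continuousOn
  exact Integrable.of_bound (hf.measurable.comp (measurable_spacing i)).aestronglyMeasurable C
    (Filter.Eventually.of_forall fun U => hC _ ⟨spacing_nonneg U i, spacing_le_one U i⟩)

lemma sum_integral_thin (hd : 2 ≤ d) (u : ℕ → ℝ) (n : ℕ) :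
    ∑ i : Fin d, ∫ U, thin (spacing U i) u n ∂(spacingPoints d) =
      ∑ k ∈ Finset.range (n + 1), occupancy (d - 1) n k * u k := by
  rw [integral_spacing hd (f := fun t => thin t u n) (by fun_prop)]
  have hc : ((d - 1 : ℕ) : ℝ) + 1 = d := by
    have : d - 1 + 1 = d := by omega
    exact_mod_cast this
  have h1 : ∀ t, spacingDensity (d - 1) t * thin t u n =
      ∑ k ∈ Finset.range (n + 1), spacingDensity (d - 1) t * binom t n k * u k := by
    intro t
    rw [thin, Finset.mul_sum]
    exact Finset.sum_congr rfl fun k _ => by ring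
  simp only [h1, occupancy, hc]
  rw [intervalIntegral.integral_finsetSum fun k _ => by
    apply Continuous.intervalIntegrable; fun_prop, Finset.mul_sum]
  refine Finset.sum_congr rfl fun k _ => ?_
  rw [intervalIntegral.integral_mul_const, mul_assoc]

/-- The spacings have total length `1`, so the mean numbers of points which they contain add up to
`n`. This normalises the kernel of `isScaleKernel_occupancy`. -/
lemma sum_occupancy_mul (hd : 2 ≤ d) (n : ℕ) :
    ∑ k ∈ Finset.range (n + 1), occupancy (d - 1) n k * k = n := by
  rw [← sum_integral_thin hd (fun k => (k : ℝ)) n]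
  simp only [thin_cast]
  rw [← integral_finsetSum _ fun i _ => integrable_comp_spacing i (f := fun t => n * t)
    (by fun_prop)]
  simp only [← Finset.mul_sum, sum_spacing (show 1 ≤ d by omega)]
  simp

/-- The kernel is the size-biased occupancy: the probability that the spacing containing a randomly
chosen one of the `n` points contains exactly `k` of them. Since `occupancy` is at most of order `1
/ n`, and at least of that order for `2 * k ≤ n`, the factor `k / n` gives the required scale. -/
lemma isScaleKernel_occupancy (hd : 2 ≤ d) :
    IsScaleKernel (fun n k => k * occupancy (d - 1) n k / n)
      ((((d - 1 : ℕ) : ℝ) + 1) * (d - 1 : ℕ)) (1 / 2 ^ (d - 1)) where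
  pos := by positivity
  nonneg n k := div_nonneg (mul_nonneg (Nat.cast_nonneg _) (occupancy_nonneg _ _ _))
    (Nat.cast_nonneg _)
  sum_eq_one n hn := by
    have hn0 : (0 : ℝ) < n := by exact_mod_cast hn
    rw [← Finset.sum_div, div_eq_one_iff_eq hn0.ne', ← sum_occupancy_mul hd n]
    exact Finset.sum_congr rfl fun k _ => mul_comm _ _
  le n k hn hk := by
    have hn0 : (0 : ℝ) < n := by exact_mod_cast hn
    have := mul_le_mul_of_nonneg_left (occupancy_le (show 1 ≤ d - 1 by omega) hn hk)
      (Nat.cast_nonneg (α := ℝ) k)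
    calc _ ≤ _ := div_le_div_of_nonneg_right this hn0.le
      _ = _ := by field_simp
  ge n k hn hk := by
    have hn0 : (0 : ℝ) < n := by exact_mod_cast hn
    have := mul_le_mul_of_nonneg_left (le_occupancy (show 1 ≤ d - 1 by omega) hn hk)
      (Nat.cast_nonneg (α := ℝ) k)
    calc _ = _ := by field_simp
      _ ≤ _ := div_le_div_of_nonneg_right this hn0.le

end
end RandomPermuton

namespace RandomPermuton
noncomputable section

variable {d : ℕ}

/-! ### Decomposition of the sample at the root -/

/-- The randomness at a single node. -/
abbrev NodeSample (d : ℕ) : Type := Equiv.Perm (Fin d) × (Fin (d - 1) → unitInterval)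

/-- The law of the randomness at a single node. -/
abbrev nodeLaw (F : Measure (Equiv.Perm (Fin d))) : Measure (NodeSample d) :=
  F.prod (spacingPoints d)

/-- The sample with a given root and given subtrees. -/
def graft (r : NodeSample d) (η : Fin d → Sample d) : Sample d := fun s =>
  if h : s = [] then r else η (s.getLast h) s.dropLast

lemma graft_nil (r : NodeSample d) (η : Fin d → Sample d) : graft r η [] = r := by
  simp [graft]

lemma graft_append (r : NodeSample d) (η : Fin d → Sample d) (s : Node d) (i : Fin d) :
    graft r η (s ++ [i]) = η i s := by
  simp [graft]

lemma subtree_graft (r : NodeSample d) (η : Fin d → Sample d) (i : Fin d) :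
    subtree i (graft r η) = η i := by
  funext s; exact graft_append r η s i

lemma measurable_graft :
    Measurable fun p : NodeSample d × (Fin d → Sample d) => graft p.1 p.2 := by
  refine measurable_pi_lambda _ fun s => ?_
  by_cases h : s = []
  · simp only [graft, h, dif_pos]
    fun_prop
  · simp only [graft, h, dif_neg, not_false_eq_true]
    fun_prop

@[fun_prop]
lemma measurable_subtree (i : Fin d) :
    Measurable fun ω : Sample d => (subtree i ω : Sample d) :=
  measurable_pi_lambda _ fun s => measurable_pi_apply (s ++ [i])

/-- The nodes of the subtree of the `i`-th child of the root which come from `I`. -/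
def subtreeNodes (I : Finset (Node d)) (i : Fin d) : Finset (Node d) :=
  I.preimage (· ++ [i]) fun _ _ _ _ h => List.append_cancel_right h

lemma mem_subtreeNodes {I : Finset (Node d)} {i : Fin d} {s : Node d} :
    s ∈ subtreeNodes I i ↔ s ++ [i] ∈ I := Finset.mem_preimage

lemma prod_eq_prod_subtree {M : Type*} [CommMonoid M] (I : Finset (Node d)) (f : Node d → M) :
    ∏ s ∈ I, f s = (∏ s ∈ I with s = [], f s) *
      ∏ i : Fin d, ∏ s ∈ subtreeNodes I i, f (s ++ [i]) := by
  rw [← Finset.prod_filter_mul_prod_filter_not I (fun s => s = [])]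
  congr 1
  rw [Finset.prod_sigma']
  symm
  refine Finset.prod_bij (fun p _ => p.2 ++ [p.1]) ?_ ?_ ?_ ?_
  · rintro ⟨i, s⟩ h
    simpa [mem_subtreeNodes] using h
  · rintro ⟨i, s⟩ _ ⟨j, t⟩ _ h
    have := List.append_inj' h rfl
    simp only [List.cons.injEq, and_true] at this
    simp [this.1, this.2]
  · intro s hs
    rw [Finset.mem_filter] at hs
    exact ⟨⟨s.getLast hs.2, s.dropLast⟩, by simp [mem_subtreeNodes, List.dropLast_append_getLast, hs.1],
      List.dropLast_append_getLast hs.2⟩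
  · intro _ _; rfl

variable (F : Measure (Equiv.Perm (Fin d))) [IsProbabilityMeasure F]

instance : IsProbabilityMeasure (sampleLaw F) := by
  unfold sampleLaw; infer_instance

/-- An infinite product measure is determined by its values on finite-dimensional boxes, and the
preimage of such a box under `graft` is a box for the root times one box for each subtree. -/
lemma map_graft : ((nodeLaw F).prod (Measure.pi fun _ : Fin d => sampleLaw F)).map
    (fun p => graft p.1 p.2) = sampleLaw F := by
  refine Measure.eq_infinitePi _ fun I t ht => ?_
  rw [Measure.map_apply measurable_graft
    (MeasurableSet.pi I.countable_toSet fun s _ => ht s), prod_eq_prod_subtree]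
  have hpre : (fun p : NodeSample d × (Fin d → Sample d) => graft p.1 p.2) ⁻¹' Set.pi I t =
      {r | ∀ s ∈ I, s = [] → r ∈ t s} ×ˢ Set.univ.pi fun i : Fin d => Set.pi (subtreeNodes I i) fun s => t (s ++ [i]) := by
    ext ⟨r, η⟩
    simp only [Set.mem_preimage, Set.mem_pi, Set.mem_prod, Set.mem_univ, Finset.mem_coe,
      mem_subtreeNodes, forall_const, Set.mem_ofPred_eq]
    constructor
    · intro h
      refine ⟨fun s hs h0 => ?_, fun i s hs => ?_⟩
      · subst h0
        simpa [graft_nil] using h [] hs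
      · simpa [graft_append] using h _ hs
    · rintro ⟨h1, h2⟩ s hs
      rcases List.eq_nil_or_concat' s with rfl | ⟨s, i, rfl⟩
      · simpa [graft_nil] using h1 _ hs rfl
      · simpa [graft_append] using h2 i s hs
  rw [hpre, Measure.prod_prod, Measure.pi_pi]
  congr 1
  · by_cases h : [] ∈ I
    · have e1 : {s ∈ I | s = []} = {[]} := by ext s; simp; rintro rfl; exact h
      have e2 : {r | ∀ s ∈ I, s = [] → r ∈ t s} = t [] := by
        ext r
        exact ⟨fun h' => h' [] h rfl, by rintro h' s _ rfl; exact h'⟩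
      rw [e1, e2, Finset.prod_singleton]
    · have e1 : {s ∈ I | s = []} = ∅ := by
        ext s; simp; rintro hs rfl; exact h hs
      have e2 : {r | ∀ s ∈ I, s = [] → r ∈ t s} = Set.univ :=
        Set.eq_univ_of_forall fun r s hs h0 => absurd (h0 ▸ hs) h
      rw [e1, e2, Finset.prod_empty, measure_univ]
  · refine Finset.prod_congr rfl fun i _ => ?_
    rw [sampleLaw, Measure.infinitePi_pi _ fun s _ => ht _]

lemma map_root_subtrees : (sampleLaw F).map (fun ω => (ω [], fun i : Fin d => (subtree i ω : Sample d))) =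
    (nodeLaw F).prod (Measure.pi fun _ : Fin d => sampleLaw F) := by
  conv_lhs => rw [← map_graft F]
  rw [Measure.map_map (by fun_prop) measurable_graft]
  have : (fun ω : Sample d => (ω [], fun i : Fin d => (subtree i ω : Sample d))) ∘
      (fun p : NodeSample d × (Fin d → Sample d) => graft p.1 p.2) = id := by
    funext p
    simp only [Function.comp, graft_nil, subtree_graft, id]
  rw [this, Measure.map_id]

lemma map_root_subtree (i : Fin d) :
    (sampleLaw F).map (fun ω => (ω [], (subtree i ω : Sample d))) = (nodeLaw F).prod (sampleLaw F) := by
  have h := congrArg (Measure.map (Prod.map id (Function.eval i))) (map_root_subtrees F)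
  rw [Measure.map_map (by fun_prop) (by fun_prop), ← Measure.map_prod_map _ _ (by fun_prop)
    (by fun_prop), Measure.map_id, (measurePreserving_eval _ i).map_eq] at h
  exact h

lemma map_root_subtree_subtree {i j : Fin d} (hij : i ≠ j) :
    (sampleLaw F).map (fun ω => (ω [], (subtree i ω : Sample d), (subtree j ω : Sample d))) =
      (nodeLaw F).prod ((sampleLaw F).prod (sampleLaw F)) := by
  have h := congrArg (Measure.map (Prod.map id fun η : Fin d → Sample d => (η i, η j)))
    (map_root_subtrees F)
  rw [Measure.map_map (by fun_prop) (by fun_prop), ← Measure.map_prod_map _ _ (by fun_prop)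
    (by fun_prop), Measure.map_id, pi_map_pair (fun _ => sampleLaw F) hij] at h
  exact h

lemma map_root : (sampleLaw F).map (fun ω => ω []) = nodeLaw F :=
  Measure.infinitePi_map_eval _ _

lemma measurePreserving_subtree (i : Fin d) :
    MeasurePreserving (fun ω : Sample d => (subtree i ω : Sample d)) (sampleLaw F) (sampleLaw F) := by
  refine ⟨measurable_subtree i, ?_⟩
  have h := congrArg (Measure.map Prod.snd) (map_root_subtree F i)
  rw [Measure.map_map (by fun_prop) (by fun_prop), Measure.map_snd_prod, measure_univ, one_smul] at h
  exact h

variable {F}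

lemma integral_comp_root {f : NodeSample d → ℝ} (hf : Measurable f) :
    ∫ ω, f (ω []) ∂(sampleLaw F) = ∫ r, f r ∂(nodeLaw F) := by
  rw [← map_root F, integral_map (measurable_pi_apply ([] : Node d)).aemeasurable hf.aestronglyMeasurable]

lemma integral_spacing_root (i : Fin d) {f : ℝ → ℝ} (hf : Measurable f) :
    ∫ ω, f (weights ω [] i) ∂(sampleLaw F) = ∫ U, f (spacing U i) ∂(spacingPoints d) := by
  unfold weights
  rw [integral_comp_root (f := fun r : NodeSample d => f (spacing r.2 i)) (by fun_prop)]
  exact (integral_fun_snd (μ := F) (ν := spacingPoints d) fun U => f (spacing U i)).trans (by simp)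

lemma integral_root_mul_subtree (i : Fin d) {f : NodeSample d → ℝ} {g : Sample d → ℝ}
    (hf : Measurable f) (hg : Measurable g) :
    ∫ ω, f (ω []) * g (subtree i ω) ∂(sampleLaw F) =
      (∫ ω, f (ω []) ∂(sampleLaw F)) * ∫ ω, g ω ∂(sampleLaw F) := by
  rw [integral_comp_root hf, ← integral_prod_mul f g, ← map_root_subtree F i,
    integral_map (by fun_prop) (by fun_prop)]

lemma integral_root_mul_subtree_mul_subtree {i j : Fin d} (hij : i ≠ j) {f : NodeSample d → ℝ}
    {g h : Sample d → ℝ} (hf : Measurable f) (hg : Measurable g) (hh : Measurable h) :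
    ∫ ω, f (ω []) * (g (subtree i ω) * h (subtree j ω)) ∂(sampleLaw F) =
      (∫ ω, f (ω []) ∂(sampleLaw F)) *
        ((∫ ω, g ω ∂(sampleLaw F)) * ∫ ω, h ω ∂(sampleLaw F)) := by
  rw [integral_comp_root hf, ← integral_prod_mul g h,
    ← integral_prod_mul f fun p : Sample d × Sample d => g p.1 * h p.2,
    ← map_root_subtree_subtree F hij, integral_map (by fun_prop) (by fun_prop)]

lemma ae_subtree (i : Fin d) {p : Sample d → Prop} (h : ∀ᵐ ω ∂(sampleLaw F), p ω) :
    ∀ᵐ ω ∂(sampleLaw F), p (subtree i ω) :=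
  (measurePreserving_subtree F i).quasiMeasurePreserving.ae h

end
end RandomPermuton

namespace RandomPermuton
noncomputable section

variable {d : ℕ}

/-! ### Measurability -/

@[fun_prop]
lemma measurable_weights (s : Node d) (i : Fin d) : Measurable fun ω : Sample d => weights ω s i :=
  (measurable_spacing i).comp (measurable_snd.comp (measurable_pi_apply s))

@[fun_prop]
lemma measurable_labels (s : Node d) : Measurable fun ω : Sample d => labels ω s :=
  measurable_fst.comp (measurable_pi_apply s)

lemma measurableSet_labels (s : Node d) (p : Equiv.Perm (Fin d) → Prop) :
    MeasurableSet {ω : Sample d | p (labels ω s)} :=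
  measurable_labels s (MeasurableSpace.measurableSet_top (s := {α | p α}))

@[fun_prop]
lemma measurable_side (s : Node d) : Measurable fun ω : Sample d => side (weights ω) s := by
  induction s with
  | nil => exact measurable_const
  | cons i s ih => exact ih.mul (measurable_weights s i)

@[fun_prop]
lemma measurable_left (s : Node d) : Measurable fun ω : Sample d => left (weights ω) s := by
  induction s with
  | nil => exact measurable_const
  | cons i s ih =>
    exact ih.add ((measurable_side s).mul (Finset.measurable_sum _ fun j _ => measurable_weights s j))

@[fun_prop]
lemma measurable_bottom (s : Node d) :
    Measurable fun ω : Sample d => bottom (labels ω) (weights ω) s := by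
  induction s with
  | nil => exact measurable_const
  | cons i s ih =>
    refine ih.add ((measurable_side s).mul ?_)
    simp only [Finset.sum_filter]
    exact Finset.measurable_sum _ fun j _ => Measurable.ite
      (measurableSet_labels s fun α => α j < α i) (measurable_weights s j) measurable_const

/-- The permuton of a sample. -/
abbrev samplePermuton (ω : Sample d) : Measure (ℝ × ℝ) := treePermuton (labels ω) (weights ω)

/-- The sampling entropies of the permuton of a sample. -/
abbrev sampleEntropy (ω : Sample d) (n : ℕ) : ℝ := samplingEntropy (samplePermuton ω) n

lemma measurable_ordinate_prod :
    Measurable fun p : Sample d × ℝ => ordinate (labels p.1) (weights p.1) p.2 := by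
  refine Measurable.iSup fun s => ?_
  have hs : MeasurableSet {p : Sample d × ℝ | p.2 ∈ interval (weights p.1) s} :=
    (measurableSet_le ((measurable_left s).comp measurable_fst) measurable_snd).inter
      (measurableSet_lt measurable_snd (((measurable_left s).comp measurable_fst).add
        ((measurable_side s).comp measurable_fst)))
  exact Measurable.ite hs ((measurable_bottom s).comp measurable_fst) measurable_const

lemma pi_treePermuton (S : Node d → Equiv.Perm (Fin d)) (w : Node d → Fin d → ℝ) (n : ℕ) :
    (Measure.pi fun _ : Fin n => treePermuton S w) =
      (Measure.pi fun _ : Fin n => volume.restrict (Set.Ico (0 : ℝ) 1)).map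
        fun x j => (x j, ordinate S w (x j)) := by
  have : ∀ j : Fin n, SigmaFinite ((volume.restrict (Set.Ico (0 : ℝ) 1)).map
      ((fun _ x => (x, ordinate S w x)) j : ℝ → ℝ × ℝ)) := fun j =>
    inferInstanceAs (SigmaFinite (treePermuton S w))
  exact (Measure.pi_map_pi (f := fun (_ : Fin n) x => (x, ordinate S w x)) fun _ =>
    (measurable_id.prodMk (measurable_ordinate S w)).aemeasurable).symm

/-- The points of the graph of the ordinate of a sample with given abscissas. -/
def graphPoints {n : ℕ} (p : Sample d × (Fin n → ℝ)) (j : Fin n) : ℝ × ℝ :=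
  (p.2 j, ordinate (labels p.1) (weights p.1) (p.2 j))

lemma measurable_graphPoints {n : ℕ} : Measurable (graphPoints (d := d) (n := n)) := by
  refine measurable_pi_lambda _ fun j => ?_
  have h2 : Measurable fun p : Sample d × (Fin n → ℝ) => (p.1, p.2 j) := by fun_prop
  have h3 : Measurable fun p : Sample d × (Fin n → ℝ) => p.2 j := by fun_prop
  exact h3.prodMk (Measurable.comp (f := fun p : Sample d × (Fin n → ℝ) => (p.1, p.2 j))
    measurable_ordinate_prod h2)

/-- Writing the sample as a graph over uniform abscissas that do not depend on `ω` turns the density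
into the measure of a section of a fixed measurable set. Measurability in `ω` follows. -/
lemma patternDensity_eq {n : ℕ} (σ : Equiv.Perm (Fin n)) (ω : Sample d) :
    patternDensity (samplePermuton ω) σ =
      ((Measure.pi fun _ : Fin n => volume.restrict (Set.Ico (0 : ℝ) 1))
        (Prod.mk ω ⁻¹' (graphPoints ⁻¹' {p | HasPattern σ p}))).toReal := by
  have hm : Measurable fun (x : Fin n → ℝ) j => (x j, ordinate (labels ω) (weights ω) (x j)) :=
    measurable_pi_lambda _ fun j => (measurable_pi_apply j).prodMk
      ((measurable_ordinate _ _).comp (measurable_pi_apply j))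
  rw [patternDensity, pi_treePermuton, Measure.real,
    Measure.map_apply hm (measurableSet_hasPattern σ)]
  rfl

lemma measurable_patternDensity {n : ℕ} (σ : Equiv.Perm (Fin n)) :
    Measurable fun ω : Sample d => patternDensity (samplePermuton ω) σ := by
  simp only [patternDensity_eq]
  exact (measurable_measure_prodMk_left
    (measurable_graphPoints (measurableSet_hasPattern σ))).ennreal_toReal

@[fun_prop]
lemma measurable_sampleEntropy (n : ℕ) : Measurable fun ω : Sample d => sampleEntropy ω n :=
  Finset.measurable_sum _ fun σ _ =>
    Real.continuous_negMulLog.measurable.comp (measurable_patternDensity σ)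

/-! ### The squares become small -/

/-- The sum of the `X k` has finite expectation, so it is almost surely finite and its terms tend to
zero. -/
lemma ae_tendsto_zero_of_summable {Ω : Type*} [MeasurableSpace Ω] {P : Measure Ω} {X : ℕ → Ω → ℝ}
    (hX : ∀ k ω, 0 ≤ X k ω) (hi : ∀ k, Integrable (X k) P) {a : ℕ → ℝ} (ha : Summable a)
    (h : ∀ k, ∫ ω, X k ω ∂P ≤ a k) : ∀ᵐ ω ∂P, Tendsto (fun k => X k ω) atTop (𝓝 0) := by
  have hs : Summable fun k => ∫ ω, X k ω ∂P :=
    ha.of_nonneg_of_le (fun k => integral_nonneg (hX k)) h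
  have h1 : ∫⁻ ω, ∑' k, ENNReal.ofReal (X k ω) ∂P ≠ ⊤ := by
    rw [lintegral_tsum fun k => (hi k).aestronglyMeasurable.aemeasurable.ennreal_ofReal]
    have : ∀ k, ∫⁻ ω, ENNReal.ofReal (X k ω) ∂P = ENNReal.ofReal (∫ ω, X k ω ∂P) := fun k =>
      (ofReal_integral_eq_lintegral_ofReal (hi k) (Eventually.of_forall (hX k))).symm
    simp only [this]
    exact hs.tsum_ofReal_ne_top
  filter_upwards [ae_lt_top' (AEMeasurable.tsum fun k =>
    (hi k).aestronglyMeasurable.aemeasurable.ennreal_ofReal) h1] with ω hω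
  have h2 := ENNReal.tendsto_atTop_zero_of_tsum_ne_top hω.ne
  have h3 := (ENNReal.tendsto_toReal ENNReal.zero_ne_top).comp h2
  simpa [Function.comp_def, ENNReal.toReal_ofReal (hX _ _)] using h3

/-- The sum of the squared side lengths of the squares of a given level. -/
def sumSq : ℕ → Sample d → ℝ
  | 0, _ => 1
  | k + 1, ω => ∑ i, weights ω [] i ^ 2 * sumSq k (subtree i ω)

@[fun_prop]
lemma measurable_sumSq (k : ℕ) : Measurable (sumSq (d := d) k) := by
  induction k with
  | zero => exact measurable_const
  | succ k ih => exact Finset.measurable_sum _ fun i _ =>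
      ((measurable_weights [] i).pow_const 2).mul (ih.comp (measurable_subtree i))

lemma weights_nonneg (ω : Sample d) (s : Node d) (i : Fin d) : 0 ≤ weights ω s i :=
  spacing_nonneg _ i

lemma weights_le_one (ω : Sample d) (s : Node d) (i : Fin d) : weights ω s i ≤ 1 :=
  spacing_le_one _ i

lemma sumSq_nonneg (k : ℕ) (ω : Sample d) : 0 ≤ sumSq k ω := by
  induction k generalizing ω with
  | zero => exact zero_le_one
  | succ k ih => exact Finset.sum_nonneg fun i _ => mul_nonneg (sq_nonneg _) (ih _)

lemma side_sq_le (s : Node d) (ω : Sample d) : side (weights ω) s ^ 2 ≤ sumSq s.length ω := by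
  induction s using List.reverseRecOn generalizing ω with
  | nil => simp [side, sumSq]
  | append_singleton s i ih =>
    rw [side_append, mul_pow, List.length_append]
    refine le_trans (mul_le_mul_of_nonneg_left (ih (subtree i ω)) (sq_nonneg _)) ?_
    exact Finset.single_le_sum (f := fun i => weights ω [] i ^ 2 * sumSq s.length (subtree i ω))
      (fun i _ => mul_nonneg (sq_nonneg _) (sumSq_nonneg _ _)) (Finset.mem_univ i)

/-- This constant is the contraction factor per level, both for the squared side lengths and for the
variance of the centred entropy. -/
lemma sum_integral_spacing_sq (hd : 2 ≤ d) :
    ∑ i : Fin d, ∫ U, spacing U i ^ 2 ∂(spacingPoints d) = 2 / (d + 1) := by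
  obtain ⟨m, rfl⟩ : ∃ m, d = m + 2 := ⟨d - 2, by omega⟩
  rw [integral_spacing hd (f := fun t => t ^ 2) (by fun_prop)]
  have h1 : ∀ t, spacingDensity (m + 2 - 1) t * t ^ 2 = (m + 1 : ℝ) * (t ^ 2 * (1 - t) ^ m) := by
    intro t
    simp [spacingDensity]
    ring
  simp only [h1]
  rw [intervalIntegral.integral_const_mul, integral_pow_mul_one_sub_pow,
    show 2 + m + 1 = m + 1 + 1 + 1 by ring, Nat.factorial_succ (m + 1 + 1),
    Nat.factorial_succ (m + 1), Nat.factorial_succ m]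
  have : (m.factorial : ℝ) ≠ 0 := by exact_mod_cast m.factorial_ne_zero
  push_cast
  simp only [Nat.factorial]
  field_simp
  push_cast
  ring

variable {F : Measure (Equiv.Perm (Fin d))} [IsProbabilityMeasure F]

lemma sum_integral_weights_sq (hd : 2 ≤ d) :
    ∑ i : Fin d, ∫ ω, weights ω [] i ^ 2 ∂(sampleLaw F) = 2 / (d + 1) := by
  rw [← sum_integral_spacing_sq hd]
  exact Finset.sum_congr rfl fun i _ =>
    integral_spacing_root i (f := fun t => t ^ 2) (by fun_prop)

lemma sumSq_le_one (hd : 1 ≤ d) (k : ℕ) (ω : Sample d) : sumSq k ω ≤ 1 := by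
  induction k generalizing ω with
  | zero => exact le_rfl
  | succ k ih =>
    rw [← sum_spacing hd (ω []).2]
    refine Finset.sum_le_sum fun i _ => ?_
    have h0 := weights_nonneg ω [] i
    have h1 := weights_le_one ω [] i
    calc weights ω [] i ^ 2 * sumSq k (subtree i ω) ≤ weights ω [] i ^ 2 * 1 :=
          mul_le_mul_of_nonneg_left (ih _) (sq_nonneg _)
      _ ≤ weights ω [] i := by nlinarith

lemma integral_sumSq (hd : 2 ≤ d) (k : ℕ) :
    ∫ ω, sumSq k ω ∂(sampleLaw F) = (2 / (d + 1)) ^ k := by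
  induction k with
  | zero => simp [sumSq]
  | succ k ih =>
    simp only [sumSq]
    rw [integral_finsetSum]
    · have h : ∀ i : Fin d, ∫ ω : Sample d, weights ω [] i ^ 2 * sumSq k (subtree i ω) ∂(sampleLaw F) =
          (∫ ω, weights ω [] i ^ 2 ∂(sampleLaw F)) * (2 / (d + 1)) ^ k := by
        intro i
        rw [← ih]
        exact integral_root_mul_subtree i (f := fun r : NodeSample d => spacing r.2 i ^ 2)
          (by fun_prop) (measurable_sumSq k)
      simp only [h]
      rw [← Finset.sum_mul, sum_integral_weights_sq hd, pow_succ, mul_comm]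
    · intro i _
      refine Integrable.of_bound (C := 1) (by fun_prop) (Eventually.of_forall fun ω => ?_)
      rw [Real.norm_of_nonneg (mul_nonneg (sq_nonneg _) (sumSq_nonneg _ _))]
      exact mul_le_one₀ (pow_le_one₀ (weights_nonneg _ _ _) (weights_le_one _ _ _))
        (sumSq_nonneg _ _) (sumSq_le_one (by omega) _ _)

lemma two_div_lt_one (hd : 2 ≤ d) : (2 : ℝ) / (d + 1) < 1 := by
  have : (2 : ℝ) ≤ d := by exact_mod_cast hd
  rw [div_lt_one (by linarith)]
  linarith

/-- The square of the largest side of a level is at most the sum of all squared sides, whose mean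
decays geometrically. -/
lemma ae_isFine (hd : 2 ≤ d) : ∀ᵐ ω ∂(sampleLaw F), IsFine (weights ω) := by
  have h := ae_tendsto_zero_of_summable (P := sampleLaw F) (X := sumSq) sumSq_nonneg
    (fun k => Integrable.of_bound (C := 1) (by fun_prop) (Eventually.of_forall fun ω => by
      rw [Real.norm_of_nonneg (sumSq_nonneg _ _)]; exact sumSq_le_one (by omega) _ _))
    (summable_geometric_of_lt_one (by positivity) (two_div_lt_one hd))
    (fun k => (integral_sumSq hd k).le)
  filter_upwards [h] with ω hω ε hε
  filter_upwards [hω.eventually_lt_const (show (0 : ℝ) < ε ^ 2 by positivity)] with n hn s hs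
  have := side_sq_le s ω
  rw [hs] at this
  exact lt_of_pow_lt_pow_left₀ 2 hε.le (this.trans_lt hn)

/-- The `d` probabilities `P(0 < spacing U i)` add up to `d`, so each of them equals `1`. -/
lemma ae_weights_pos (hd : 2 ≤ d) : ∀ᵐ ω ∂(sampleLaw F), ∀ i, 0 < weights ω [] i := by
  rw [ae_all_iff]
  intro i
  have h1 := sum_measure_lt_spacing' hd le_rfl zero_lt_one
  simp only [sub_zero, ENNReal.ofReal_one, one_pow, mul_one] at h1
  have h2 : spacingPoints d {U | 0 < spacing U i} = 1 := by
    by_contra hne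
    have hlt : spacingPoints d {U | 0 < spacing U i} < 1 := lt_of_le_of_ne prob_le_one hne
    have h5 : ∑ j ∈ Finset.univ.erase i, spacingPoints d {U | 0 < spacing U j} ≤
        ((d - 1 : ℕ) : ENNReal) := by
      refine (Finset.sum_le_card_nsmul _ _ 1 fun j _ => prob_le_one).trans ?_
      simp
    rw [← Finset.add_sum_erase _ _ (Finset.mem_univ i)] at h1
    have h6 := ENNReal.add_lt_add_of_lt_of_le
      (ne_top_of_le_ne_top (ENNReal.natCast_ne_top _) h5) hlt h5
    rw [h1, show (1 : ENNReal) + (d - 1 : ℕ) = ((1 + (d - 1) : ℕ) : ENNReal) by push_cast; rfl,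
      show 1 + (d - 1) = d by omega] at h6
    exact lt_irrefl _ h6
  have h3 : ∀ᵐ U ∂(spacingPoints d), 0 < spacing U i :=
    (mem_ae_iff_prob_eq_one (measurableSet_lt measurable_const (measurable_spacing i))).2 h2
  have h4 : ∀ᵐ r ∂(nodeLaw F), 0 < spacing r.2 i :=
    (Measure.quasiMeasurePreserving_snd (μ := F) (ν := spacingPoints d)).ae h3
  rw [← map_root F] at h4
  exact ae_of_ae_map (measurable_pi_apply ([] : Node d)).aemeasurable h4

/-! ### The recursion for the sampling entropy -/

lemma samplePermuton_eq_inflate (hd : 1 ≤ d) (ω : Sample d) : samplePermuton ω =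
    inflate (labels ω []) (weights ω []) fun i => samplePermuton (subtree i ω) :=
  treePermuton_eq_inflate (isWeight_weights hd ω) (labels ω)

lemma ae_isPermuton (hd : 2 ≤ d) : ∀ᵐ ω ∂(sampleLaw F), IsPermuton (samplePermuton ω) := by
  filter_upwards [ae_isFine hd] with ω hω
  exact isPermuton_treePermuton (isWeight_weights (by omega) ω) hω _

lemma ae_isPermuton_subtree (hd : 2 ≤ d) :
    ∀ᵐ ω ∂(sampleLaw F), ∀ i, IsPermuton (samplePermuton (subtree i ω)) := by
  rw [ae_all_iff]
  exact fun i => ae_subtree i (ae_isPermuton hd)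

/-- The contribution of the root to the sampling entropy. -/
def rootTerm (ω : Sample d) (n : ℕ) : ℝ :=
  sampleEntropy ω n - ∑ i, thin (weights ω [] i) (sampleEntropy (subtree i ω)) n

lemma ae_rootTerm (hd : 2 ≤ d) : ∀ᵐ ω ∂(sampleLaw F),
    ∀ n, 0 ≤ rootTerm ω n ∧ rootTerm ω n ≤ d * Real.log (n + 1) := by
  filter_upwards [ae_isPermuton hd, ae_isPermuton_subtree hd] with ω h1 h2 n
  have e := samplePermuton_eq_inflate (by omega) ω
  have h3 := sum_thin_le_samplingEntropy (weights_nonneg ω []) (sum_spacing (by omega) (ω []).2) h2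
    (e ▸ h1) n
  have h4 := samplingEntropy_le_sum_thin (weights_nonneg ω []) (sum_spacing (by omega) (ω []).2) h2
    (e ▸ h1) n
  rw [← e] at h3 h4
  unfold rootTerm
  constructor <;> linarith

end
end RandomPermuton

namespace RandomPermuton
noncomputable section

variable {d : ℕ} {F : Measure (Equiv.Perm (Fin d))} [IsProbabilityMeasure F]

/-! ### Expectation of the sampling entropy -/

lemma binom_le_one {p : ℝ} (h0 : 0 ≤ p) (h1 : p ≤ 1) {n k : ℕ} (hk : k ≤ n) : binom p n k ≤ 1 := by
  rw [← sum_binom p n]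
  exact Finset.single_le_sum (f := binom p n) (fun k _ => binom_nonneg h0 h1 n k)
    (Finset.mem_range.2 (by omega))

lemma integrable_binom_mul (i : Fin d) {n k : ℕ} (hk : k ≤ n) {f : Sample d → ℝ}
    (hf : Integrable f (sampleLaw F)) :
    Integrable (fun ω => binom (weights ω [] i) n k * f (subtree i ω)) (sampleLaw F) := by
  refine Integrable.bdd_mul (c := 1) ((measurePreserving_subtree F i).integrable_comp_of_integrable hf)
    ((continuous_binom n k).measurable.comp (measurable_weights [] i)).aestronglyMeasurable
    (Eventually.of_forall fun ω => ?_)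
  rw [Real.norm_of_nonneg (binom_nonneg (weights_nonneg _ _ _) (weights_le_one _ _ _) _ _)]
  exact binom_le_one (weights_nonneg _ _ _) (weights_le_one _ _ _) hk

lemma integrable_thin_subtree (i : Fin d) (n : ℕ) {u : Sample d → ℕ → ℝ}
    (hu : ∀ k, k ≤ n → Integrable (fun ω => u ω k) (sampleLaw F)) :
    Integrable (fun ω => thin (weights ω [] i) (u (subtree i ω)) n) (sampleLaw F) := by
  unfold thin
  refine integrable_finsetSum _ fun k hk => ?_
  have hk' : k ≤ n := by simpa [Nat.lt_succ_iff] using hk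
  exact integrable_binom_mul i hk' (f := fun ω => u ω k) (hu k hk')

lemma integral_thin_subtree (i : Fin d) (n : ℕ) {u : Sample d → ℕ → ℝ}
    (hm : ∀ k, Measurable fun ω => u ω k)
    (hu : ∀ k, k ≤ n → Integrable (fun ω => u ω k) (sampleLaw F)) :
    ∫ ω, thin (weights ω [] i) (u (subtree i ω)) n ∂(sampleLaw F) =
      ∫ ω, thin (weights ω [] i) (fun k => ∫ ω, u ω k ∂(sampleLaw F)) n ∂(sampleLaw F) := by
  unfold thin
  have hle : ∀ k ∈ Finset.range (n + 1), k ≤ n := fun k hk => by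
    simpa [Nat.lt_succ_iff] using hk
  rw [integral_finsetSum _ fun k hk =>
    integrable_binom_mul i (hle k hk) (f := fun ω => u ω k) (hu k (hle k hk)),
    integral_finsetSum _ fun k hk => integrable_binom_mul i (hle k hk) (integrable_const _)]
  refine Finset.sum_congr rfl fun k _ => ?_
  rw [integral_mul_const]
  exact integral_root_mul_subtree i (f := fun r : NodeSample d => binom (spacing r.2 i) n k)
    (g := fun ω => u ω k)
    ((continuous_binom n k).measurable.comp (by fun_prop : Measurable fun r : NodeSample d => spacing r.2 i)) (hm k)

lemma sum_integral_thin_weights (hd : 2 ≤ d) (u : ℕ → ℝ) (n : ℕ) :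
    ∑ i : Fin d, ∫ ω, thin (weights ω [] i) u n ∂(sampleLaw F) =
      ∑ k ∈ Finset.range (n + 1), occupancy (d - 1) n k * u k := by
  rw [← sum_integral_thin hd]
  exact Finset.sum_congr rfl fun i _ => integral_spacing_root i (f := fun t => thin t u n)
    (continuous_thin u n).measurable

lemma sampleEntropy_nonneg (ω : Sample d) (n : ℕ) : 0 ≤ sampleEntropy ω n :=
  samplingEntropy_nonneg _ n

lemma sampleEntropy_zero (ω : Sample d) : sampleEntropy ω 0 = 0 := by
  have h (σ : Equiv.Perm (Fin 0)) : {p : Fin 0 → ℝ × ℝ | HasPattern σ p} = Set.univ :=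
    Set.eq_univ_of_forall fun p => ⟨1, fun i => i.elim0, fun i => i.elim0⟩
  simp [sampleEntropy, samplingEntropy, patternDensity, h]

lemma ae_sampleEntropy_le (hd : 2 ≤ d) : ∀ᵐ ω ∂(sampleLaw F),
    ∀ n, 1 ≤ n → sampleEntropy ω n ≤ (n - 1) * Real.log n := by
  filter_upwards [ae_isPermuton hd] with ω h n hn
  exact samplingEntropy_le h hn

lemma integrable_sampleEntropy (hd : 2 ≤ d) (n : ℕ) :
    Integrable (fun ω => sampleEntropy ω n) (sampleLaw F) := by
  rcases Nat.eq_zero_or_pos n with rfl | hn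
  · simp only [sampleEntropy_zero]
    exact integrable_const 0
  refine Integrable.of_bound (C := (n - 1) * Real.log n)
    (measurable_sampleEntropy n).aestronglyMeasurable ?_
  filter_upwards [ae_sampleEntropy_le hd] with ω h1
  rw [Real.norm_of_nonneg (sampleEntropy_nonneg ω n)]
  exact h1 n hn

/-- The expectation of the sampling entropy. -/
def meanEntropy (F : Measure (Equiv.Perm (Fin d))) [IsProbabilityMeasure F] (n : ℕ) : ℝ :=
  ∫ ω, sampleEntropy ω n ∂(sampleLaw F)

lemma meanEntropy_zero : meanEntropy F 0 = 0 := by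
  simp only [meanEntropy, sampleEntropy_zero, integral_zero]

lemma meanEntropy_nonneg (n : ℕ) : 0 ≤ meanEntropy F n :=
  integral_nonneg fun ω => sampleEntropy_nonneg ω n

lemma meanEntropy_le (hd : 2 ≤ d) {n : ℕ} (hn : 1 ≤ n) :
    meanEntropy F n ≤ (n - 1) * Real.log n := by
  have := integral_mono_ae (integrable_sampleEntropy (F := F) hd n)
    (integrable_const ((n - 1) * Real.log n))
    (by filter_upwards [ae_sampleEntropy_le hd] with ω h using h n hn)
  rwa [integral_const, probReal_univ, one_smul] at this

lemma integrable_rootTerm (hd : 2 ≤ d) (n : ℕ) :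
    Integrable (fun ω => rootTerm ω n) (sampleLaw F) :=
  (integrable_sampleEntropy hd n).sub (integrable_finsetSum _ fun i _ =>
    integrable_thin_subtree i n fun k _ => integrable_sampleEntropy hd k)

/-- A subtree is independent of the root weights and has the law of the whole tree. Hence its
entropies may be replaced by their means, and averaging the binomial weights over the spacings
produces `occupancy`. -/
lemma meanEntropy_eq (hd : 2 ≤ d) (n : ℕ) : meanEntropy F n =
    ∑ k ∈ Finset.range (n + 1), occupancy (d - 1) n k * meanEntropy F k +
      ∫ ω, rootTerm ω n ∂(sampleLaw F) := by
  have h1 := integral_sub (integrable_sampleEntropy (F := F) hd n)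
    (integrable_finsetSum Finset.univ fun i _ =>
    integrable_thin_subtree (F := F) i n fun k _ => integrable_sampleEntropy hd k)
  rw [integral_finsetSum _ fun i _ =>
    integrable_thin_subtree (F := F) i n fun k _ => integrable_sampleEntropy hd k] at h1
  simp only [integral_thin_subtree (F := F) (u := sampleEntropy) _ n measurable_sampleEntropy
    fun k _ => integrable_sampleEntropy hd k] at h1
  change ∫ ω, rootTerm ω n ∂(sampleLaw F) = meanEntropy F n - ∑ i : Fin d,
    ∫ ω, thin (weights ω [] i) (meanEntropy F) n ∂(sampleLaw F) at h1
  rw [sum_integral_thin_weights hd] at h1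
  rw [h1]
  ring

lemma integral_rootTerm_nonneg (hd : 2 ≤ d) (n : ℕ) : 0 ≤ ∫ ω, rootTerm ω n ∂(sampleLaw F) :=
  integral_nonneg_of_ae (by filter_upwards [ae_rootTerm hd] with ω h using (h n).1)

lemma integral_rootTerm_le (hd : 2 ≤ d) (n : ℕ) :
    ∫ ω, rootTerm ω n ∂(sampleLaw F) ≤ d * Real.log (n + 1) := by
  have := integral_mono_ae (integrable_rootTerm (F := F) hd n)
    (integrable_const (d * Real.log (n + 1)))
    (by filter_upwards [ae_rootTerm hd] with ω h using (h n).2)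
  simpa using this

/-- A crude bound is enough: it brings the error of the recursion, divided by `n`, to the form `E /
√n` used for scale kernels. -/
lemma log_add_one_le_sqrt {n : ℕ} (hn : 1 ≤ n) : Real.log (n + 1) ≤ 4 * √(n : ℝ) := by
  have hn' : (1 : ℝ) ≤ n := by exact_mod_cast hn
  have h1 : Real.log (n + 1) = 2 * Real.log √((n : ℝ) + 1) := by
    rw [Real.log_sqrt (by positivity)]; ring
  have h2 := Real.log_le_sub_one_of_pos (Real.sqrt_pos.2 (by positivity : (0 : ℝ) < n + 1))
  have h3 : √((n : ℝ) + 1) ≤ 2 * √(n : ℝ) := by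
    rw [Real.sqrt_le_left (by positivity), mul_pow, Real.sq_sqrt (by positivity)]
    linarith
  linarith

lemma sum_kernel_mul_eq (n : ℕ) : ∑ k ∈ Finset.range (n + 1),
    (k * occupancy (d - 1) n k / n) * (meanEntropy F k / k) =
      (∑ k ∈ Finset.range (n + 1), occupancy (d - 1) n k * meanEntropy F k) / n := by
  rw [Finset.sum_div]
  refine Finset.sum_congr rfl fun k _ => ?_
  rcases Nat.eq_zero_or_pos k with rfl | hk
  · simp [meanEntropy_zero]
  · have : (k : ℝ) ≠ 0 := by positivity
    field_simp

lemma mean_div_sub_eq (hd : 2 ≤ d) (n : ℕ) : meanEntropy F n / n -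
    ∑ k ∈ Finset.range (n + 1), (k * occupancy (d - 1) n k / n) * (meanEntropy F k / k) =
      (∫ ω, rootTerm ω n ∂(sampleLaw F)) / n := by
  rw [sum_kernel_mul_eq, ← sub_div, meanEntropy_eq hd n, add_sub_cancel_left]

lemma integral_rootTerm_div_le (hd : 2 ≤ d) {n : ℕ} (hn : 1 ≤ n) :
    (∫ ω, rootTerm ω n ∂(sampleLaw F)) / n ≤ 4 * d / √(n : ℝ) := by
  have hn' : (1 : ℝ) ≤ n := by exact_mod_cast hn
  have h1 := integral_rootTerm_le (F := F) hd n
  have h2 := mul_le_mul_of_nonneg_left (log_add_one_le_sqrt hn) (Nat.cast_nonneg (α := ℝ) d)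
  rw [div_le_div_iff₀ (by linarith) (by positivity)]
  calc _ ≤ (4 * d * √(n : ℝ)) * √(n : ℝ) :=
        mul_le_mul_of_nonneg_right (by linarith) (Real.sqrt_nonneg _)
    _ = _ := by rw [mul_assoc, Real.mul_self_sqrt (by linarith)]

lemma exists_tendsto_meanEntropy (F : Measure (Equiv.Perm (Fin d))) [IsProbabilityMeasure F]
    (hd : 2 ≤ d) : ∃ c, Tendsto (fun n : ℕ => meanEntropy F n / n) atTop (𝓝 c) := by
  have hw := isScaleKernel_occupancy hd
  have hE : (0 : ℝ) ≤ 4 * d := by positivity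
  -- Counting permutations only bounds `meanEntropy F n / n` by `log n`. Boundedness comes from the
  -- renewal inequality, and convergence is then derived from boundedness.
  obtain ⟨A, hA⟩ := hw.bddAbove_of_sub hE (g := fun n => meanEntropy F n / n) fun n hn => by
    have := mean_div_sub_eq (F := F) hd n
    have := integral_rootTerm_div_le (F := F) hd (n := n) (by omega)
    linarith
  refine hw.exists_tendsto hE (A := A) (fun n => ?_) fun n hn => ?_
  · rw [abs_of_nonneg (div_nonneg (meanEntropy_nonneg n) (Nat.cast_nonneg _))]
    exact hA n
  · rw [mean_div_sub_eq hd n, abs_of_nonneg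
      (div_nonneg (integral_rootTerm_nonneg hd n) (Nat.cast_nonneg _))]
    exact integral_rootTerm_div_le hd (by omega)

lemma pos_of_tendsto_meanEntropy (hd : 2 ≤ d) {c : ℝ}
    (hc : Tendsto (fun n : ℕ => meanEntropy F n / n) atTop (𝓝 c)) {k : ℕ} (hk : 1 ≤ k)
    (hpos : 0 < meanEntropy F k) : 0 < c := by
  obtain ⟨S, hS, h⟩ := (isScaleKernel_occupancy hd).exists_pos_le
    (g := fun n => meanEntropy F n / n)
    (fun n => div_nonneg (meanEntropy_nonneg n) (Nat.cast_nonneg _))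
    (fun n _ => by
      have h1 := mean_div_sub_eq (F := F) hd n
      have h2 := div_nonneg (integral_rootTerm_nonneg (F := F) hd n) (Nat.cast_nonneg (α := ℝ) n)
      linarith) hk (div_pos hpos (by exact_mod_cast hk))
  refine hS.trans_le (ge_of_tendsto hc ?_)
  filter_upwards [eventually_gt_atTop (2 * k)] with n hn using h n hn

end
end RandomPermuton

namespace RandomPermuton
noncomputable section

/-! ### Interpolation between powers -/

lemma le_add_mul_log {H : ℕ → ℝ} (hH : ∀ n, H n ≤ H (n + 1) + Real.log (n + 1)) {m n : ℕ}
    (hmn : m ≤ n) : H m ≤ H n + (n - m) * Real.log n := by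
  induction n, hmn using Nat.le_induction with
  | base => simp
  | succ n hmn ih =>
    have h0 : (0 : ℝ) ≤ n - m := sub_nonneg.2 (by exact_mod_cast hmn)
    have h1 : Real.log n ≤ Real.log (n + 1) := by
      rcases Nat.eq_zero_or_pos n with rfl | hn
      · simp
      · exact Real.log_le_log (by positivity) (by linarith)
    have h2 := mul_le_mul_of_nonneg_left h1 h0
    have h3 := hH n
    push_cast
    linarith

lemma tendsto_succ_div : Tendsto (fun j : ℕ => ((j : ℝ) + 1) / j) atTop (𝓝 1) := by
  have h1 : Tendsto (fun j : ℕ => 1 + 1 / (j : ℝ)) atTop (𝓝 (1 + 0)) :=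
    tendsto_const_nhds.add tendsto_one_div_atTop_nhds_zero_nat
  rw [add_zero] at h1
  refine h1.congr' ?_
  filter_upwards [eventually_gt_atTop 0] with j hj
  have : (j : ℝ) ≠ 0 := by positivity
  field_simp

lemma tendsto_log_add_one_div :
    Tendsto (fun j : ℕ => Real.log ((j : ℝ) + 1) / ((j : ℝ) + 1)) atTop (𝓝 0) := by
  have h1 := Real.isLittleO_log_id_atTop.tendsto_div_nhds_zero
  exact h1.comp (tendsto_atTop_add_const_right _ 1 tendsto_natCast_atTop_atTop)

/-- Bernoulli's inequality bounds the relative gap between consecutive `p`-th powers by `p / (j +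
1)`, and the logarithm equals `p * log (j + 1)`. -/
lemma tendsto_gap_mul_log {p : ℕ} : Tendsto (fun j : ℕ =>
    (((j : ℝ) + 1) ^ p - (j : ℝ) ^ p) * Real.log (((j : ℝ) + 1) ^ p) / ((j : ℝ) + 1) ^ p)
    atTop (𝓝 0) := by
  have h1 := tendsto_log_add_one_div.const_mul ((p : ℝ) ^ 2)
  rw [mul_zero] at h1
  refine squeeze_zero (fun j => ?_) (fun j => ?_) h1
  · have : (j : ℝ) ^ p ≤ ((j : ℝ) + 1) ^ p := pow_le_pow_left₀ (by positivity) (by linarith) p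
    exact div_nonneg (mul_nonneg (by linarith) (Real.log_nonneg
      (one_le_pow₀ (by linarith [Nat.cast_nonneg (α := ℝ) j])))) (by positivity)
  · have hj : (0 : ℝ) < (j : ℝ) + 1 := by positivity
    have hb := one_add_mul_le_pow (a := -(1 / ((j : ℝ) + 1))) (by
      have : 1 / ((j : ℝ) + 1) ≤ 1 := by
        rw [div_le_one hj]; linarith [Nat.cast_nonneg (α := ℝ) j]
      linarith) p
    have e : 1 + -(1 / ((j : ℝ) + 1)) = j / (j + 1) := by field_simp; ring
    rw [e, div_pow] at hb
    have hl : 0 ≤ Real.log ((j : ℝ) + 1) := Real.log_nonneg (by linarith [Nat.cast_nonneg (α := ℝ) j])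
    have h2 : (((j : ℝ) + 1) ^ p - (j : ℝ) ^ p) / ((j : ℝ) + 1) ^ p ≤ p * (1 / ((j : ℝ) + 1)) := by
      rw [sub_div, div_self (by positivity)]
      linarith
    rw [Real.log_pow, mul_div_right_comm]
    calc _ ≤ p * (1 / ((j : ℝ) + 1)) * (p * Real.log ((j : ℝ) + 1)) :=
          mul_le_mul_of_nonneg_right h2 (by positivity)
      _ = _ := by ring

/-- If `H` is almost increasing and `H n / n` converges along the `p`-th powers, then it
converges. -/
lemma tendsto_div_of_tendsto_pow {H : ℕ → ℝ} (hH : ∀ n, H n ≤ H (n + 1) + Real.log (n + 1))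
    {p : ℕ} (hp : 1 ≤ p) {c : ℝ}
    (h : Tendsto (fun j : ℕ => H (j ^ p) / ((j ^ p : ℕ) : ℝ)) atTop (𝓝 c)) :
    Tendsto (fun n : ℕ => H n / n) atTop (𝓝 c) := by
  -- The integer `p`-th root: `n` lies between `r n ^ p` and `(r n + 1) ^ p`, whose ratio tends to
  -- `1`. Almost monotonicity compares `H n` with the values at both ends.
  set r : ℕ → ℕ := fun n => ⌊(n : ℝ) ^ ((p : ℝ)⁻¹)⌋₊ with hr
  have hp0 : (p : ℝ) ≠ 0 := by positivity
  have hrt : Tendsto r atTop atTop := tendsto_nat_floor_atTop.comp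
    ((tendsto_rpow_atTop (by positivity)).comp tendsto_natCast_atTop_atTop)
  have hroot : ∀ n : ℕ, ((n : ℝ) ^ ((p : ℝ)⁻¹)) ^ p = n := fun n =>
    Real.rpow_inv_natCast_pow (by positivity) (by omega)
  have hr1 : ∀ n : ℕ, (r n : ℝ) ^ p ≤ n := fun n => by
    rw [← hroot n]
    exact pow_le_pow_left₀ (by positivity) (Nat.floor_le (by positivity)) p
  have hr2 : ∀ n : ℕ, (n : ℝ) ≤ ((r n : ℝ) + 1) ^ p := fun n => by
    nth_rw 1 [← hroot n]
    exact pow_le_pow_left₀ (by positivity) (Nat.lt_floor_add_one _).le p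
  have hratio : Tendsto (fun n => (((r n : ℝ) + 1) / r n) ^ p) atTop (𝓝 1) := by
    simpa using (tendsto_succ_div.comp hrt).pow p
  have hup : Tendsto (fun n : ℕ => ((r n : ℝ) + 1) ^ p / n) atTop (𝓝 1) := by
    refine tendsto_of_tendsto_of_tendsto_of_le_of_le' tendsto_const_nhds hratio ?_ ?_
    · filter_upwards [eventually_gt_atTop 0] with n hn
      rw [one_le_div (by exact_mod_cast hn)]
      exact hr2 n
    · filter_upwards [hrt.eventually_gt_atTop 0] with n hn
      rw [div_pow]
      exact div_le_div_of_nonneg_left (by positivity) (by positivity) (hr1 n)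
  have hlow : Tendsto (fun n : ℕ => (r n : ℝ) ^ p / n) atTop (𝓝 1) := by
    have h1 := hup.mul (hratio.inv₀ one_ne_zero)
    rw [inv_one, mul_one] at h1
    refine h1.congr' ?_
    filter_upwards [hrt.eventually_gt_atTop 0] with n hn
    have : (r n : ℝ) ≠ 0 := by positivity
    rw [div_pow]
    field_simp
  have herr := (tendsto_gap_mul_log (p := p)).comp hrt
  have hA := h.comp hrt
  have hB := h.comp ((tendsto_add_atTop_nat 1).comp hrt)
  simp only [Function.comp_def] at herr hA hB
  have hL := (hA.mul hlow).sub (herr.mul hup)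
  have hU := (hB.add herr).mul hup
  simp only [mul_one, sub_zero, add_zero] at hL hU
  refine tendsto_of_tendsto_of_tendsto_of_le_of_le' hL hU ?_ ?_
  · filter_upwards [hrt.eventually_gt_atTop 0, eventually_gt_atTop 0] with n hn hn0
    have hn' : (0 : ℝ) < n := by exact_mod_cast hn0
    have hrn : (0 : ℝ) < r n := by exact_mod_cast hn
    have h1 := le_add_mul_log hH (m := r n ^ p) (n := n) (by exact_mod_cast hr1 n)
    have h2 : ((n : ℝ) - (r n : ℝ) ^ p) * Real.log n ≤
        (((r n : ℝ) + 1) ^ p - (r n : ℝ) ^ p) * Real.log (((r n : ℝ) + 1) ^ p) :=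
      mul_le_mul (by linarith [hr2 n]) (Real.log_le_log hn' (hr2 n))
        (Real.log_nonneg (by exact_mod_cast hn0)) (by linarith [hr1 n, hr2 n])
    push_cast at h1 ⊢
    have e : H (r n ^ p) / (r n : ℝ) ^ p * ((r n : ℝ) ^ p / n) -
        (((r n : ℝ) + 1) ^ p - (r n : ℝ) ^ p) * Real.log (((r n : ℝ) + 1) ^ p) /
          ((r n : ℝ) + 1) ^ p * (((r n : ℝ) + 1) ^ p / n) =
        (H (r n ^ p) -
          (((r n : ℝ) + 1) ^ p - (r n : ℝ) ^ p) * Real.log (((r n : ℝ) + 1) ^ p)) / n := by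
      field_simp
    rw [e]
    exact div_le_div_of_nonneg_right (by linarith) hn'.le
  · filter_upwards [hrt.eventually_gt_atTop 0, eventually_gt_atTop 0] with n hn hn0
    have hn' : (0 : ℝ) < n := by exact_mod_cast hn0
    have hrn : (0 : ℝ) < r n := by exact_mod_cast hn
    have h1 := le_add_mul_log hH (m := n) (n := (r n + 1) ^ p) (by exact_mod_cast hr2 n)
    have h2 : (((r n : ℝ) + 1) ^ p - n) * Real.log (((r n : ℝ) + 1) ^ p) ≤
        (((r n : ℝ) + 1) ^ p - (r n : ℝ) ^ p) * Real.log (((r n : ℝ) + 1) ^ p) :=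
      mul_le_mul_of_nonneg_right (by linarith [hr1 n])
        (Real.log_nonneg (one_le_pow₀ (by linarith)))
    push_cast at h1 ⊢
    have e : (H ((r n + 1) ^ p) / ((r n : ℝ) + 1) ^ p +
        (((r n : ℝ) + 1) ^ p - (r n : ℝ) ^ p) * Real.log (((r n : ℝ) + 1) ^ p) /
          ((r n : ℝ) + 1) ^ p) * (((r n : ℝ) + 1) ^ p / n) =
        (H ((r n + 1) ^ p) +
          (((r n : ℝ) + 1) ^ p - (r n : ℝ) ^ p) * Real.log (((r n : ℝ) + 1) ^ p)) / n := by
      field_simp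
    rw [e]
    exact div_le_div_of_nonneg_right (by linarith) hn'.le

end
end RandomPermuton

namespace RandomPermuton
noncomputable section

variable {d : ℕ} {F : Measure (Equiv.Perm (Fin d))} [IsProbabilityMeasure F]

/-! ### Spreading over the children of the root -/

/-- The sum over the children of the root of the binomially thinned values of `u`. -/
def spread (u : Sample d → ℕ → ℝ) (ω : Sample d) (n : ℕ) : ℝ :=
  ∑ i, thin (weights ω [] i) (u (subtree i ω)) n

lemma spread_add (u v : Sample d → ℕ → ℝ) (ω : Sample d) (n : ℕ) :
    spread (fun ω n => u ω n + v ω n) ω n = spread u ω n + spread v ω n := by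
  simp only [spread, thin_add, Finset.sum_add_distrib]

lemma measurable_thin_subtree (i : Fin d) {u : Sample d → ℕ → ℝ}
    (hu : ∀ k, Measurable fun ω => u ω k) (n : ℕ) :
    Measurable fun ω => thin (weights ω [] i) (u (subtree i ω)) n :=
  Finset.measurable_sum _ fun k _ => ((continuous_binom n k).measurable.comp
    (measurable_weights [] i)).mul ((hu k).comp (measurable_subtree i))

lemma abs_thin_le {p : ℝ} (h0 : 0 ≤ p) (h1 : p ≤ 1) {u : ℕ → ℝ} {n : ℕ} {B : ℝ}
    (h : ∀ k, k ≤ n → |u k| ≤ B) : |thin p u n| ≤ B := by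
  rw [abs_le]
  have h2 := thin_mono h0 h1 (u := fun _ => -B) (v := u) (n := n) fun k hk => (abs_le.1 (h k hk)).1
  have h3 := thin_mono h0 h1 (u := u) (v := fun _ => B) (n := n) fun k hk => (abs_le.1 (h k hk)).2
  rw [thin_const] at h2 h3
  exact ⟨h2, h3⟩

/-- `u` consists of bounded centered random variables, with variance at most `v * m * (m - 1)`. -/
structure IsCentered (F : Measure (Equiv.Perm (Fin d))) [IsProbabilityMeasure F] (N : ℕ) (B v : ℝ)
    (u : Sample d → ℕ → ℝ) : Prop where
  meas : ∀ m, Measurable fun ω => u ω m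
  bound : ∀ᵐ ω ∂(sampleLaw F), ∀ m, m ≤ N → |u ω m| ≤ B
  mean : ∀ m, m ≤ N → ∫ ω, u ω m ∂(sampleLaw F) = 0
  sq : ∀ m, m ≤ N → ∫ ω, u ω m ^ 2 ∂(sampleLaw F) ≤ v * (m * (m - 1))

namespace IsCentered

variable {N : ℕ} {B v : ℝ} {u : Sample d → ℕ → ℝ}

lemma integrable (hu : IsCentered F N B v u) {m : ℕ} (hm : m ≤ N) :
    Integrable (fun ω => u ω m) (sampleLaw F) :=
  Integrable.of_bound (C := B) (hu.meas m).aestronglyMeasurable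
    (by filter_upwards [hu.bound] with ω h using h m hm)

lemma integrable_sq (hu : IsCentered F N B v u) {m : ℕ} (hm : m ≤ N) :
    Integrable (fun ω => u ω m ^ 2) (sampleLaw F) := by
  refine Integrable.of_bound (C := B ^ 2) ((hu.meas m).pow_const 2).aestronglyMeasurable ?_
  filter_upwards [hu.bound] with ω h
  rw [Real.norm_of_nonneg (sq_nonneg _), ← sq_abs]
  exact pow_le_pow_left₀ (abs_nonneg _) (h m hm) 2

lemma ae_abs_thin_le (hu : IsCentered F N B v u) : ∀ᵐ ω ∂(sampleLaw F),
    ∀ i m, m ≤ N → |thin (weights ω [] i) (u (subtree i ω)) m| ≤ B := by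
  rw [ae_all_iff]
  intro i
  filter_upwards [ae_subtree i hu.bound] with ω h m hm
  exact abs_thin_le (weights_nonneg _ _ _) (weights_le_one _ _ _) fun k hk => h k (hk.trans hm)

/-- Given the root, the two subtrees are independent and `u` is centred on each of them. -/
lemma integral_mul_eq_zero (hu : IsCentered F N B v u) {m : ℕ} (hm : m ≤ N) {i j : Fin d}
    (hij : i ≠ j) : ∫ ω, thin (weights ω [] i) (u (subtree i ω)) m *
      thin (weights ω [] j) (u (subtree j ω)) m ∂(sampleLaw F) = 0 := by
  have hterm : ∀ k l, Measurable fun r : NodeSample d =>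
      binom (spacing r.2 i) m k * binom (spacing r.2 j) m l := fun k l =>
    ((continuous_binom m k).measurable.comp
      (by fun_prop : Measurable fun r : NodeSample d => spacing r.2 i)).mul
    ((continuous_binom m l).measurable.comp
      (by fun_prop : Measurable fun r : NodeSample d => spacing r.2 j))
  have e : ∀ ω : Sample d, thin (weights ω [] i) (u (subtree i ω)) m *
      thin (weights ω [] j) (u (subtree j ω)) m = ∑ k ∈ Finset.range (m + 1),
        ∑ l ∈ Finset.range (m + 1), binom (weights ω [] i) m k * binom (weights ω [] j) m l *
          (u (subtree i ω) k * u (subtree j ω) l) := by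
    intro ω
    rw [thin, thin, Finset.sum_mul_sum]
    exact Finset.sum_congr rfl fun k _ => Finset.sum_congr rfl fun l _ => by ring
  have hle : ∀ k ∈ Finset.range (m + 1), k ≤ m := fun k hk => by
    simpa [Nat.lt_succ_iff] using hk
  have hint : ∀ k ∈ Finset.range (m + 1), ∀ l ∈ Finset.range (m + 1), Integrable (fun ω =>
      binom (weights ω [] i) m k * binom (weights ω [] j) m l *
        (u (subtree i ω) k * u (subtree j ω) l)) (sampleLaw F) := by
    intro k hk l hl
    refine Integrable.of_bound (C := 1 * 1 * (B * B)) ?_ ?_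
    · exact (((hterm k l).comp (measurable_pi_apply ([] : Node d))).mul
        (((hu.meas k).comp (measurable_subtree i)).mul
          ((hu.meas l).comp (measurable_subtree j)))).aestronglyMeasurable
    · filter_upwards [ae_subtree i hu.bound, ae_subtree j hu.bound] with ω h1 h2
      have hb : ∀ a x, x ≤ m → |binom (weights ω [] a) m x| ≤ 1 := fun a x hx => by
        rw [abs_of_nonneg (binom_nonneg (weights_nonneg _ _ _) (weights_le_one _ _ _) _ _)]
        exact binom_le_one (weights_nonneg _ _ _) (weights_le_one _ _ _) hx
      have hk1 := h1 k ((hle k hk).trans hm)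
      have hl1 := h2 l ((hle l hl).trans hm)
      have hB : 0 ≤ B := (abs_nonneg _).trans hk1
      rw [Real.norm_eq_abs, abs_mul, abs_mul, abs_mul]
      exact mul_le_mul (mul_le_mul (hb i k (hle k hk)) (hb j l (hle l hl)) (abs_nonneg _)
        zero_le_one) (mul_le_mul hk1 hl1 (abs_nonneg _) hB) (by positivity) (by norm_num)
  simp only [e]
  rw [integral_finsetSum _ fun k hk => integrable_finsetSum _ fun l hl => hint k hk l hl]
  refine Finset.sum_eq_zero fun k hk => ?_
  rw [integral_finsetSum _ fun l hl => hint k hk l hl]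
  refine Finset.sum_eq_zero fun l hl => ?_
  refine (integral_root_mul_subtree_mul_subtree (F := F) hij (hterm k l) (hu.meas k)
    (hu.meas l)).trans ?_
  rw [hu.mean k ((hle k hk).trans hm), zero_mul, mul_zero]

/-- Jensen's inequality moves the square inside the thinning; there `thin_falling` reproduces `m *
(m - 1)` with the additional factor `weights ω [] i ^ 2`. -/
lemma integral_thin_sq_le (hu : IsCentered F N B v u) {m : ℕ} (hm : m ≤ N) (i : Fin d) :
    ∫ ω, thin (weights ω [] i) (u (subtree i ω)) m ^ 2 ∂(sampleLaw F) ≤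
      v * (m * (m - 1)) * ∫ ω, weights ω [] i ^ 2 ∂(sampleLaw F) := by
  have h1 : ∫ ω, thin (weights ω [] i) (u (subtree i ω)) m ^ 2 ∂(sampleLaw F) ≤
      ∫ ω, thin (weights ω [] i) (fun k => u (subtree i ω) k ^ 2) m ∂(sampleLaw F) := by
    refine integral_mono_of_nonneg (Eventually.of_forall fun ω => sq_nonneg _)
      (integrable_thin_subtree i m (u := fun ω k => u ω k ^ 2) fun k hk =>
        hu.integrable_sq (hk.trans hm)) (Eventually.of_forall fun ω => ?_)
    exact thin_sq_le (weights_nonneg _ _ _) (weights_le_one _ _ _) _ _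
  refine h1.trans ?_
  rw [integral_thin_subtree i m (u := fun ω k => u ω k ^ 2) (fun k => (hu.meas k).pow_const 2)
    fun k hk => hu.integrable_sq (hk.trans hm), ← integral_const_mul]
  refine integral_mono_ae ?_ ?_ (Eventually.of_forall fun ω => ?_)
  · exact integrable_thin_subtree i m (u := fun _ k => ∫ ω, u ω k ^ 2 ∂(sampleLaw F))
      fun k _ => integrable_const _
  · refine Integrable.of_bound (C := |v * (m * (m - 1))|) (by fun_prop)
      (Eventually.of_forall fun ω => ?_)
    rw [Real.norm_eq_abs, abs_mul, abs_of_nonneg (sq_nonneg (weights ω [] i))]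
    exact mul_le_of_le_one_right (abs_nonneg _)
      (pow_le_one₀ (weights_nonneg _ _ _) (weights_le_one _ _ _))
  · refine (thin_mono (weights_nonneg ω _ _) (weights_le_one ω _ _)
      fun k hk => hu.sq k (hk.trans hm)).trans ?_
    rw [thin_const_mul, thin_falling]
    exact le_of_eq (by ring)

/-- By orthogonality only the diagonal terms survive, and the mean squared weights add up to `2 / (d
+ 1)`. The uniform bound grows by a factor `d`, which is harmless because it only ensures
integrability. The range `N` is kept since thinning never increases the sample size. -/
lemma spread (hd : 2 ≤ d) (hu : IsCentered F N B v u) :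
    IsCentered F N (d * B) (v * (2 / (d + 1))) (spread u) where
  meas m := Finset.measurable_sum _ fun i _ => measurable_thin_subtree i hu.meas m
  bound := by
    filter_upwards [hu.ae_abs_thin_le] with ω h m hm
    refine (Finset.abs_sum_le_sum_abs _ _).trans ?_
    refine (Finset.sum_le_card_nsmul _ _ B fun i _ => h i m hm).trans ?_
    simp
  mean m hm := by
    simp only [RandomPermuton.spread]
    rw [integral_finsetSum _ fun i _ => integrable_thin_subtree i m fun k hk =>
      hu.integrable (hk.trans hm)]
    refine Finset.sum_eq_zero fun i _ => ?_
    rw [integral_thin_subtree i m hu.meas fun k hk => hu.integrable (hk.trans hm)]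
    refine integral_eq_zero_of_ae (Eventually.of_forall fun ω => ?_)
    refine Finset.sum_eq_zero fun k hk => ?_
    have hk' : k ≤ m := by simpa [Nat.lt_succ_iff] using hk
    simp only [hu.mean k (hk'.trans hm), mul_zero]
  sq m hm := by
    simp only [RandomPermuton.spread, pow_two (∑ i, _), Finset.sum_mul_sum]
    have hint : ∀ i j, Integrable (fun ω => thin (weights ω [] i) (u (subtree i ω)) m *
        thin (weights ω [] j) (u (subtree j ω)) m) (sampleLaw F) := by
      intro i j
      refine Integrable.of_bound (C := B * B) ((measurable_thin_subtree i hu.meas m).mul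
        (measurable_thin_subtree j hu.meas m)).aestronglyMeasurable ?_
      filter_upwards [hu.ae_abs_thin_le] with ω h
      rw [Real.norm_eq_abs, abs_mul]
      exact mul_le_mul (h i m hm) (h j m hm) (abs_nonneg _) ((abs_nonneg _).trans (h i m hm))
    rw [integral_finsetSum _ fun i _ => integrable_finsetSum _ fun j _ => hint i j]
    have h1 : ∀ i : Fin d, ∫ ω, ∑ j, thin (weights ω [] i) (u (subtree i ω)) m *
        thin (weights ω [] j) (u (subtree j ω)) m ∂(sampleLaw F) ≤
          v * (m * (m - 1)) * ∫ ω, weights ω [] i ^ 2 ∂(sampleLaw F) := by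
      intro i
      rw [integral_finsetSum _ fun j _ => hint i j, Finset.sum_eq_single i
        (fun j _ hj => hu.integral_mul_eq_zero hm hj.symm) (by simp)]
      simp only [← pow_two]
      exact hu.integral_thin_sq_le hm i
    refine (Finset.sum_le_sum fun i _ => h1 i).trans (le_of_eq ?_)
    rw [← Finset.mul_sum, sum_integral_weights_sq hd]
    ring

lemma iterate (hd : 2 ≤ d) (hu : IsCentered F N B v u) (k : ℕ) :
    IsCentered F N (d ^ k * B) (v * (2 / (d + 1)) ^ k) (RandomPermuton.spread^[k] u) := by
  induction k with
  | zero => simpa using hu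
  | succ k ih =>
    rw [Function.iterate_succ_apply']
    have := ih.spread hd
    rwa [← mul_assoc, ← pow_succ', mul_assoc, ← pow_succ] at this

end IsCentered

/-- The deviation of the sampling entropy from its mean. -/
def deviation (F : Measure (Equiv.Perm (Fin d))) [IsProbabilityMeasure F] (ω : Sample d) (n : ℕ) :
    ℝ := sampleEntropy ω n - meanEntropy F n

/-- The entropy and its mean both lie between `0` and `(m - 1) * log m`, so their difference has
square at most `(m - 1) ^ 2 * log N ^ 2 ≤ m * (m - 1) * log N ^ 2`. -/
lemma isCentered_deviation (hd : 2 ≤ d) (N : ℕ) :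
    IsCentered F N (N * Real.log N) (Real.log N ^ 2) (deviation F) := by
  have hlog : ∀ m : ℕ, 1 ≤ m → m ≤ N → Real.log m ≤ Real.log N := fun m hm hN =>
    Real.log_le_log (by exact_mod_cast hm) (by exact_mod_cast hN)
  have hae : ∀ᵐ ω ∂(sampleLaw F), ∀ m : ℕ, 1 ≤ m → m ≤ N →
      |deviation F ω m| ≤ (m - 1) * Real.log N := by
    filter_upwards [ae_sampleEntropy_le hd] with ω h m hm hN
    have h1 := h m hm
    have h2 := meanEntropy_le (F := F) hd hm
    have h3 := sampleEntropy_nonneg ω m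
    have h4 := meanEntropy_nonneg (F := F) m
    have h5 : ((m : ℝ) - 1) * Real.log m ≤ (m - 1) * Real.log N :=
      mul_le_mul_of_nonneg_left (hlog m hm hN) (sub_nonneg.2 (by exact_mod_cast hm))
    rw [deviation, abs_le]
    constructor <;> linarith
  have hzero : ∀ ω, deviation F ω 0 = 0 := fun ω => by
    rw [deviation, sampleEntropy_zero, meanEntropy_zero, sub_zero]
  refine ⟨fun m => (measurable_sampleEntropy m).sub_const _, ?_, fun m _ => ?_, fun m hN => ?_⟩
  · filter_upwards [hae] with ω h m hN
    rcases Nat.eq_zero_or_pos m with rfl | hm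
    · rw [hzero, abs_zero]
      exact mul_nonneg (Nat.cast_nonneg _) (Real.log_natCast_nonneg _)
    · refine (h m hm hN).trans (mul_le_mul_of_nonneg_right ?_ (Real.log_natCast_nonneg _))
      have : (m : ℝ) ≤ N := by exact_mod_cast hN
      linarith
  · simp only [deviation]
    rw [integral_sub (integrable_sampleEntropy hd m) (integrable_const _), integral_const,
      probReal_univ, one_smul, meanEntropy, sub_self]
  · rcases Nat.eq_zero_or_pos m with rfl | hm
    · simp [hzero]
    have h1 : ∀ᵐ ω ∂(sampleLaw F), deviation F ω m ^ 2 ≤ Real.log N ^ 2 * (m * (m - 1)) := by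
      filter_upwards [hae] with ω h
      have h2 := pow_le_pow_left₀ (abs_nonneg _) (h m hm hN) 2
      rw [sq_abs, mul_pow] at h2
      have hm' : (1 : ℝ) ≤ m := by exact_mod_cast hm
      have h3 : ((m : ℝ) - 1) ^ 2 ≤ m * (m - 1) := by nlinarith
      nlinarith [mul_le_mul_of_nonneg_right h3 (sq_nonneg (Real.log N))]
    refine (integral_mono_of_nonneg (Eventually.of_forall fun ω => sq_nonneg _)
      (integrable_const _) h1).trans ?_
    rw [integral_const, probReal_univ, one_smul]

end
end RandomPermuton

namespace RandomPermuton
noncomputable section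

variable {d : ℕ} {F : Measure (Equiv.Perm (Fin d))} [IsProbabilityMeasure F]

/-! ### Almost sure convergence -/

lemma sampleEntropy_eq_spread (ω : Sample d) (n : ℕ) :
    sampleEntropy ω n = spread sampleEntropy ω n + rootTerm ω n := by
  rw [rootTerm, spread]; ring

/-- The contribution to the sampling entropy of the nodes of level less than `k`. -/
def topTerm : ℕ → Sample d → ℕ → ℝ
  | 0, _, _ => 0
  | k + 1, ω, n => spread (topTerm k) ω n + rootTerm ω n

/-- The recursion unrolled over `k` levels. The entropies at level `k` are split into fluctuation
and mean, and the root terms of the levels above are collected. -/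
lemma sampleEntropy_eq (k : ℕ) (ω : Sample d) (n : ℕ) : sampleEntropy ω n =
    spread^[k] (deviation F) ω n + spread^[k] (fun _ => meanEntropy F) ω n + topTerm k ω n := by
  induction k generalizing ω n with
  | zero => simp [deviation, topTerm]
  | succ k ih =>
    have e : sampleEntropy (d := d) = fun ω n => (spread^[k] (deviation F) ω n +
        spread^[k] (fun _ => meanEntropy F) ω n) + topTerm k ω n := by
      funext ω n; exact ih ω n
    rw [sampleEntropy_eq_spread, e, spread_add, spread_add, Function.iterate_succ_apply',
      Function.iterate_succ_apply', topTerm]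
    ring

lemma spread_mono {u v : Sample d → ℕ → ℝ} {ω : Sample d}
    (h : ∀ i k, u (subtree i ω) k ≤ v (subtree i ω) k) (n : ℕ) : spread u ω n ≤ spread v ω n :=
  Finset.sum_le_sum fun i _ => thin_mono (weights_nonneg _ _ _) (weights_le_one _ _ _)
    fun k _ => h i k

lemma spread_affine (hd : 1 ≤ d) (a b : ℝ) (ω : Sample d) (n : ℕ) :
    spread (fun _ k => a * k + b) ω n = a * n + d * b := by
  have h1 : ∑ i, weights ω [] i = 1 := sum_spacing hd _
  simp only [spread, thin_add, thin_const, thin_const_mul, thin_cast, Finset.sum_add_distrib,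
    ← Finset.mul_sum, h1]
  simp

/-- The weights add up to `1`, so spreading preserves a linear function, while an additive constant
is multiplied by `d` at each level. -/
lemma abs_iterate_sub_le (hd : 1 ≤ d) {u : ℕ → ℝ} {c δ K : ℝ}
    (h : ∀ n : ℕ, |u n - c * n| ≤ δ * n + K) (k : ℕ) (ω : Sample d) (n : ℕ) :
    |spread^[k] (fun _ => u) ω n - c * n| ≤ δ * n + d ^ k * K := by
  have key : ∀ (ω : Sample d) (n : ℕ), spread^[k] (fun _ => u) ω n ≤ (c + δ) * n + d ^ k * K ∧
      (c - δ) * n + -(d ^ k * K) ≤ spread^[k] (fun _ => u) ω n := by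
    induction k with
    | zero =>
      intro ω n
      have := abs_le.1 (h n)
      simp only [Function.iterate_zero, id]
      constructor <;> linarith
    | succ k ih =>
      intro ω n
      rw [Function.iterate_succ_apply']
      have h1 := spread_mono (ω := ω) (u := spread^[k] (fun _ => u))
        (v := fun _ m => (c + δ) * m + d ^ k * K) (fun i m => (ih _ m).1) n
      have h2 := spread_mono (ω := ω) (v := spread^[k] (fun _ => u))
        (u := fun _ m => (c - δ) * m + -(d ^ k * K)) (fun i m => (ih _ m).2) n
      rw [spread_affine hd] at h1 h2
      rw [pow_succ']
      constructor <;> linarith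
  have := key ω n
  rw [abs_le]
  constructor <;> linarith

/-- There are `1 + d + … + d ^ (k - 1) ≤ d ^ k - 1` nodes above level `k`, each contributing at most
`d * log (n + 1)`; the inequality uses `2 ≤ d`. -/
lemma ae_topTerm (hd : 2 ≤ d) (k : ℕ) : ∀ᵐ ω ∂(sampleLaw F), ∀ n, 0 ≤ topTerm k ω n ∧
    topTerm k ω n ≤ (d ^ k - 1) * (d * Real.log (n + 1)) := by
  induction k with
  | zero => simp [topTerm]
  | succ k ih =>
    have h2 : ∀ᵐ ω ∂(sampleLaw F), ∀ i : Fin d, ∀ n, 0 ≤ topTerm k (subtree i ω) n ∧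
        topTerm k (subtree i ω) n ≤ (d ^ k - 1) * (d * Real.log (n + 1)) := by
      rw [ae_all_iff]
      exact fun i => ae_subtree i ih
    filter_upwards [h2, ae_rootTerm hd] with ω h2 h3 n
    have hd' : (2 : ℝ) ≤ d := by exact_mod_cast hd
    have hL : 0 ≤ d * Real.log ((n : ℝ) + 1) :=
      mul_nonneg (by linarith) (Real.log_nonneg (by linarith [Nat.cast_nonneg (α := ℝ) n]))
    have hpow : (1 : ℝ) ≤ (d : ℝ) ^ k := one_le_pow₀ (by linarith)
    have h4 : 0 ≤ spread (topTerm k) ω n := Finset.sum_nonneg fun i _ =>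
      thin_nonneg (weights_nonneg _ _ _) (weights_le_one _ _ _) fun m _ => (h2 i m).1
    have h5 : spread (topTerm k) ω n ≤ ∑ i : Fin d, (d ^ k - 1) * (d * Real.log (n + 1)) := by
      refine Finset.sum_le_sum fun i _ => ?_
      refine (thin_mono (weights_nonneg _ _ _) (weights_le_one _ _ _)
        (v := fun _ => (d ^ k - 1) * (d * Real.log (n + 1))) fun m hm => (h2 i m).2.trans ?_).trans
        (le_of_eq (thin_const _ _ _))
      have : (m : ℝ) ≤ n := by exact_mod_cast hm
      have h6 : Real.log ((m : ℝ) + 1) ≤ Real.log (n + 1) :=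
        Real.log_le_log (by positivity) (by linarith)
      exact mul_le_mul_of_nonneg_left (mul_le_mul_of_nonneg_left h6 (by linarith)) (by linarith)
    rw [Finset.sum_const, Finset.card_univ, Fintype.card_fin, nsmul_eq_mul] at h5
    rw [topTerm, pow_succ']
    refine ⟨add_nonneg h4 (h3 n).1, ?_⟩
    have h7 := (h3 n).2
    nlinarith

/-- The number of levels which are separated from the rest of the tree for samples of size `n`. -/
def depth (d n : ℕ) : ℕ := Nat.log (d ^ 2) n

/-- The base `d ^ 2` in `depth` keeps the number of separated subtrees below `√n`, so that the
accumulated logarithmic errors are `o(n)`, while the variance still decays like a power of `n`. -/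
lemma pow_depth_le {n : ℕ} (hn : 1 ≤ n) : (d : ℝ) ^ depth d n ≤ √(n : ℝ) := by
  apply Real.le_sqrt_of_sq_le
  rw [← pow_mul, mul_comm, pow_mul]
  exact_mod_cast Nat.pow_log_le_self (d ^ 2) (by omega)

lemma tendsto_inv_sqrt : Tendsto (fun n : ℕ => 1 / √(n : ℝ)) atTop (𝓝 0) :=
  tendsto_const_nhds.div_atTop (Real.tendsto_sqrt_atTop.comp tendsto_natCast_atTop_atTop)

lemma tendsto_log_div_sqrt :
    Tendsto (fun n : ℕ => Real.log ((n : ℝ) + 1) / √(n : ℝ)) atTop (𝓝 0) := by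
  have h1 := (isLittleO_log_rpow_atTop (show (0 : ℝ) < 1 / 2 by norm_num)).tendsto_div_nhds_zero
  have h2 := (h1.comp (tendsto_atTop_add_const_right _ (1 : ℝ)
    tendsto_natCast_atTop_atTop)).const_mul 2
  rw [mul_zero] at h2
  refine squeeze_zero' (Eventually.of_forall fun n => div_nonneg
    (Real.log_nonneg (by linarith [Nat.cast_nonneg (α := ℝ) n])) (Real.sqrt_nonneg _)) ?_ h2
  filter_upwards [eventually_ge_atTop 1] with n hn
  have hn' : (1 : ℝ) ≤ n := by exact_mod_cast hn
  simp only [Function.comp, ← Real.sqrt_eq_rpow]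
  have h3 : √((n : ℝ) + 1) ≤ 2 * √(n : ℝ) := by
    rw [Real.sqrt_le_left (by positivity), mul_pow, Real.sq_sqrt (by positivity)]
    linarith
  rw [← mul_div_assoc, div_le_div_iff₀ (by positivity) (by positivity)]
  have := mul_le_mul_of_nonneg_left h3 (Real.log_nonneg (by linarith : (1 : ℝ) ≤ n + 1))
  linarith

lemma exists_affine_bound {u : ℕ → ℝ} {c : ℝ} (h : Tendsto (fun n : ℕ => u n / n) atTop (𝓝 c))
    {δ : ℝ} (hδ : 0 < δ) : ∃ K, ∀ n : ℕ, |u n - c * n| ≤ δ * n + K := by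
  obtain ⟨N, hN⟩ := Metric.tendsto_atTop.1 h δ hδ
  have hs : ∀ n, 0 ≤ |u n - c * n| := fun n => abs_nonneg _
  refine ⟨∑ n ∈ Finset.range (N + 1), |u n - c * n|, fun n => ?_⟩
  rcases lt_or_ge n (N + 1) with hn | hn
  · have := Finset.single_le_sum (f := fun n : ℕ => |u n - c * n|) (fun n _ => hs n)
      (Finset.mem_range.2 hn)
    have h2 : 0 ≤ δ * n := by positivity
    linarith
  · have h1 := (hN n (by omega)).le
    have hn0 : (0 : ℝ) < n := by exact_mod_cast (by omega : 0 < n)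
    rw [Real.dist_eq] at h1
    have h2 : u n - c * n = (u n / n - c) * n := by field_simp
    have h3 := Finset.sum_nonneg (s := Finset.range (N + 1)) fun n _ => hs n
    rw [h2, abs_mul, abs_of_pos hn0]
    have := mul_le_mul_of_nonneg_right h1 hn0.le
    linarith

lemma tendsto_iterate_div (hd : 2 ≤ d) {u : ℕ → ℝ} {c : ℝ}
    (h : Tendsto (fun n : ℕ => u n / n) atTop (𝓝 c)) (ω : Sample d) :
    Tendsto (fun n : ℕ => spread^[depth d n] (fun _ => u) ω n / n) atTop (𝓝 c) := by
  rw [Metric.tendsto_atTop']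
  intro ε hε
  obtain ⟨K, hK⟩ := exists_affine_bound h (half_pos hε)
  have hK0 : 0 ≤ K := by simpa using (abs_nonneg _).trans (hK 0)
  have h1 := tendsto_inv_sqrt.const_mul K
  rw [mul_zero] at h1
  obtain ⟨N, hN⟩ := eventually_atTop.1 (h1.eventually_lt_const (half_pos hε))
  refine ⟨N, fun n hn => ?_⟩
  have hn1 : 1 ≤ n := by omega
  have hn0 : (0 : ℝ) < n := by exact_mod_cast hn1
  have h2 := abs_iterate_sub_le (by omega) hK (depth d n) ω n
  have h3 := mul_le_mul_of_nonneg_right (pow_depth_le (d := d) hn1) hK0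
  have h4 := hN n hn.le
  have h5 : spread^[depth d n] (fun _ => u) ω n / n - c =
      (spread^[depth d n] (fun _ => u) ω n - c * n) / n := by field_simp
  rw [Real.dist_eq, h5, abs_div, abs_of_pos hn0, div_lt_iff₀ hn0]
  have h6 : √(n : ℝ) * √(n : ℝ) = n := Real.mul_self_sqrt hn0.le
  have h7 : K * √(n : ℝ) = K * (1 / √(n : ℝ)) * n := by
    nth_rw 3 [← h6]
    field_simp
  have h8 := mul_lt_mul_of_pos_right h4 hn0
  linarith

lemma ae_tendsto_topTerm (hd : 2 ≤ d) : ∀ᵐ ω ∂(sampleLaw F),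
    Tendsto (fun n : ℕ => topTerm (depth d n) ω n / n) atTop (𝓝 0) := by
  filter_upwards [ae_all_iff.2 fun k => ae_topTerm (F := F) hd k] with ω h
  have h1 := tendsto_log_div_sqrt.const_mul (d : ℝ)
  rw [mul_zero] at h1
  refine squeeze_zero (fun n => div_nonneg (h _ n).1 (Nat.cast_nonneg n)) (fun n => ?_) h1
  rcases Nat.eq_zero_or_pos n with rfl | hn
  · simp
  have hn0 : (0 : ℝ) < n := by exact_mod_cast hn
  have hL : 0 ≤ d * Real.log ((n : ℝ) + 1) :=
    mul_nonneg (by positivity) (Real.log_nonneg (by linarith))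
  have h2 := (h (depth d n) n).2
  have h3 := mul_le_mul_of_nonneg_right (pow_depth_le (d := d) hn) hL
  rw [div_le_iff₀ hn0]
  calc topTerm (depth d n) ω n ≤ √(n : ℝ) * (d * Real.log ((n : ℝ) + 1)) := by linarith
    _ = d * (Real.log ((n : ℝ) + 1) / √(n : ℝ)) * (√(n : ℝ) * √(n : ℝ)) := by field_simp
    _ = _ := by rw [Real.mul_self_sqrt hn0.le]

/-- The exponent `q` converts geometric decay in the depth into polynomial decay in `n`, and thereby
fixes the power `4 * q` of the subsequence. -/
lemma exists_exponent (hd : 2 ≤ d) :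
    ∃ q : ℕ, 1 ≤ q ∧ ((2 : ℝ) / (d + 1)) ^ q ≤ 1 / (d : ℝ) ^ 2 := by
  obtain ⟨q, hq⟩ := exists_pow_lt_of_lt_one (show (0 : ℝ) < 1 / (d : ℝ) ^ 2 by positivity)
    (two_div_lt_one hd)
  refine ⟨q + 1, by omega, ?_⟩
  rw [pow_succ]
  exact (mul_le_of_le_one_right (by positivity) (two_div_lt_one hd).le).trans hq.le

/-- With `n = j ^ (4 * q)` and `n < (d ^ 2) ^ (depth d n + 1)`, the `q`-th power of the left side is
at most `1 / n`, which is the `q`-th power of `1 / j ^ 4`. -/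
lemma pow_depth_succ_le (hd : 2 ≤ d) {q : ℕ} (hq : 1 ≤ q)
    (h : ((2 : ℝ) / (d + 1)) ^ q ≤ 1 / (d : ℝ) ^ 2) {j : ℕ} (hj : 1 ≤ j) :
    ((2 : ℝ) / (d + 1)) ^ (depth d (j ^ (4 * q)) + 1) ≤ 1 / (j : ℝ) ^ 4 := by
  have hj0 : (0 : ℝ) < j := by exact_mod_cast hj
  refine le_of_pow_le_pow_left₀ (n := q) (by omega) (by positivity) ?_
  have h1 : ((j ^ (4 * q) : ℕ) : ℝ) ≤ ((d : ℝ) ^ 2) ^ (depth d (j ^ (4 * q)) + 1) := by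
    exact_mod_cast (Nat.lt_pow_succ_log_self (b := d ^ 2) (by nlinarith) (j ^ (4 * q))).le
  calc _ = (((2 : ℝ) / (d + 1)) ^ q) ^ (depth d (j ^ (4 * q)) + 1) := by
        rw [← pow_mul, ← pow_mul, mul_comm]
    _ ≤ (1 / (d : ℝ) ^ 2) ^ (depth d (j ^ (4 * q)) + 1) := pow_le_pow_left₀ (by positivity) h _
    _ = 1 / ((d : ℝ) ^ 2) ^ (depth d (j ^ (4 * q)) + 1) := by rw [div_pow, one_pow]
    _ ≤ 1 / ((j ^ (4 * q) : ℕ) : ℝ) :=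
        one_div_le_one_div_of_le (by push_cast; positivity) h1
    _ = _ := by rw [div_pow, one_pow, ← pow_mul]; push_cast; rfl

lemma integral_sq_deviation_div_le (hd : 2 ≤ d) (n k : ℕ) :
    Integrable (fun ω => (spread^[k] (deviation F) ω n / n) ^ 2) (sampleLaw F) ∧
    ∫ ω, (spread^[k] (deviation F) ω n / n) ^ 2 ∂(sampleLaw F) ≤
      Real.log n ^ 2 * (2 / (d + 1)) ^ k := by
  have hc := (isCentered_deviation (F := F) hd n).iterate hd k
  simp only [div_pow]
  refine ⟨(hc.integrable_sq le_rfl).div_const _, ?_⟩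
  rw [integral_div]
  rcases Nat.eq_zero_or_pos n with rfl | hn
  · simp
  have hn0 : (0 : ℝ) < n := by exact_mod_cast hn
  rw [div_le_iff₀ (by positivity)]
  have h1 : (n : ℝ) * (n - 1) ≤ (n : ℝ) ^ 2 := by nlinarith
  rw [← div_pow (2 : ℝ)]
  exact (hc.sq n le_rfl).trans (mul_le_mul_of_nonneg_left h1
    (by positivity : 0 ≤ Real.log n ^ 2 * ((2 : ℝ) / (d + 1)) ^ k))

lemma ae_tendsto_deviation (hd : 2 ≤ d) {q : ℕ} (hq : 1 ≤ q)
    (h : ((2 : ℝ) / (d + 1)) ^ q ≤ 1 / (d : ℝ) ^ 2) : ∀ᵐ ω ∂(sampleLaw F),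
    Tendsto (fun j : ℕ => spread^[depth d (j ^ (4 * q))] (deviation F) ω (j ^ (4 * q)) /
      ((j ^ (4 * q) : ℕ) : ℝ)) atTop (𝓝 0) := by
  set ρ : ℝ := 2 / (d + 1) with hρ
  have hρ0 : 0 < ρ := by positivity
  -- The second moments are at most `(log n) ^ 2 * ρ ^ depth`. Here `log n ≤ 4 * q * j` and `ρ ^
  -- depth ≤ 1 / (ρ * j ^ 4)`, where the factor `1 / ρ` compensates for the `+ 1` in
  -- `pow_depth_succ_le`; the product is of order `1 / j ^ 2`.
  have hX := ae_tendsto_zero_of_summable (P := sampleLaw F)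
    (X := fun j ω => (spread^[depth d (j ^ (4 * q))] (deviation F) ω (j ^ (4 * q)) /
      ((j ^ (4 * q) : ℕ) : ℝ)) ^ 2) (a := fun j => 16 * q ^ 2 / ρ * (1 / (j : ℝ) ^ 2))
    (fun _ _ => sq_nonneg _) (fun j => (integral_sq_deviation_div_le hd _ _).1)
    ((Real.summable_one_div_nat_pow.2 (by norm_num)).mul_left _) fun j => ?_
  · filter_upwards [hX] with ω hω
    have h1 := (Real.continuous_sqrt.tendsto 0).comp hω
    simp only [Function.comp_def, Real.sqrt_sq_eq_abs, Real.sqrt_zero] at h1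
    exact (tendsto_zero_iff_abs_tendsto_zero _).2 h1
  · refine (integral_sq_deviation_div_le hd _ _).2.trans ?_
    rcases Nat.eq_zero_or_pos j with rfl | hj
    · simp [show q ≠ 0 by omega]
    have hj0 : (0 : ℝ) < j := by exact_mod_cast hj
    have h1 := pow_depth_succ_le hd hq h hj
    rw [← hρ, pow_succ] at h1
    have h2 : ρ ^ depth d (j ^ (4 * q)) ≤ 1 / (j : ℝ) ^ 4 / ρ := by
      rwa [le_div_iff₀ hρ0]
    have h3 : Real.log ((j ^ (4 * q) : ℕ) : ℝ) ^ 2 ≤ (4 * q * j) ^ 2 := by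
      refine pow_le_pow_left₀ (Real.log_natCast_nonneg _) ?_ 2
      push_cast
      rw [Real.log_pow]
      push_cast
      exact mul_le_mul_of_nonneg_left (Real.log_le_self hj0.le) (by positivity)
    calc _ ≤ (4 * q * j) ^ 2 * (1 / (j : ℝ) ^ 4 / ρ) :=
          mul_le_mul h3 h2 (by positivity) (by positivity)
      _ = _ := by field_simp; ring

theorem ae_tendsto_sampleEntropy (hd : 2 ≤ d) {c : ℝ}
    (hc : Tendsto (fun n : ℕ => meanEntropy F n / n) atTop (𝓝 c)) : ∀ᵐ ω ∂(sampleLaw F),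
    Tendsto (fun n : ℕ => sampleEntropy ω n / n) atTop (𝓝 c) := by
  obtain ⟨q, hq, h⟩ := exists_exponent hd
  filter_upwards [ae_tendsto_deviation (F := F) hd hq h, ae_tendsto_topTerm (F := F) hd,
    ae_isPermuton hd] with ω h1 h2 h3
  refine tendsto_div_of_tendsto_pow (p := 4 * q) (fun n => samplingEntropy_le_succ h3 n) (by omega) ?_
  have hpow : Tendsto (fun j : ℕ => j ^ (4 * q)) atTop atTop := tendsto_pow_atTop (by omega)
  have h4 := (h1.add ((tendsto_iterate_div hd hc ω).comp hpow)).add (h2.comp hpow)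
  rw [zero_add, add_zero] at h4
  refine h4.congr fun j => ?_
  have h5 := sampleEntropy_eq (F := F) (depth d (j ^ (4 * q))) ω (j ^ (4 * q))
  simp only [Function.comp]
  rw [← add_div, ← add_div, ← h5]

end
end RandomPermuton

namespace RandomPermuton
noncomputable section

variable {d : ℕ}

/-! ### The two degenerate permutons -/

lemma samplingEntropy_eq_zero {μ : Measure (ℝ × ℝ)} [IsProbabilityMeasure μ] {n : ℕ}
    {σ : Equiv.Perm (Fin n)} (h : ∀ᵐ p ∂(Measure.pi fun _ : Fin n => μ), HasPattern σ p) :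
    samplingEntropy μ n = 0 := by
  refine Finset.sum_eq_zero fun σ' _ => ?_
  by_cases hσ : σ' = σ
  · subst hσ
    have : patternDensity μ σ' = 1 := by
      rw [patternDensity, measureReal_congr (t := Set.univ), probReal_univ]
      filter_upwards [h] with p hp
      exact propext ⟨fun _ => trivial, fun _ => hp⟩
    rw [this, Real.negMulLog_one]
  · have : patternDensity μ σ' = 0 := by
      rw [patternDensity, measureReal_congr (t := ∅), measureReal_empty]
      filter_upwards [h] with p hp
      exact propext ⟨fun h' => hσ (HasPattern.unique h' hp), fun h' => h'.elim⟩
    rw [this, Real.negMulLog_zero]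

lemma Generic.exists_strictMono {n : ℕ} {p : Fin n → ℝ × ℝ} (h : Generic p) :
    ∃ e : Equiv.Perm (Fin n), StrictMono fun i => (p (e i)).1 :=
  ⟨Tuple.sort fun i => (p i).1, (Tuple.monotone_sort fun i => (p i).1).strictMono_of_injective
    (h.1.comp (Equiv.injective _))⟩

lemma samplingEntropy_eq_zero_of_graph {μ : Measure (ℝ × ℝ)} (hμ : IsPermuton μ) {φ : ℝ → ℝ}
    (h : ∀ᵐ p ∂μ, p.2 = φ p.1) {n : ℕ} {σ : Equiv.Perm (Fin n)}
    (hφ : ∀ (x : Fin n → ℝ), StrictMono x → ∀ i j, φ (x i) < φ (x j) ↔ σ i < σ j) :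
    samplingEntropy μ n = 0 := by
  have := hμ.isProbabilityMeasure
  apply samplingEntropy_eq_zero (σ := σ)
  have h1 : ∀ᵐ p ∂(Measure.pi fun _ : Fin n => μ), ∀ j, (p j).2 = φ (p j).1 := by
    rw [ae_all_iff]
    exact fun j => (measurePreserving_eval (fun _ : Fin n => μ) j).quasiMeasurePreserving.ae h
  filter_upwards [h1, ae_generic (fun _ : Fin n => μ) fun _ => hμ.diffuse] with p hp hg
  obtain ⟨e, he⟩ := hg.exists_strictMono
  refine ⟨e, he, fun i j => ?_⟩
  rw [hp, hp]
  exact hφ _ he i j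

lemma ae_treePermuton_graph {S : Node d → Equiv.Perm (Fin d)} {w : Node d → Fin d → ℝ}
    {φ : ℝ → ℝ} (hφ : Measurable φ) (h : ∀ x ∈ Set.Ico (0 : ℝ) 1, ordinate S w x = φ x) :
    ∀ᵐ p ∂(treePermuton S w), p.2 = φ p.1 := by
  have hm : Measurable fun x => (x, ordinate S w x) :=
    measurable_id.prodMk (measurable_ordinate S w)
  rw [treePermuton, ae_map_iff hm.aemeasurable
    (measurableSet_eq_fun (by fun_prop) (by fun_prop))]
  filter_upwards [ae_restrict_mem measurableSet_Ico] with x hx using h x hx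

section Weight

variable {w : Node d → Fin d → ℝ} (hw : IsWeight w)
include hw

lemma exists_mem_interval {x : ℝ} (hx : x ∈ Set.Ico (0 : ℝ) 1) (n : ℕ) :
    ∃ s : Node d, s.length = n ∧ x ∈ interval w s := by
  induction n with
  | zero => exact ⟨[], rfl, by simpa [interval, left, side] using hx⟩
  | succ n ih =>
    obtain ⟨s, rfl, hs1, hs2⟩ := ih
    have hpos : 0 < side w s := by linarith
    obtain ⟨i, hi1, hi2⟩ := exists_mem_offset (α := 1) (hw.2 s) (y := (x - left w s) / side w s)
      (div_nonneg (by linarith) hpos.le) ((div_lt_one hpos).2 (by linarith))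
    rw [le_div_iff₀ hpos] at hi1
    rw [div_lt_iff₀ hpos] at hi2
    refine ⟨i :: s, rfl, ?_, ?_⟩
    · change left w s + side w s * offset 1 (w s) i ≤ x
      linarith
    · change x < left w s + side w s * offset 1 (w s) i + side w s * w s i
      linarith

lemma ordinate_eq_of_bottom (hfine : IsFine w) {S : Node d → Equiv.Perm (Fin d)} {x y : ℝ}
    (hx : x ∈ Set.Ico (0 : ℝ) 1)
    (h : ∀ s, x ∈ interval w s → bottom S w s ≤ y ∧ y ≤ bottom S w s + side w s) :
    ordinate S w x = y := by
  refine eq_of_abs_sub_le_all fun ε hε => ?_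
  obtain ⟨n, hn⟩ := (hfine ε hε).exists
  obtain ⟨s, hs, hxs⟩ := exists_mem_interval hw hx n
  have h1 := bottom_le_ordinate hw S hxs
  have h2 := ordinate_le hw S hxs
  have h3 := hn s hs
  have h4 := h s hxs
  rw [abs_le]
  constructor <;> linarith

/-- Under reversal the siblings below the `i`-th child are those to its right, so the vertical
interval is the mirror image of the horizontal one in `[0, 1]`. -/
lemma bottom_revPerm (s : Node d) :
    bottom (fun _ => Fin.revPerm) w s = 1 - left w s - side w s := by
  induction s with
  | nil => simp [bottom, left, side]
  | cons i s ih =>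
    have h1 : ∑ j with Fin.revPerm j < Fin.revPerm i, w s j + w s i + ∑ j with j < i, w s j = 1 := by
      have h2 : w s i = ∑ j, if j = i then w s j else 0 := by simp
      rw [h2, Finset.sum_filter, Finset.sum_filter, ← Finset.sum_add_distrib,
        ← Finset.sum_add_distrib, ← hw.2 s]
      refine Finset.sum_congr rfl fun j _ => ?_
      rcases lt_trichotomy i j with hij | hij | hij
      · simp [hij, hij.ne', not_lt.2 hij.le]
      · simp [hij]
      · simp [hij, hij.ne, not_lt.2 hij.le]
    simp only [bottom, left, side]
    rw [ih]
    linear_combination side w s * h1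

lemma samplingEntropy_treePermuton_one (hfine : IsFine w) (n : ℕ) :
    samplingEntropy (treePermuton (fun _ => 1) w) n = 0 := by
  refine samplingEntropy_eq_zero_of_graph (φ := id) (σ := 1) (isPermuton_treePermuton hw hfine _)
    (ae_treePermuton_graph measurable_id fun x hx =>
      ordinate_eq_of_bottom hw hfine hx fun s hs => ?_) fun x hx i j => hx.lt_iff_lt
  rw [← left_eq_bottom]
  exact ⟨hs.1, hs.2.le⟩

lemma samplingEntropy_treePermuton_revPerm (hfine : IsFine w) (n : ℕ) :
    samplingEntropy (treePermuton (fun _ => Fin.revPerm) w) n = 0 := by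
  refine samplingEntropy_eq_zero_of_graph (φ := fun x => 1 - x) (σ := Fin.revPerm)
    (isPermuton_treePermuton hw hfine _)
    (ae_treePermuton_graph (by fun_prop) fun x hx =>
      ordinate_eq_of_bottom hw hfine hx fun s hs => ?_) fun x hx i j => ?_
  · rw [bottom_revPerm hw]
    have h1 := hs.1
    have h2 := hs.2
    constructor <;> linarith
  · rw [sub_lt_sub_iff_left, hx.lt_iff_lt]
    exact Fin.rev_lt_rev.symm

end Weight

/-! ### Permutons with deterministic patterns of size two -/

/-- Almost all pairs of points are in increasing position (if `0 < ε`), or almost all pairs of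
points are in decreasing position (if `ε < 0`). -/
def IsMonotone (μ : Measure (ℝ × ℝ)) (ε : ℝ) : Prop :=
  ∀ᵐ q ∂(μ.prod μ), q.1.1 < q.2.1 → 0 < ε * (q.2.2 - q.1.2)

lemma measurableSet_monotone (ε : ℝ) : MeasurableSet {q : (ℝ × ℝ) × (ℝ × ℝ) |
    q.1.1 < q.2.1 → 0 < ε * (q.2.2 - q.1.2)} := by
  have h1 : MeasurableSet {q : (ℝ × ℝ) × (ℝ × ℝ) | q.1.1 < q.2.1} :=
    measurableSet_lt (by fun_prop) (by fun_prop)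
  have h2 : MeasurableSet {q : (ℝ × ℝ) × (ℝ × ℝ) | 0 < ε * (q.2.2 - q.1.2)} :=
    measurableSet_lt measurable_const (by fun_prop)
  simp only [imp_iff_not_or]
  exact h1.compl.union h2

lemma hasPattern_one_of_lt {p : Fin 2 → ℝ × ℝ} (h1 : (p 0).1 < (p 1).1) (h2 : (p 0).2 < (p 1).2) :
    HasPattern 1 p := by
  refine ⟨1, ?_, ?_⟩
  · intro i j hij
    fin_cases i <;> fin_cases j <;> simp_all
  · intro i j
    fin_cases i <;> fin_cases j <;> simp [h2, h2.le]

lemma HasPattern.snd_lt_of_one {n : ℕ} {p : Fin n → ℝ × ℝ} (h : HasPattern 1 p) {i j : Fin n}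
    (hij : (p i).1 < (p j).1) : (p i).2 < (p j).2 := by
  obtain ⟨e, he, h'⟩ := h
  have h1 := h' (e.symm i) (e.symm j)
  have h2 := he.lt_iff_lt (a := e.symm i) (b := e.symm j)
  simp only [Equiv.apply_symm_apply] at h1 h2
  exact h1.2 (h2.1 hij)

lemma isMonotone_of_pi {μ : Measure (ℝ × ℝ)} [IsProbabilityMeasure μ] {ε : ℝ}
    (h : ∀ᵐ p ∂(Measure.pi fun _ : Fin 2 => μ),
      (p 0).1 < (p 1).1 → 0 < ε * ((p 1).2 - (p 0).2)) : IsMonotone μ ε := by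
  rw [IsMonotone, ← pi_map_pair (fun _ : Fin 2 => μ) (show (0 : Fin 2) ≠ 1 by decide),
    ae_map_iff (by fun_prop) (measurableSet_monotone ε)]
  exact h

/-- Each summand of the entropy is nonnegative, so it vanishes and the increasing pattern has
density `0` or `1`. -/
lemma isMonotone_of_samplingEntropy_eq_zero {μ : Measure (ℝ × ℝ)} (hμ : IsPermuton μ)
    (h : samplingEntropy μ 2 = 0) : IsMonotone μ 1 ∨ IsMonotone μ (-1) := by
  have := hμ.isProbabilityMeasure
  have h0 : ∀ σ : Equiv.Perm (Fin 2), 0 ≤ Real.negMulLog (patternDensity μ σ) := fun σ =>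
    Real.negMulLog_nonneg measureReal_nonneg measureReal_le_one
  have h1 := (Finset.sum_eq_zero_iff_of_nonneg fun σ _ => h0 σ).1 h 1 (Finset.mem_univ _)
  have h2 : 0 ≤ patternDensity μ (1 : Equiv.Perm (Fin 2)) := measureReal_nonneg
  have h3 : patternDensity μ (1 : Equiv.Perm (Fin 2)) = 0 ∨
      patternDensity μ (1 : Equiv.Perm (Fin 2)) = 1 := by
    rw [Real.negMulLog, mul_eq_zero, neg_eq_zero, Real.log_eq_zero] at h1
    rcases h1 with h1 | h1 | h1 | h1
    · exact Or.inl h1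
    · exact Or.inl h1
    · exact Or.inr h1
    · linarith
  rcases h3 with h3 | h3
  · right
    apply isMonotone_of_pi
    have h4 : ∀ᵐ p ∂(Measure.pi fun _ : Fin 2 => μ), ¬ HasPattern 1 p := by
      rw [patternDensity, measureReal_eq_zero_iff] at h3
      exact measure_eq_zero_iff_ae_notMem.1 h3
    filter_upwards [h4, ae_generic (fun _ : Fin 2 => μ) fun _ => hμ.diffuse] with p hp hg hlt
    have h5 : (p 0).2 ≠ (p 1).2 := hg.2.ne (show (0 : Fin 2) ≠ 1 by decide)
    rcases lt_or_gt_of_ne h5 with h6 | h6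
    · exact absurd (hasPattern_one_of_lt hlt h6) hp
    · linarith
  · left
    apply isMonotone_of_pi
    have h4 : ∀ᵐ p ∂(Measure.pi fun _ : Fin 2 => μ), HasPattern 1 p := by
      rw [patternDensity, Measure.real, ENNReal.toReal_eq_one_iff] at h3
      exact (mem_ae_iff_prob_eq_one (measurableSet_hasPattern 1)).2 h3
    filter_upwards [h4] with p hp hlt
    have := hp.snd_lt_of_one hlt
    linarith

lemma map_cellMap_absolutelyContinuous {α : Equiv.Perm (Fin d)} {τ : Fin d → ℝ}
    {μ : Fin d → Measure (ℝ × ℝ)} {i : Fin d} (hi : 0 < τ i) :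
    (μ i).map (cellMap α τ i) ≪ inflate α τ μ := by
  refine Measure.AbsolutelyContinuous.mk fun s _ hs => ?_
  rw [inflate, Measure.finsetSum_apply, Finset.sum_eq_zero_iff] at hs
  have := hs i (Finset.mem_univ i)
  rw [Measure.smul_apply, smul_eq_mul, mul_eq_zero, ENNReal.ofReal_eq_zero] at this
  exact this.resolve_left (not_le.2 hi)

lemma IsMonotone.ae_cellMap {α : Equiv.Perm (Fin d)} {τ : Fin d → ℝ} {μ : Fin d → Measure (ℝ × ℝ)}
    [∀ i, IsProbabilityMeasure (μ i)] {ε : ℝ} (h : IsMonotone (inflate α τ μ) ε) {i j : Fin d}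
    (hi : 0 < τ i) (hj : 0 < τ j) : ∀ᵐ q ∂((μ i).prod (μ j)),
      (cellMap α τ i q.1).1 < (cellMap α τ j q.2).1 →
        0 < ε * ((cellMap α τ j q.2).2 - (cellMap α τ i q.1).2) := by
  have hfin : IsFiniteMeasure (inflate α τ μ) := by
    have (k : Fin d) : IsFiniteMeasure (ENNReal.ofReal (τ k) • (μ k).map (cellMap α τ k)) :=
      Measure.smul_finite _ ENNReal.ofReal_ne_top
    unfold inflate; infer_instance
  have h1 := (map_cellMap_absolutelyContinuous (α := α) (μ := μ) hi).prod
    (map_cellMap_absolutelyContinuous (α := α) (μ := μ) hj)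
  have h2 := h1.ae_le h
  rw [Measure.map_prod_map _ _ (by fun_prop) (by fun_prop)] at h2
  exact ae_of_ae_map (by fun_prop) h2

/-- The scaled copy of `μ i` is absolutely continuous with respect to the inflation, and a
similarity with positive ratio preserves orientation. -/
lemma IsMonotone.of_inflate {α : Equiv.Perm (Fin d)} {τ : Fin d → ℝ} {μ : Fin d → Measure (ℝ × ℝ)}
    [∀ i, IsProbabilityMeasure (μ i)] {ε : ℝ} (h : IsMonotone (inflate α τ μ) ε) {i : Fin d}
    (hi : 0 < τ i) : IsMonotone (μ i) ε := by
  filter_upwards [h.ae_cellMap hi hi] with q hq hlt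
  have h1 := hq (by
    have := mul_lt_mul_of_pos_left hlt hi
    simp only [cellMap]; linarith)
  have h2 : (cellMap α τ i q.2).2 - (cellMap α τ i q.1).2 = τ i * (q.2.2 - q.1.2) := by
    simp only [cellMap]; ring
  rw [h2, mul_left_comm] at h1
  exact pos_of_mul_pos_right h1 hi.le

/-- A single pair of points suffices. Almost every point of `μ i` has abscissa less than `1`, so its
image lies strictly to the left of the `j`-th cell even though the two cells may touch. -/
lemma IsMonotone.exists_cells {α : Equiv.Perm (Fin d)} {τ : Fin d → ℝ} (hτ : ∀ i, 0 < τ i)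
    {μ : Fin d → Measure (ℝ × ℝ)} (hμ : ∀ i, IsPermuton (μ i)) {ε : ℝ}
    (h : IsMonotone (inflate α τ μ) ε) {i j : Fin d} (hij : i < j) :
    ∃ x ∈ Set.Icc (0 : ℝ) 1, ∃ y ∈ Set.Icc (0 : ℝ) 1,
      0 < ε * ((offset α τ j + τ j * y) - (offset α τ i + τ i * x)) := by
  have (i : Fin d) := (hμ i).isProbabilityMeasure
  have h1 : ∀ᵐ p ∂(μ i), p.1 < 1 ∧ p.2 ∈ Set.Icc (0 : ℝ) 1 := by
    filter_upwards [(hμ i).ae_mem, measure_eq_zero_iff_ae_notMem.1 ((hμ i).diffuse.1 1)] with p h1 h2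
    exact ⟨lt_of_le_of_ne h1.1.2 h2, h1.2⟩
  have h2 := (hμ j).ae_mem
  have h3 := (Measure.quasiMeasurePreserving_fst (μ := μ i) (ν := μ j)).ae h1
  have h4 := (Measure.quasiMeasurePreserving_snd (μ := μ i) (ν := μ j)).ae h2
  obtain ⟨q, hq, hq1, hq2⟩ := (((h.ae_cellMap (hτ i) (hτ j)).and (h3.and h4))).exists
  refine ⟨q.1.2, hq1.2, q.2.2, hq2.2, hq ?_⟩
  have h5 := offset_add_le (α := 1) (fun i => (hτ i).le) (i := i) (k := j) hij
  have h6 := mul_lt_mul_of_pos_left hq1.1 (hτ i)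
  have h7 := mul_nonneg (hτ j).le hq2.1.1
  simp only [cellMap]
  linarith

/-- If `α` inverted a pair `i < j`, the `j`-th cell would lie entirely below the `i`-th,
contradicting the increasing pair from `exists_cells`. -/
lemma IsMonotone.eq_one {α : Equiv.Perm (Fin d)} {τ : Fin d → ℝ} (hτ : ∀ i, 0 < τ i)
    {μ : Fin d → Measure (ℝ × ℝ)} (hμ : ∀ i, IsPermuton (μ i))
    (h : IsMonotone (inflate α τ μ) 1) : α = 1 := by
  have hmono : StrictMono α := by
    intro i j hij
    by_contra hlt
    have hlt' : α j < α i := lt_of_le_of_ne (not_lt.1 hlt) (α.injective.ne hij.ne')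
    obtain ⟨x, hx, y, hy, hxy⟩ := h.exists_cells hτ hμ hij
    have h1 := offset_add_le (fun i => (hτ i).le) hlt'
    have h2 := mul_nonneg (hτ i).le hx.1
    have h3 := mul_le_mul_of_nonneg_left hy.2 (hτ j).le
    linarith
  exact perm_eq_of_lt_iff fun i j => hmono.lt_iff_lt

lemma IsMonotone.eq_revPerm {α : Equiv.Perm (Fin d)} {τ : Fin d → ℝ} (hτ : ∀ i, 0 < τ i)
    {μ : Fin d → Measure (ℝ × ℝ)} (hμ : ∀ i, IsPermuton (μ i))
    (h : IsMonotone (inflate α τ μ) (-1)) : α = Fin.revPerm := by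
  have hanti : StrictAnti α := by
    intro i j hij
    by_contra hlt
    have hlt' : α i < α j := lt_of_le_of_ne (not_lt.1 hlt) (α.injective.ne hij.ne)
    obtain ⟨x, hx, y, hy, hxy⟩ := h.exists_cells hτ hμ hij
    have h1 := offset_add_le (fun i => (hτ i).le) hlt'
    have h2 := mul_nonneg (hτ j).le hy.1
    have h3 := mul_le_mul_of_nonneg_left hx.2 (hτ i).le
    linarith
  exact perm_eq_of_lt_iff fun i j => by
    rw [hanti.lt_iff_gt]
    exact Fin.rev_lt_rev.symm

end
end RandomPermuton

namespace RandomPermuton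
noncomputable section

variable {d : ℕ} {F : Measure (Equiv.Perm (Fin d))} [IsProbabilityMeasure F]

/-! ### Vanishing of the entropy rate -/

lemma meanEntropy_eq_zero_iff (hd : 2 ≤ d) (n : ℕ) :
    meanEntropy F n = 0 ↔ ∀ᵐ ω ∂(sampleLaw F), sampleEntropy ω n = 0 :=
  integral_eq_zero_iff_of_nonneg (fun ω => sampleEntropy_nonneg ω n) (integrable_sampleEntropy hd n)

lemma ae_labels_eq (a : Equiv.Perm (Fin d)) (hF : F = Measure.dirac a) :
    ∀ᵐ ω ∂(sampleLaw F), labels ω = fun _ => a := by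
  have h1 : ∀ᵐ ω ∂(sampleLaw F), ∀ s, labels ω s = a := by
    rw [ae_all_iff]
    intro s
    have h2 : ∀ᵐ α ∂F, α = a := by rw [hF]; exact (ae_dirac_iff (MeasurableSet.of_discrete)).2 rfl
    exact (measurePreserving_eval_infinitePi (fun _ : Node d => nodeLaw F) s).quasiMeasurePreserving.ae
      ((Measure.quasiMeasurePreserving_fst (μ := F) (ν := spacingPoints d)).ae h2)
  filter_upwards [h1] with ω h using funext h

lemma meanEntropy_eq_zero_of_dirac (hd : 2 ≤ d)
    (hF : F = Measure.dirac 1 ∨ F = Measure.dirac Fin.revPerm) (n : ℕ) : meanEntropy F n = 0 := by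
  rw [meanEntropy_eq_zero_iff hd]
  rcases hF with hF | hF
  · filter_upwards [ae_labels_eq _ hF, ae_isFine hd] with ω h1 h2
    rw [sampleEntropy, samplePermuton, h1]
    exact samplingEntropy_treePermuton_one (isWeight_weights (by omega) ω) h2 n
  · filter_upwards [ae_labels_eq _ hF, ae_isFine hd] with ω h1 h2
    rw [sampleEntropy, samplePermuton, h1]
    exact samplingEntropy_treePermuton_revPerm (isWeight_weights (by omega) ω) h2 n

lemma IsMonotone.labels_eq (hd : 2 ≤ d) {ω : Sample d} (hpos : ∀ i, 0 < weights ω [] i)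
    (hsub : ∀ i, IsPermuton (samplePermuton (subtree i ω))) :
    (IsMonotone (samplePermuton ω) 1 → labels ω [] = 1) ∧
      (IsMonotone (samplePermuton ω) (-1) → labels ω [] = Fin.revPerm) := by
  rw [samplePermuton_eq_inflate (by omega) ω]
  exact ⟨fun h => h.eq_one hpos hsub, fun h => h.eq_revPerm hpos hsub⟩

/-- Entropy zero at size two makes the permuton monotone in one direction. The `i`-th subtree
inherits the direction, and the direction fixes both labels. -/
lemma ae_labels_eq_of_meanEntropy_eq_zero (hd : 2 ≤ d) (h : meanEntropy F 2 = 0) (i : Fin d) :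
    ∀ᵐ ω ∂(sampleLaw F), (labels ω [] = 1 ∧ labels (subtree i ω) [] = 1) ∨
      (labels ω [] = Fin.revPerm ∧ labels (subtree i ω) [] = Fin.revPerm) := by
  rw [meanEntropy_eq_zero_iff hd] at h
  have hroot : ∀ᵐ ω ∂(sampleLaw F), (IsMonotone (samplePermuton ω) 1 → labels ω [] = 1) ∧
      (IsMonotone (samplePermuton ω) (-1) → labels ω [] = Fin.revPerm) := by
    filter_upwards [ae_weights_pos hd, ae_isPermuton_subtree hd] with ω h1 h2 using
      IsMonotone.labels_eq hd h1 h2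
  filter_upwards [h, ae_isPermuton hd, ae_weights_pos hd, hroot, ae_subtree i hroot]
    with ω h1 h2 h3 h4 h5
  have hstep : ∀ ε, IsMonotone (samplePermuton ω) ε →
      IsMonotone (samplePermuton (subtree i ω)) ε := by
    intro ε hε
    rw [samplePermuton_eq_inflate (by omega) ω] at hε
    exact hε.of_inflate (h3 i)
  rcases isMonotone_of_samplingEntropy_eq_zero h2 h1 with hm | hm
  · exact Or.inl ⟨h4.1 hm, h5.1 (hstep _ hm)⟩
  · exact Or.inr ⟨h4.2 hm, h5.2 (hstep _ hm)⟩

lemma one_ne_revPerm (hd : 2 ≤ d) : (1 : Equiv.Perm (Fin d)) ≠ Fin.revPerm := by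
  intro h
  have := congrArg (fun σ : Equiv.Perm (Fin d) => (σ ⟨0, by omega⟩ : ℕ)) h
  simp at this
  omega

lemma eq_dirac_of_ae {a : Equiv.Perm (Fin d)} (h : ∀ᵐ α ∂F, α = a) : F = Measure.dirac a := by
  ext s hs
  rw [Measure.dirac_apply' a hs]
  by_cases ha : a ∈ s
  · rw [Set.indicator_of_mem ha, Pi.one_apply]
    refine (mem_ae_iff_prob_eq_one hs).1 ?_
    filter_upwards [h] with α hα using hα ▸ ha
  · rw [Set.indicator_of_notMem ha, measure_eq_zero_iff_ae_notMem]
    filter_upwards [h] with α hα using hα ▸ ha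

lemma eq_dirac_of_meanEntropy_eq_zero (hd : 2 ≤ d) (h : meanEntropy F 2 = 0) :
    F = Measure.dirac 1 ∨ F = Measure.dirac Fin.revPerm := by
  have i : Fin d := ⟨0, by omega⟩
  have hmap : (sampleLaw F).map (fun ω => (labels ω [], labels (subtree i ω) [])) = F.prod F := by
    have h1 := congrArg (Measure.map (Prod.map Prod.fst fun ω : Sample d => labels ω []))
      (map_root_subtree F i)
    rw [Measure.map_map (by fun_prop) (by fun_prop), ← Measure.map_prod_map _ _ (by fun_prop)
      (by fun_prop), Measure.map_fst_prod, measure_univ, one_smul] at h1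
    have h2 : (sampleLaw F).map (fun ω => labels ω []) = F := by
      have := congrArg (Measure.map Prod.fst) (map_root F)
      have hm : Measurable fun ω : Sample d => ω [] := measurable_pi_apply _
      rw [Measure.map_map measurable_fst hm, Measure.map_fst_prod,
        measure_univ, one_smul] at this
      exact this
    rw [h2] at h1
    exact h1
  have h1 : ∀ᵐ q ∂(F.prod F), (q.1 = 1 ∧ q.2 = 1) ∨ (q.1 = Fin.revPerm ∧ q.2 = Fin.revPerm) := by
    have hm : Measurable fun ω : Sample d => (labels ω [], labels (subtree i ω) []) :=
      (measurable_labels []).prodMk ((measurable_labels []).comp (measurable_subtree i))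
    rw [← hmap, ae_map_iff hm.aemeasurable (Set.toFinite _).measurableSet]
    exact ae_labels_eq_of_meanEntropy_eq_zero hd h i
  -- The labels of the root and of its child are independent with law `F`, yet almost surely they
  -- are not the identity and the reversal respectively.
  have h2 : F {1} * F {Fin.revPerm} = 0 := by
    rw [← Measure.prod_prod]
    refine measure_mono_null ?_ h1
    rintro ⟨a, b⟩ ⟨ha, hb⟩ hq
    simp only [Set.mem_singleton_iff] at ha hb
    subst ha hb
    rcases hq with ⟨_, h3⟩ | ⟨h3, _⟩
    · exact one_ne_revPerm hd h3.symm
    · exact one_ne_revPerm hd h3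
  have h3 : ∀ᵐ α ∂F, α = 1 ∨ α = Fin.revPerm := by
    have h4 : ∀ᵐ q ∂(F.prod F), q.1 = 1 ∨ q.1 = Fin.revPerm := by
      filter_upwards [h1] with q hq using hq.imp And.left And.left
    have h5 : (F.prod F).map Prod.fst = F := by
      rw [Measure.map_fst_prod, measure_univ, one_smul]
    rw [← h5]
    exact (ae_map_iff measurable_fst.aemeasurable MeasurableSet.of_discrete).2 h4
  rcases mul_eq_zero.1 h2 with h4 | h4
  · right
    apply eq_dirac_of_ae
    filter_upwards [h3, measure_eq_zero_iff_ae_notMem.1 h4] with α h5 h6 using h5.resolve_left h6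
  · left
    apply eq_dirac_of_ae
    filter_upwards [h3, measure_eq_zero_iff_ae_notMem.1 h4] with α h5 h6 using h5.resolve_right h6

end
end RandomPermuton

theorem theorem6 (d : ℕ) (hd : 2 ≤ d) (F : Measure (Equiv.Perm (Fin d)))
    [IsProbabilityMeasure F] :
    ∃ c : ℝ, 0 ≤ c ∧
      (∀ᵐ ω ∂(sampleLaw F), ∃ μ : FiniteMeasure (ℝ × ℝ),
        IsTreePermuton (labels ω) (weights ω) μ ∧
          Tendsto (fun n : ℕ => samplingEntropy (μ : Measure (ℝ × ℝ)) n / n) atTop (𝓝 c)) ∧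
      (c = 0 ↔ F = Measure.dirac (1 : Equiv.Perm (Fin d)) ∨
        F = Measure.dirac (Fin.revPerm : Equiv.Perm (Fin d))) := by
  obtain ⟨c, hc⟩ := exists_tendsto_meanEntropy F hd
  refine ⟨c, ge_of_tendsto' hc fun n => div_nonneg (meanEntropy_nonneg n) (Nat.cast_nonneg n),
    ?_, fun h0 => ?_, fun hF => ?_⟩
  · filter_upwards [ae_isFine hd, ae_tendsto_sampleEntropy hd hc] with ω h1 h2
    exact ⟨treeFiniteMeasure (labels ω) (weights ω),
      isTreePermuton (isWeight_weights (by omega) ω) h1 _, h2⟩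
  · apply eq_dirac_of_meanEntropy_eq_zero hd
    by_contra hne
    -- If the mean entropy of pairs were positive, the supersolution `meanEntropy F n / n` would
    -- stay away from zero.
    exact (pos_of_tendsto_meanEntropy hd hc one_le_two
      (lt_of_le_of_ne (meanEntropy_nonneg 2) (Ne.symm hne))).ne' h0
  · simp only [meanEntropy_eq_zero_of_dirac hd hF, zero_div] at hc
    exact tendsto_nhds_unique hc tendsto_const_nhds
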